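/- Let $\nu$ be the standard Gaussian probability measure on $\mathbb{R}$ and $L^2 := L^2((-1,1)\times\mathbb{R},\ dx\otimes d\nu)$ (real valued, points written $(x,t)$). Let $H_k$ be the Hermite polynomials normalized in $L^2(\mathbb{R},\nu)$, let $P_j$ be the Legendre polynomials normalized in $L^2(-1,1)$, and for $f\in L^2$ put $$b_{k,j}=b_{k,j}(f):=\int_{\mathbb{R}}\int_{-1}^1 f(x,t)\,H_k(t)\,P_j(x)\,dx\,d\nu(t),\qquad k,j\ge 0 .$$ For integers $n,m\ge 0$ let $$|f|_{W^{j,k}}^2:=\int_{\mathbb{R}}\int_{-1}^1\bigl(\partial_t^k\partial_x^j f\bigr)^2(1-x^2)^j\,dx\,d\nu,\qquad \|f\|_{W^{n,m}}^2:=\sum_{j=0}^n\sum_{k=0}^m|f|_{W^{j,k}}^2,$$ where derivatives are weak derivatives on $(-1,1)\times\mathbb{R}$, and let $W^{n,m}$ be the closure in this norm of the span of the functions $g(x)h(t)$ with $g\in H^n(-1,1)$, $h\in H^m(\mathbb{R})$ (standard Sobolev spaces). Put $W^n:=W^{n,n}$ for integers $n\ge0$, and for $n<\eta<n+1$ let $W^\eta:=(W^n,W^{n+1})_{\eta-n,2}$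 be the real interpolation space with $$\|f\|_{W^\eta}^2:=\int_0^\infty r^{-2(\eta-n)}J(r,f)^2\,\frac{dr}{r},\qquad J(r,f):=\inf_{f=v+w,\ v\in W^n,\ w\in W^{n+1}}\bigl(\|v\|_{W^n}+r\|w\|_{W^{n+1}}\bigr).$$ Write $k_*:=\max(k,1)$. Then the following hold. 1. For every real $\eta\ge 0$ and every $f\in L^2$: $f\in W^\eta$ if and only if $\sum_{k,j\ge 0}b_{k,j}^2\,k_*^{\eta}\,j_*^{2\eta}<\infty$. Moreover there are constants $c,C>0$ depending only on $\eta$ such that for all $f\in W^\eta$ $$c\sum_{k,j\ge 0}b_{k,j}^2\,k_*^{\eta}\,j_*^{2\eta}\ \le\ \|f\|_{W^\eta}^2\ \le\ C\sum_{k,j\ge 0}b_{k,j}^2\,k_*^{\eta}\,j_*^{2\eta}.$$ 2. For every integer $n\ge 0$ and every $f\in L^2$: $\sum_{k,j\ge n}b_{k,j}^2\,k^nj^{2n}<\infty$ if and only if the weak derivative $\partial_t^n\partial_x^n f$ exists as a locally integrable function on $(-1,1)\times\mathbb{R}$ and $(1-x^2)^{n/2}\,\partial_t^n\partial_x^n f\in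 L^2$. In this case the sum and $\int_{\mathbb{R}}\int_{-1}^1(\partial_t^n\partial_x^n f)^2(1-x^2)^n\,dx\,d\nu$ bound each other up to positive constants that depend only on $n$. 3. Let $\psi_I:[-1,1]\times\mathbb{R}\to\mathbb{R}$ be a continuous function such that $\psi_I(u,-t)=\psi_I(u,t)$ and $((\mathbf{x},t),(\mathbf{y},s))\mapsto\psi_I(\langle \mathbf{x},\mathbf{y}\rangle,t-s)$ is positive definite on $\mathbb{S}^2\times\mathbb{R}$ (the kernel of an isotropic stationary covariance), let $\varphi_j(t):=\int_{-1}^1\psi_I(x,t)P_j(x)\,dx$ and let $\alpha_{k,j}:=\int_{\mathbb{R}}\varphi_jH_k\,d\nu$ be its Hermite power spectrum. Then $\psi_I\in L^2$, and for every integer $n\ge 0$: (a) $\psi_I\in W^n$ if and only if $\sum_{k,j\ge 0}\alpha_{k,j}^2\,k_*^nj_*^{2n}<\infty$, and in this case $(\alpha_{k,j}k^{n/2}j^n)_{k,j\ge 0}\in\ell^2$; (b) $\sum_{k,j\ge n}\alpha_{k,j}^2\,k^nj^{2n}<\infty$ if and only if $\partial_t^n\partial_x^n\psi_I$ exists as a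 weak derivative on $(-1,1)\times\mathbb{R}$ and $(1-x^2)^{n/2}\,\partial_t^n\partial_x^n\psi_I\in L^2$, i.e. $\int_{\mathbb{R}}\int_{-1}^1(\partial_t^n\partial_x^n\psi_I)^2(1-x^2)^n\,dx\,d\nu<\infty$. -/

import Mathlib

open MeasureTheory ProbabilityTheory Set
open scoped ENNReal ContDiff

noncomputable section

namespace HermiteLegendre

/-- The open strip `(-1,1) × ℝ`; a point is written `(x, t)`. -/
def strip : Set (ℝ × ℝ) := Ioo (-1 : ℝ) 1 ×ˢ univ

/-- The measure `dx ⊗ dν` on the strip, `ν` being the standard Gaussian probability measure. -/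
def stripMeasure : Measure (ℝ × ℝ) :=
  (volume.restrict (Ioo (-1 : ℝ) 1)).prod (gaussianReal 0 1)

/-- The real Hilbert space `L²((-1,1) × ℝ)` with respect to `dx ⊗ dν`. -/
abbrev L2 : Type := Lp ℝ 2 stripMeasure

/-! ### Orthonormal polynomials and Fourier coefficients -/

/-- Hermite polynomials (probabilists' version), orthonormal in `L²(ℝ, ν)`. -/
def hermiteN (k : ℕ) (t : ℝ) : ℝ :=
  Polynomial.aeval t (Polynomial.hermite k) / √(k.factorial : ℝ)

/-- Legendre polynomials (Rodrigues' formula), orthonormal in `L²(-1,1)`. -/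
def legendreN (j : ℕ) (x : ℝ) : ℝ :=
  √((2 * j + 1) / 2) * (iteratedDeriv j (fun y : ℝ => (y ^ 2 - 1) ^ j) x / (2 ^ j * (j.factorial : ℝ)))

/-- The coefficient `b_{k,j}` of `f` with respect to `H_k(t) P_j(x)`. -/
def coeff (f : L2) (k j : ℕ) : ℝ :=
  ∫ p, f p * hermiteN k p.2 * legendreN j p.1 ∂stripMeasure

/-! ### Weak derivatives and weighted Sobolev norms on the strip -/

/-- `g` is the weak derivative `∂_t^k ∂_x^j f` on the strip. -/
def HasWeakDeriv (j k : ℕ) (f g : ℝ × ℝ → ℝ) : Prop :=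
  LocallyIntegrableOn g strip ∧
    ∀ φ : ℝ × ℝ → ℝ, ContDiff ℝ ∞ φ → HasCompactSupport φ → tsupport φ ⊆ strip →
      ∫ p in strip,
          f p * iteratedDeriv k (fun t => iteratedDeriv j (fun x => φ (x, t)) p.1) p.2
        = (-1) ^ (j + k) * ∫ p in strip, g p * φ p

/-- The square of the seminorm `|f|_{W^{j,k}}`, i.e. the integral of
`(∂_t^k ∂_x^j f)² (1 - x²)^j` with respect to `dx dν`. The weak derivative is unique up to null
sets, so the infimum only says that the value is `∞` if the derivative does not exist. -/
def seminormSq (j k : ℕ) (f : L2) : ℝ≥0∞ :=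
  ⨅ (g : ℝ × ℝ → ℝ) (_ : HasWeakDeriv j k f g),
    ∫⁻ p, ENNReal.ofReal (g p ^ 2 * (1 - p.1 ^ 2) ^ j) ∂stripMeasure

/-- The square of the norm of `W^{n,m}`. -/
def sobolevNormSq (n m : ℕ) (f : L2) : ℝ≥0∞ :=
  ∑ j ∈ Finset.range (n + 1), ∑ k ∈ Finset.range (m + 1), seminormSq j k f

/-! ### The spaces `W^{n,m}` -/

/-- The standard Sobolev space `H^n(U)`, `U ⊆ ℝ` open: `g` and its weak derivatives up to order
`n` are in `L²(U)` (with respect to Lebesgue measure). -/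
def MemSobolev (U : Set ℝ) (n : ℕ) (g : ℝ → ℝ) : Prop :=
  MemLp g 2 (volume.restrict U) ∧
    ∀ i ≤ n, ∃ g' : ℝ → ℝ, MemLp g' 2 (volume.restrict U) ∧
      ∀ φ : ℝ → ℝ, ContDiff ℝ ∞ φ → HasCompactSupport φ → tsupport φ ⊆ U →
        ∫ x in U, g x * iteratedDeriv i φ x = (-1) ^ i * ∫ x in U, g' x * φ x

/-- The (algebraic) tensor product of `H^n(-1,1)` and `H^m(ℝ)` inside `L²`: the span of the
functions `(x, t) ↦ g x * h t`. -/
def tensorSobolev (n m : ℕ) : Submodule ℝ L2 :=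
  Submodule.span ℝ {f : L2 | ∃ g h : ℝ → ℝ, MemSobolev (Ioo (-1) 1) n g ∧
    MemSobolev univ m h ∧ f =ᵐ[stripMeasure] fun p => g p.1 * h p.2}

/-- `W^{n,m}`: the closure of the tensor product of `H^n(-1,1)` and `H^m(ℝ)` with respect to the
weighted norm. -/
def sobolevSpace (n m : ℕ) : Set L2 :=
  {f | sobolevNormSq n m f < ⊤ ∧
    ∀ ε : ℝ≥0∞, 0 < ε → ∃ u ∈ tensorSobolev n m, sobolevNormSq n m (f - u) < ε}

/-! ### The interpolation spaces `W^η` -/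

/-- The functional `J(r, f) = inf (‖v‖_{W^n} + r ‖w‖_{W^{n+1}})`, the infimum being over all
decompositions `f = v + w` with `v ∈ W^n = W^{n,n}` and `w ∈ W^{n+1} = W^{n+1,n+1}`. -/
def functionalJ (n : ℕ) (r : ℝ) (f : L2) : ℝ≥0∞ :=
  ⨅ (v : L2) (w : L2) (_ : v ∈ sobolevSpace n n) (_ : w ∈ sobolevSpace (n + 1) (n + 1))
    (_ : f = v + w),
    sobolevNormSq n n v ^ (1 / 2 : ℝ)
      + ENNReal.ofReal r * sobolevNormSq (n + 1) (n + 1) w ^ (1 / 2 : ℝ)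

/-- The square of the norm of the real interpolation space `(W^n, W^{n+1})_{θ,2}`. -/
def interpNormSq (n : ℕ) (θ : ℝ) (f : L2) : ℝ≥0∞ :=
  ∫⁻ r in Ioi (0 : ℝ), ENNReal.ofReal (r ^ (-2 * θ) / r) * functionalJ n r f ^ 2

open Classical in
/-- The square of the norm of `W^η`, `η ≥ 0`. -/
def normSqW (η : ℝ) (f : L2) : ℝ≥0∞ :=
  if η = ⌊η⌋₊ then sobolevNormSq ⌊η⌋₊ ⌊η⌋₊ f else interpNormSq ⌊η⌋₊ (η - ⌊η⌋₊) f

open Classical in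
/-- The space `W^η`, `η ≥ 0`: the weighted Sobolev space `W^{n,n}` if `η = n` is an integer, and
`(W^n, W^{n+1})_{η-n,2}` if `n < η < n + 1`. -/
def spaceW (η : ℝ) : Set L2 :=
  if η = ⌊η⌋₊ then sobolevSpace ⌊η⌋₊ ⌊η⌋₊
  else {f | interpNormSq ⌊η⌋₊ (η - ⌊η⌋₊) f < ⊤}

/-! ### Covariance kernels on `S² × ℝ` -/

/-- `ψ` is the kernel, written in terms of `u = ⟨x, y⟩` and of the time lag, of a continuous,
spatially isotropic and temporally stationary covariance function on `S² × ℝ`. -/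
structure IsCovarianceKernel (ψ : ℝ → ℝ → ℝ) : Prop where
  continuousOn : ContinuousOn (fun p : ℝ × ℝ => ψ p.1 p.2) (Icc (-1) 1 ×ˢ univ)
  symm : ∀ u ∈ Icc (-1 : ℝ) 1, ∀ t, ψ u (-t) = ψ u t
  posDef : ∀ (s : Finset (Metric.sphere (0 : EuclideanSpace ℝ (Fin 3)) 1 × ℝ))
    (c : Metric.sphere (0 : EuclideanSpace ℝ (Fin 3)) 1 × ℝ → ℝ),
    0 ≤ ∑ p ∈ s, ∑ q ∈ s, c p * c q *
      ψ (inner ℝ (p.1 : EuclideanSpace ℝ (Fin 3)) (q.1 : EuclideanSpace ℝ (Fin 3))) (p.2 - q.2)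

/-- The function `φ_j(t)`: the coefficient of `ψ(·, t)` with respect to `P_j`. -/
def schoenbergFun (ψ : ℝ → ℝ → ℝ) (j : ℕ) (t : ℝ) : ℝ :=
  ∫ x in Ioo (-1 : ℝ) 1, ψ x t * legendreN j x

/-- The spatio-temporal Hermite power spectrum `α_{k,j}`: the coefficient of `φ_j` with respect
to `H_k` in `L²(ℝ, ν)`. -/
def spectrumCoeff (ψ : ℝ → ℝ → ℝ) (k j : ℕ) : ℝ :=
  ∫ t, schoenbergFun ψ j t * hermiteN k t ∂(gaussianReal 0 1)

/-! ### Weighted sums of squares of coefficients -/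

/-- The terms `b_{k,j}² k^η j^{2η}`, an index `0` being replaced by `1` in the weight. -/
def weightedTerm (b : ℕ → ℕ → ℝ) (η : ℝ) (p : ℕ × ℕ) : ℝ :=
  b p.1 p.2 ^ 2 * ((max p.1 1 : ℕ) : ℝ) ^ η * ((max p.2 1 : ℕ) : ℝ) ^ (2 * η)

/-- The terms `b_{k,j}² k^n j^{2n}` with `k = n + p.1 ≥ n` and `j = n + p.2 ≥ n`. -/
def tailTerm (b : ℕ → ℕ → ℝ) (n : ℕ) (p : ℕ × ℕ) : ℝ :=
  b (n + p.1) (n + p.2) ^ 2 * ((n + p.1 : ℕ) : ℝ) ^ n * ((n + p.2 : ℕ) : ℝ) ^ (2 * n)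

end HermiteLegendre

end

open HermiteLegendre

noncomputable section

namespace HermiteLegendre

open Polynomial Filter Topology

/-! ### Normalized Hermite polynomials -/

/-! Everything reduces to weighted sequence spaces, because differentiation acts diagonally between
orthonormal bases. The functions `H_m(t) P_l(x)` form an orthonormal basis of `L²(dx ⊗ dν)`. The
derivative `∂_t^k ∂_x^j` sends those with `m ≥ k`, `l ≥ j` to multiples of the basis `H_{m-k}(t) ·
gegenP j (l-j)` of `L²((1-x²)^j dx ⊗ dν)` and kills the others. Orthonormality follows from ladder
operators (`integral_hermiteP_mul`, `integral_gegenP_mul`), completeness from uniqueness of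
characteristic functions (`ae_eq_zero_of_integral_mul_monomial`).

For weak derivatives this has to be shown in two directions. If the formal coefficients of the
derivative are square summable, Riesz–Fischer yields a candidate, and Parseval against test
functions confirms it (`exists_hasWeakDeriv`). Conversely, the coefficients of a given weak
derivative are found by testing with truncated basis functions times the density
(`HasWeakDeriv.fourierCoeff_eq`). The truncation at `x = ±1` is harmless since the weight `(1-x²)^j`
vanishes there to the order of the derivative. Hence each seminorm is an explicit weighted sum of
squares (`seminormSq_eq`), with weights given by descending factorials comparable to `k_*^n
j_*^{2n}` (`exists_sobolevWeight_bounds`). Taking the closure of the tensor product loses nothing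
(`mem_sobolevSpace_iff`).

For noninteger order, `J(r, f)²` is comparable to the sum of `b²` times the minimum of the two
weights: splitting the indices according to the smaller weight is an almost optimal decomposition
(`exists_minSum_le_functionalJ`, `exists_functionalJ_le_minSum`). Integrating in `r` term by term
gives the geometric mean of the weights (`lintegral_minSum`). A covariance kernel is bounded by its
value at the origin (`IsCovarianceKernel.abs_le`), so it lies in `L²`, and Fubini identifies its
power spectrum with its coefficients. -/

/-- The normalized Hermite polynomial `H_k` as an element of `ℝ[X]`. -/
def hermiteP (k : ℕ) : ℝ[X] :=
  C (√(k.factorial : ℝ))⁻¹ * (hermite k).map (Int.castRingHom ℝ)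

lemma hermiteN_eq (k : ℕ) (t : ℝ) : hermiteN k t = (hermiteP k).eval t := by
  simp [hermiteN, hermiteP, aeval_def, eval_map, div_eq_inv_mul]

/-- Differentiating the recursion `He_{n+1} = X He_n - He_n'` reproduces the claim from the
preceding index. -/
lemma derivative_hermite_succ (n : ℕ) :
    derivative (hermite (n + 1)) = ((n : ℤ[X]) + 1) * hermite n := by
  induction n with
  | zero => simp
  | succ n ih =>
    rw [hermite_succ (n + 1), derivative_sub, derivative_mul, ih, hermite_succ n]
    simp only [derivative_X, derivative_mul, derivative_add, derivative_natCast,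
      derivative_one]
    push_cast
    ring

lemma sqrt_factorial_succ (k : ℕ) :
    √((k + 1).factorial : ℝ) = √((k : ℝ) + 1) * √(k.factorial : ℝ) := by
  rw [Nat.factorial_succ, Nat.cast_mul, Real.sqrt_mul (by positivity)]
  norm_cast

lemma sqrt_factorial_ne_zero (k : ℕ) : √(k.factorial : ℝ) ≠ 0 := by
  have := k.factorial_pos
  positivity

/-- The lowering operator; the normalization turns the factor `k + 1` into its square root. -/
lemma derivative_hermiteP_succ (k : ℕ) :
    derivative (hermiteP (k + 1)) = C √((k : ℝ) + 1) * hermiteP k := by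
  have h1 : (√((k : ℝ) + 1)) ≠ 0 := by positivity
  have h2 := sqrt_factorial_ne_zero k
  have h3 : ((k : ℝ[X]) + 1) = C (√((k : ℝ) + 1) * √((k : ℝ) + 1)) := by
    rw [Real.mul_self_sqrt (by positivity)]
    simp
  rw [hermiteP, hermiteP, derivative_C_mul, derivative_map, derivative_hermite_succ,
    sqrt_factorial_succ]
  simp only [Polynomial.map_mul, Polynomial.map_add, Polynomial.map_natCast, Polynomial.map_one]
  rw [h3, ← mul_assoc, ← mul_assoc, ← C_mul, ← C_mul]
  congr 2
  field_simp

/-- The raising operator: up to the Gaussian factor, the left side is the derivative of `H_k` times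
the Gaussian density. Up to sign it is the adjoint of differentiation in `L²(ν)`. -/
lemma X_mul_hermiteP_sub (k : ℕ) :
    derivative (hermiteP k) - X * hermiteP k = C (-√((k : ℝ) + 1)) * hermiteP (k + 1) := by
  have h1 : (√((k : ℝ) + 1)) ≠ 0 := by positivity
  have h2 := sqrt_factorial_ne_zero k
  have h4 : (√(k.factorial : ℝ))⁻¹ = √((k : ℝ) + 1) * (√((k + 1).factorial : ℝ))⁻¹ := by
    rw [sqrt_factorial_succ]
    field_simp
  rw [hermiteP, hermiteP, hermite_succ, derivative_C_mul, derivative_map, h4]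
  simp only [Polynomial.map_sub, Polynomial.map_mul, Polynomial.map_X, C_mul, C_neg]
  ring

lemma degree_hermiteP (k : ℕ) : (hermiteP k).degree = k := by
  rw [hermiteP, degree_C_mul (inv_ne_zero (sqrt_factorial_ne_zero k)),
    (hermite_monic k).degree_map, degree_hermite]

/-! ### The Gaussian weight and orthonormality of the Hermite polynomials. -/

/-- The standard Gaussian density. -/
abbrev gaussDens (t : ℝ) : ℝ := gaussianPDFReal 0 1 t

lemma gaussDens_pos (t : ℝ) : 0 < gaussDens t := gaussianPDFReal_pos 0 1 t one_ne_zero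

lemma gaussDens_eq (t : ℝ) : gaussDens t = (√(2 * Real.pi))⁻¹ * Real.exp (-t ^ 2 / 2) := by
  simp [gaussDens, gaussianPDFReal]

lemma contDiff_gaussDens : ContDiff ℝ ∞ gaussDens := by
  have : gaussDens = fun t => (√(2 * Real.pi))⁻¹ * Real.exp (-t ^ 2 / 2) :=
    funext gaussDens_eq
  rw [this]
  fun_prop

lemma hasDerivAt_gaussDens (t : ℝ) : HasDerivAt gaussDens (-t * gaussDens t) t := by
  have : gaussDens = fun t => (√(2 * Real.pi))⁻¹ * Real.exp (-t ^ 2 / 2) :=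
    funext gaussDens_eq
  rw [this]
  have h : HasDerivAt (fun t : ℝ => -t ^ 2 / 2) (-t) t := by
    have := ((hasDerivAt_pow 2 t).neg).div_const 2
    convert! this using 1
    simp; ring
  convert! (h.exp.const_mul (√(2 * Real.pi))⁻¹) using 1
  ring

lemma gaussianReal_eq : gaussianReal 0 1 = volume.withDensity (gaussianPDF 0 1) :=
  gaussianReal_of_var_ne_zero 0 one_ne_zero

lemma integral_gaussian (f : ℝ → ℝ) :
    ∫ t, f t ∂(gaussianReal 0 1) = ∫ t, f t * gaussDens t := by
  rw [integral_gaussianReal_eq_integral_smul one_ne_zero]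
  simp [mul_comm]

lemma integrable_gaussian_iff (f : ℝ → ℝ) :
    Integrable f (gaussianReal 0 1) ↔ Integrable (fun t => f t * gaussDens t) := by
  rw [gaussianReal_eq, integrable_withDensity_iff (measurable_gaussianPDF 0 1)
    (by simp [gaussianPDF])]
  simp [toReal_gaussianPDF]

lemma integrable_poly_gaussian (p : ℝ[X]) :
    Integrable (fun t => p.eval t) (gaussianReal 0 1) := by
  induction p using Polynomial.induction_on' with
  | add p q hp hq => simpa only [eval_add] using hp.fun_add hq
  | monomial n a =>
    simp only [eval_monomial]
    refine Integrable.const_mul ?_ a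
    have : MemLp id (n : ENNReal) (gaussianReal 0 1) := by
      exact_mod_cast memLp_id_gaussianReal (μ := 0) (v := 1) n
    have h := this.integrable_norm_pow'
    refine h.mono (by fun_prop) (by simp)

/-- Gaussian integration by parts for polynomials. -/
lemma integral_derivative_sub_X_mul (p : ℝ[X]) :
    ∫ t, (derivative p - X * p).eval t ∂(gaussianReal 0 1) = 0 := by
  rw [integral_gaussian]
  refine integral_eq_zero_of_hasDerivAt_of_integrable (f := fun t => p.eval t * gaussDens t)
    (fun t => ?_) ?_ ?_
  · convert! (p.hasDerivAt t).mul (hasDerivAt_gaussDens t) using 1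
    simp
    ring
  · exact (integrable_gaussian_iff _).1 (integrable_poly_gaussian _)
  · exact (integrable_gaussian_iff _).1 (integrable_poly_gaussian _)

/-- Integrating by parts with `H_a H_{b+1}`, raising the first factor and lowering the second, gives
`√(a+1) ⟨H_{a+1}, H_{b+1}⟩ = √(b+1) ⟨H_a, H_b⟩`. This descends to pairings with a constant, which
vanish because a raised polynomial has mean zero. -/
lemma integral_hermiteP_mul (a b : ℕ) :
    ∫ t, (hermiteP a).eval t * (hermiteP b).eval t ∂(gaussianReal 0 1)
      = if a = b then 1 else 0 := by
  have zero : ∀ b, ∫ t, (hermiteP 0).eval t * (hermiteP (b + 1)).eval t ∂(gaussianReal 0 1) = 0 := by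
    intro b
    have h := integral_derivative_sub_X_mul (hermiteP b)
    rw [X_mul_hermiteP_sub] at h
    simp only [eval_mul, eval_C, integral_const_mul] at h
    have h1 : (-√((b : ℝ) + 1)) ≠ 0 := by
      have : 0 < √((b : ℝ) + 1) := by positivity
      exact neg_ne_zero.2 this.ne'
    have h2 := (mul_eq_zero.1 h).resolve_left h1
    simpa [hermiteP] using h2
  induction a generalizing b with
  | zero =>
    cases b with
    | zero => simp [hermiteP]
    | succ b => simpa using zero b
  | succ a ih =>
    cases b with
    | zero =>
      simp_rw [mul_comm ((hermiteP (a + 1)).eval _)]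
      simpa using zero a
    | succ b =>
      have h := integral_derivative_sub_X_mul (hermiteP a * hermiteP (b + 1))
      have e : derivative (hermiteP a * hermiteP (b + 1)) - X * (hermiteP a * hermiteP (b + 1))
          = C (-√((a : ℝ) + 1)) * (hermiteP (a + 1) * hermiteP (b + 1))
            + C √((b : ℝ) + 1) * (hermiteP a * hermiteP b) := by
        rw [derivative_mul, derivative_hermiteP_succ, ← mul_assoc (C (-√((a : ℝ) + 1))),
          ← X_mul_hermiteP_sub]
        ring
      rw [e] at h
      simp only [eval_add, eval_mul, eval_C] at h
      rw [integral_add, integral_const_mul, integral_const_mul, ih b] at h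
      · have h1 : 0 < √((a : ℝ) + 1) := by positivity
        by_cases hab : a = b
        · subst hab
          simp only [if_true] at h ⊢
          have : √((a : ℝ) + 1) * (∫ t, (hermiteP (a + 1)).eval t * (hermiteP (a + 1)).eval t
            ∂(gaussianReal 0 1)) = √((a : ℝ) + 1) * 1 := by linarith
          exact mul_left_cancel₀ h1.ne' this
        · simp only [hab, if_false, mul_zero, add_zero] at h
          have := (mul_eq_zero.1 h).resolve_left (neg_ne_zero.2 h1.ne')
          simpa [hab] using this
      · simpa using (integrable_poly_gaussian (hermiteP (a + 1) * hermiteP (b + 1))).const_mul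
          (-√((a : ℝ) + 1))
      · simpa using (integrable_poly_gaussian (hermiteP a * hermiteP b)).const_mul √((b : ℝ) + 1)

lemma iteratedDeriv_eval (p : ℝ[X]) (n : ℕ) :
    iteratedDeriv n (fun x => p.eval x) = fun x => (derivative^[n] p).eval x := by
  induction n generalizing p with
  | zero => simp
  | succ n ih =>
    rw [iteratedDeriv_succ']
    have : deriv (fun x => p.eval x) = fun x => (derivative p).eval x := by
      ext x; simp
    rw [this, ih]
    simp

/-- The raising operator is applied `k` times, and the descending factorial collects the factors
`m+1, …, m+k`. -/
lemma iteratedDeriv_hermiteP_mul_gaussDens (k m : ℕ) :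
    iteratedDeriv k (fun t => (hermiteP m).eval t * gaussDens t)
      = fun t => (-1) ^ k * √((m + k).descFactorial k : ℝ) *
        ((hermiteP (m + k)).eval t * gaussDens t) := by
  induction k generalizing m with
  | zero => simp
  | succ k ih =>
    rw [iteratedDeriv_succ']
    have h : deriv (fun t => (hermiteP m).eval t * gaussDens t)
        = fun t => (-√((m : ℝ) + 1)) * ((hermiteP (m + 1)).eval t * gaussDens t) := by
      ext t
      refine HasDerivAt.deriv ?_
      have e := congrArg (eval t) (X_mul_hermiteP_sub m)
      simp only [eval_sub, eval_mul, eval_X, eval_C] at e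
      convert! ((hermiteP m).hasDerivAt t).mul (hasDerivAt_gaussDens t) using 1
      rw [← mul_assoc, ← e]; ring
    rw [h]
    ext t
    rw [iteratedDeriv_const_mul_field, ih]
    have e : (((m + (k + 1)).descFactorial (k + 1) : ℕ) : ℝ)
        = ((m : ℝ) + 1) * ((m + 1 + k).descFactorial k : ℝ) := by
      rw [show m + (k + 1) = m + 1 + k by ring, Nat.descFactorial_succ]
      rw [show m + 1 + k - k = m + 1 by omega]
      push_cast; ring
    rw [e, Real.sqrt_mul (by positivity), show m + (k + 1) = m + 1 + k by ring, pow_succ]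
    ring

/-- `H_m^{(k)}` is a multiple of `H_{m-k}`. -/
lemma iterate_derivative_hermiteP_add (k m : ℕ) :
    derivative^[k] (hermiteP (m + k)) = C √((m + k).descFactorial k : ℝ) * hermiteP m := by
  induction k with
  | zero => simp
  | succ k ih =>
    rw [Function.iterate_succ_apply, ← add_assoc, derivative_hermiteP_succ,
      iterate_derivative_C_mul, ih, ← mul_assoc, ← C_mul, Nat.succ_descFactorial_succ, Nat.cast_mul,
      Real.sqrt_mul (by positivity)]
    push_cast
    rfl

lemma iterate_derivative_hermiteP_of_lt {k m : ℕ} (h : m < k) :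
    derivative^[k] (hermiteP m) = 0 := by
  apply iterate_derivative_eq_zero
  rwa [natDegree_eq_of_degree_eq_some (degree_hermiteP m)]

/-! ### Normalized Legendre polynomials and their derivatives -/

/-- The normalized Legendre polynomial `P_l` as an element of `ℝ[X]`. -/
def legendreP (l : ℕ) : ℝ[X] :=
  C (√((2 * l + 1) / 2) / (2 ^ l * (l.factorial : ℝ))) * derivative^[l] ((X ^ 2 - 1) ^ l)

lemma legendreN_eq (l : ℕ) (x : ℝ) : legendreN l x = (legendreP l).eval x := by
  have h : (fun y : ℝ => (y ^ 2 - 1) ^ l) = fun y => ((X ^ 2 - 1) ^ l : ℝ[X]).eval y := by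
    ext y; simp
  rw [legendreN, legendreP, h, iteratedDeriv_eval]
  simp only [eval_mul, eval_C]
  ring

/-- With `w = (X²-1)^l` one has `(X²-1) w' = 2 l X w`; this is its derivative of order `i + 1`. -/
lemma iterate_derivative_sq_sub_one (l i : ℕ) :
    (X ^ 2 - 1) * derivative^[i + 2] ((X ^ 2 - 1 : ℝ[X]) ^ l)
      + C (2 * ((i : ℝ) + 1) - 2 * l) * (X * derivative^[i + 1] ((X ^ 2 - 1 : ℝ[X]) ^ l))
      + C (((i : ℝ) + 1) * (i - 2 * l)) * derivative^[i] ((X ^ 2 - 1 : ℝ[X]) ^ l) = 0 := by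
  induction i with
  | zero =>
    have h : (X ^ 2 - 1) * derivative ((X ^ 2 - 1 : ℝ[X]) ^ l)
        = C (2 * (l : ℝ)) * (X * (X ^ 2 - 1) ^ l) := by
      cases l with
      | zero => simp
      | succ l =>
        rw [derivative_pow]
        simp only [derivative_sub, derivative_one, derivative_X_pow, Nat.add_sub_cancel, C_mul,
          map_natCast, map_ofNat]
        simp
        ring
    have h' := congrArg derivative h
    simp only [derivative_mul, derivative_sub, derivative_one, derivative_X_pow, derivative_C,
      derivative_X] at h'
    simp only [Function.iterate_succ, Function.iterate_zero, Function.comp, id]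
    simp only [C_mul, C_sub, C_add, map_natCast, map_ofNat, C_1] at h' ⊢
    simp at h' ⊢
    linear_combination h'
  | succ i ih =>
    have h' := congrArg derivative ih
    simp only [derivative_mul, derivative_add, derivative_sub, derivative_one, derivative_X_pow,
      derivative_C, derivative_X, ← Function.iterate_succ_apply' (⇑derivative), derivative_zero] at h'
    simp only [C_mul, C_sub, C_add, map_natCast, map_ofNat, C_1] at h' ⊢
    simp only [Nat.succ_eq_add_one] at h'
    push_cast at h' ⊢
    simp at h' ⊢
    linear_combination h'

/-- The Sturm-Liouville form of the differential equation of `P_l^{(j)}`. -/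
lemma derivative_weight_mul_legendreP (l j : ℕ) :
    derivative ((1 - X ^ 2) ^ (j + 1) * derivative^[j + 1] (legendreP l))
      = C (-(((l : ℝ) - j) * (l + j + 1))) * ((1 - X ^ 2) ^ j * derivative^[j] (legendreP l)) := by
  -- By Rodrigues' formula, `P_l^{(j)}` is a multiple of the derivative of order `l + j` of
  -- `(X²-1)^l`.
  have h := iterate_derivative_sq_sub_one l (l + j)
  simp only [legendreP, iterate_derivative_C_mul, ← Function.iterate_add_apply]
  rw [derivative_mul, derivative_pow, derivative_C_mul, ← Function.iterate_succ_apply' derivative,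
    show (j + 1 + l).succ = l + j + 2 by omega, show j + 1 + l = l + j + 1 by omega,
    show j + l = l + j by omega]
  generalize derivative^[l + j + 2] ((X ^ 2 - 1 : ℝ[X]) ^ l) = V2 at *
  generalize derivative^[l + j + 1] ((X ^ 2 - 1 : ℝ[X]) ^ l) = V1 at *
  generalize derivative^[l + j] ((X ^ 2 - 1 : ℝ[X]) ^ l) = V0 at *
  generalize √((2 * (l : ℝ) + 1) / 2) / (2 ^ l * (l.factorial : ℝ)) = c at *
  simp only [derivative_sub, derivative_one, derivative_X_pow, C_mul, C_sub, C_add, C_neg,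
    map_natCast, map_ofNat, C_1] at h ⊢
  push_cast at h ⊢
  simp at h ⊢
  linear_combination (-(1 - X ^ 2) ^ j * C c) * h

/-- The polynomial `P_{l+j}^{(j)}`, normalized in `L²((-1,1), (1-x²)^j dx)`. -/
def gegenP (j l : ℕ) : ℝ[X] :=
  C (√((l + 2 * j).descFactorial (2 * j) : ℝ))⁻¹ * derivative^[j] (legendreP (l + j))

lemma gegenP_zero (l : ℕ) : gegenP 0 l = legendreP l := by simp [gegenP]

lemma sqrt_descFactorial_ne_zero {m k : ℕ} (h : k ≤ m) : √(m.descFactorial k : ℝ) ≠ 0 := by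
  have : 0 < m.descFactorial k := Nat.pos_of_ne_zero (by
    rw [Ne, Nat.descFactorial_eq_zero_iff_lt]; omega)
  positivity

/-- `P_l^{(j)}` is a multiple of a normalized polynomial. -/
lemma iterate_derivative_legendreP_add (j l : ℕ) :
    derivative^[j] (legendreP (l + j)) = C √((l + 2 * j).descFactorial (2 * j) : ℝ) * gegenP j l := by
  rw [gegenP, ← mul_assoc, ← C_mul, mul_inv_cancel₀ (sqrt_descFactorial_ne_zero (by omega)), C_1,
    one_mul]

lemma sqrt_descFactorial_succ (j l : ℕ) :
    √((l + 2 * (j + 1)).descFactorial (2 * (j + 1)) : ℝ)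
      = √(((l : ℝ) + 1) * (l + 2 * j + 2)) * √((l + 1 + 2 * j).descFactorial (2 * j) : ℝ) := by
  rw [← Real.sqrt_mul (by positivity)]
  congr 1
  rw [show l + 2 * (j + 1) = (l + 1 + 2 * j) + 1 by ring, show 2 * (j + 1) = (2 * j + 1) + 1 by ring,
    Nat.succ_descFactorial_succ, Nat.descFactorial_succ, show l + 1 + 2 * j - 2 * j = l + 1 by omega]
  push_cast
  ring

/-- Differentiation as a ladder operator from the weight `(1-x²)^j` to `(1-x²)^(j+1)`. -/
lemma derivative_gegenP_succ (j l : ℕ) :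
    derivative (gegenP j (l + 1)) = C √(((l : ℝ) + 1) * (l + 2 * j + 2)) * gegenP (j + 1) l := by
  have h1 : √(((l : ℝ) + 1) * (l + 2 * j + 2)) ≠ 0 := by positivity
  rw [gegenP, gegenP, derivative_C_mul, ← Function.iterate_succ_apply' derivative, ← mul_assoc,
    ← C_mul, sqrt_descFactorial_succ, mul_inv, mul_inv_cancel_left₀ h1,
    show l + (j + 1) = l + 1 + j by ring]

/-- The adjoint ladder operator. The Sturm–Liouville eigenvalue `(l+1)(l+2j+2)` is the product of
the two ladder factors, so each of them carries its square root. -/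
lemma derivative_weight_mul_gegenP (j l : ℕ) :
    derivative ((1 - X ^ 2) ^ (j + 1) * gegenP (j + 1) l)
      = C (-√(((l : ℝ) + 1) * (l + 2 * j + 2))) * ((1 - X ^ 2) ^ j * gegenP j (l + 1)) := by
  have h1 : √(((l : ℝ) + 1) * (l + 2 * j + 2)) ≠ 0 := by positivity
  have h3 : √((l + 1 + 2 * j).descFactorial (2 * j) : ℝ) ≠ 0 := sqrt_descFactorial_ne_zero (by omega)
  have e : C (√(((l : ℝ) + 1) * (l + 2 * j + 2)) * √((l + 1 + 2 * j).descFactorial (2 * j) : ℝ))⁻¹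
        * C (-((((l + 1 + j : ℕ) : ℝ) - j) * ((l + 1 + j : ℕ) + j + 1)))
      = C (-√(((l : ℝ) + 1) * (l + 2 * j + 2)))
        * C (√((l + 1 + 2 * j).descFactorial (2 * j) : ℝ))⁻¹ := by
    rw [← C_mul, ← C_mul]
    congr 1
    push_cast
    field_simp
    rw [Real.sq_sqrt (by positivity)]
    ring
  rw [gegenP, gegenP, mul_left_comm, derivative_C_mul, derivative_weight_mul_legendreP,
    sqrt_descFactorial_succ, show l + (j + 1) = l + 1 + j by ring]
  linear_combination ((1 - X ^ 2) ^ j * derivative^[j] (legendreP (l + 1 + j))) * e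

lemma degree_legendreP (l : ℕ) : (legendreP l).degree = l := by
  have h2 : (X ^ 2 - 1 : ℝ[X]).Monic := by
    have := monic_X_pow_sub_C (1 : ℝ) (n := 2) two_ne_zero
    simpa using this
  have hd : ((X ^ 2 - 1 : ℝ[X]) ^ l).natDegree = 2 * l := by
    rw [h2.natDegree_pow]
    have : (X ^ 2 - 1 : ℝ[X]).natDegree = 2 := by
      simpa using natDegree_X_pow_sub_C (R := ℝ) (n := 2) (r := 1)
    rw [this, mul_comm]
  have hc : √((2 * (l : ℝ) + 1) / 2) / (2 ^ l * (l.factorial : ℝ)) ≠ 0 := by positivity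
  rw [legendreP, degree_C_mul hc]
  refine degree_eq_of_le_of_coeff_ne_zero ?_ ?_
  · refine degree_le_natDegree.trans ?_
    have := natDegree_iterate_derivative ((X ^ 2 - 1 : ℝ[X]) ^ l) l
    exact_mod_cast this.trans (by omega)
  · rw [coeff_iterate_derivative, show l + l = 2 * l by ring]
    have : ((X ^ 2 - 1 : ℝ[X]) ^ l).coeff (2 * l) = 1 := by
      rw [← hd]; exact (h2.pow l)
    rw [this]
    have h0 : 0 < (2 * l).descFactorial l := Nat.pos_of_ne_zero (by
      rw [Ne, Nat.descFactorial_eq_zero_iff_lt]; omega)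
    simp only [nsmul_eq_mul, mul_one]
    positivity

/-- Having one polynomial in each degree makes the family span all polynomials, which completeness
relies on. -/
lemma degree_gegenP (j l : ℕ) : (gegenP j l).degree = l := by
  induction j generalizing l with
  | zero => rw [gegenP_zero, degree_legendreP]
  | succ j ih =>
    have h1 : √(((l : ℝ) + 1) * (l + 2 * j + 2)) ≠ 0 := by positivity
    have h := derivative_gegenP_succ j l
    have h2 := congrArg degree h
    rw [degree_C_mul h1, degree_derivative (by
      rw [natDegree_eq_of_degree_eq_some (ih (l + 1))]; omega),
      natDegree_eq_of_degree_eq_some (ih (l + 1))] at h2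
    simpa using h2.symm

lemma iterate_derivative_legendreP_of_lt {j l : ℕ} (h : l < j) :
    derivative^[j] (legendreP l) = 0 := by
  apply iterate_derivative_eq_zero
  rwa [natDegree_eq_of_degree_eq_some (degree_legendreP l)]

/-! ### Orthonormality of the Legendre polynomials and their derivatives. -/

lemma integrableOn_poly (p : ℝ[X]) : IntegrableOn (fun x => p.eval x) (Ioo (-1) 1) :=
  (p.continuous.continuousOn.integrableOn_compact isCompact_Icc).mono_set Ioo_subset_Icc_self

lemma integral_derivative (p : ℝ[X]) :
    ∫ x in Ioo (-1 : ℝ) 1, (derivative p).eval x = p.eval 1 - p.eval (-1) := by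
  rw [← integral_Ioc_eq_integral_Ioo, ← intervalIntegral.integral_of_le (by norm_num)]
  exact intervalIntegral.integral_eq_sub_of_hasDerivAt (fun x _ => p.hasDerivAt x)
    ((derivative p).continuous.intervalIntegrable _ _)

/-- Integration by parts against the weight `(1-x²)^(j+1)`. -/
lemma integral_weight_mul_derivative (j : ℕ) (p q : ℝ[X]) :
    ∫ x in Ioo (-1 : ℝ) 1, ((1 - X ^ 2) ^ (j + 1) * p * derivative q).eval x
      = -∫ x in Ioo (-1 : ℝ) 1, (derivative ((1 - X ^ 2) ^ (j + 1) * p) * q).eval x := by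
  have h := integral_derivative ((1 - X ^ 2) ^ (j + 1) * p * q)
  rw [derivative_mul] at h
  simp only [eval_add] at h
  rw [integral_add (integrableOn_poly _) (integrableOn_poly _)] at h
  -- The exponent `j + 1` is positive, so there are no boundary terms.
  have e1 : eval 1 ((1 - X ^ 2) ^ (j + 1) * p * q) = 0 := by simp
  have e2 : eval (-1) ((1 - X ^ 2) ^ (j + 1) * p * q) = 0 := by simp
  rw [e1, e2] at h
  linarith

lemma integral_weight_iterate_derivative_legendreP (j a b : ℕ) :
    ∫ x in Ioo (-1 : ℝ) 1,
        ((1 - X ^ 2) ^ (j + 1) * derivative^[j + 1] (legendreP a) *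
          derivative^[j + 1] (legendreP b)).eval x
      = (((a : ℝ) - j) * (a + j + 1)) * ∫ x in Ioo (-1 : ℝ) 1,
        ((1 - X ^ 2) ^ j * derivative^[j] (legendreP a) * derivative^[j] (legendreP b)).eval x := by
  rw [Function.iterate_succ_apply' derivative j (legendreP b), integral_weight_mul_derivative,
    derivative_weight_mul_legendreP, ← integral_const_mul, ← integral_neg]
  congr 1
  ext x
  simp
  ring

/-- Eigenfunctions of a symmetric operator: the Dirichlet form with weight `1-x²` equals both
`a(a+1)` and `b(b+1)` times the pairing, and these eigenvalues differ. -/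
lemma integral_legendreP_mul_of_ne {a b : ℕ} (hab : a ≠ b) :
    ∫ x in Ioo (-1 : ℝ) 1, (legendreP a).eval x * (legendreP b).eval x = 0 := by
  have h1 := integral_weight_iterate_derivative_legendreP 0 a b
  have h2 := integral_weight_iterate_derivative_legendreP 0 b a
  have e : ∀ x : ℝ, ((1 - X ^ 2) ^ (0 + 1) * derivative^[0 + 1] (legendreP a) *
          derivative^[0 + 1] (legendreP b)).eval x = ((1 - X ^ 2) ^ (0 + 1) *
          derivative^[0 + 1] (legendreP b) * derivative^[0 + 1] (legendreP a)).eval x := by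
    intro x; congr 1; ring
  simp_rw [e] at h1
  rw [h1] at h2
  simp at h2
  simp_rw [mul_comm ((legendreP b).eval _)] at h2
  have h3 : ((a : ℝ) * (a + 1) - b * (b + 1)) *
      ∫ x in Ioo (-1 : ℝ) 1, (legendreP a).eval x * (legendreP b).eval x = 0 := by linarith
  refine (mul_eq_zero.1 h3).resolve_left ?_
  have h4 : ((a : ℝ) * (a + 1) - b * (b + 1)) = (a - b) * (a + b + 1) := by ring
  rw [h4]
  refine mul_ne_zero (sub_ne_zero.2 (by exact_mod_cast hab)) (by positivity)

/-- Since `x (1-x²)^(l+1)` vanishes at `±1`, its derivative integrates to zero, which gives `(2l+3)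
I_{l+1} = (2l+2) I_l`. -/
lemma integral_weight_pow (l : ℕ) :
    ∫ x in Ioo (-1 : ℝ) 1, ((1 - X ^ 2 : ℝ[X]) ^ l).eval x
      = 2 ^ (2 * l + 1) * (l.factorial : ℝ) ^ 2 / ((2 * l + 1).factorial : ℝ) := by
  induction l with
  | zero => simp; norm_num
  | succ l ih =>
    have h := integral_derivative (X * (1 - X ^ 2) ^ (l + 1))
    have e : derivative (X * (1 - X ^ 2 : ℝ[X]) ^ (l + 1))
        = C (2 * (l : ℝ) + 3) * (1 - X ^ 2) ^ (l + 1) - C (2 * (l : ℝ) + 2) * (1 - X ^ 2) ^ l := by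
      rw [derivative_mul, derivative_pow]
      simp only [derivative_sub, derivative_one, derivative_X_pow, derivative_X, C_mul, C_add,
        map_natCast, map_ofNat, Nat.add_sub_cancel]
      simp
      ring
    rw [e] at h
    simp only [eval_sub] at h
    rw [integral_sub (integrableOn_poly _) (integrableOn_poly _)] at h
    simp only [eval_mul (p := C _), eval_C, integral_const_mul, ih] at h
    have h0 : ((2 * (l + 1) + 1).factorial : ℝ)
        = (2 * l + 3) * (2 * l + 2) * ((2 * l + 1).factorial : ℝ) := by
      rw [show 2 * (l + 1) + 1 = (2 * l + 1 + 1) + 1 by ring, Nat.factorial_succ, Nat.factorial_succ]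
      push_cast; ring
    rw [h0, Nat.factorial_succ]
    have h3 : (2 * (l : ℝ) + 3) ≠ 0 := by positivity
    have h2 : (2 * (l : ℝ) + 2) ≠ 0 := by positivity
    have hf : ((2 * l + 1).factorial : ℝ) ≠ 0 := by positivity
    simp at h
    have h5 : (2 * (l : ℝ) + 3) * (∫ x in Ioo (-1 : ℝ) 1, (1 - x ^ 2) ^ (l + 1))
        = (2 * l + 2) * (2 ^ (2 * l + 1) * (l.factorial : ℝ) ^ 2 / ((2 * l + 1).factorial : ℝ)) := by
      linarith
    simp only [eval_pow, eval_sub, eval_one, eval_X]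
    apply mul_left_cancel₀ h3
    rw [h5]
    push_cast
    field_simp
    ring

lemma integral_weight_iterate_derivative_sq (j l : ℕ) (h : j ≤ l) :
    ∫ x in Ioo (-1 : ℝ) 1,
        ((1 - X ^ 2) ^ j * derivative^[j] (legendreP l) * derivative^[j] (legendreP l)).eval x
      = ((l + j).descFactorial (2 * j) : ℝ) *
        ∫ x in Ioo (-1 : ℝ) 1, (legendreP l).eval x * (legendreP l).eval x := by
  induction j with
  | zero => simp
  | succ j ih =>
    rw [integral_weight_iterate_derivative_legendreP, ih (by omega), ← mul_assoc]
    congr 1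
    rw [show l + (j + 1) = (l + j) + 1 by ring, show 2 * (j + 1) = (2 * j + 1) + 1 by ring,
      Nat.succ_descFactorial_succ, Nat.descFactorial_succ, show l + j - 2 * j = l - j by omega]
    push_cast [show j ≤ l by omega]
    ring

/-- After `l` integrations by parts only the constant `P_l^{(l)}` and the integral of `(1-x²)^l`
remain. -/
lemma integral_legendreP_sq (l : ℕ) :
    ∫ x in Ioo (-1 : ℝ) 1, (legendreP l).eval x * (legendreP l).eval x = 1 := by
  have h := integral_weight_iterate_derivative_sq l l le_rfl
  have hd : derivative^[l] (legendreP l)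
      = C (√((2 * l + 1) / 2) / (2 ^ l * (l.factorial : ℝ)) * ((2 * l).factorial : ℝ)) := by
    rw [legendreP, iterate_derivative_C_mul, ← Function.iterate_add_apply, C_mul]
    congr 1
    have h2 : (X ^ 2 - 1 : ℝ[X]).Monic := by
      have := monic_X_pow_sub_C (1 : ℝ) (n := 2) two_ne_zero
      simpa using this
    have hn : (X ^ 2 - 1 : ℝ[X]).natDegree = 2 := by
      simpa using natDegree_X_pow_sub_C (R := ℝ) (n := 2) (r := 1)
    have hd : ((X ^ 2 - 1 : ℝ[X]) ^ l).natDegree = 2 * l := by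
      rw [h2.natDegree_pow, hn, mul_comm]
    have hdeg : (derivative^[l + l] ((X ^ 2 - 1 : ℝ[X]) ^ l)).natDegree = 0 := by
      have := natDegree_iterate_derivative ((X ^ 2 - 1 : ℝ[X]) ^ l) (l + l)
      omega
    rw [eq_C_of_natDegree_eq_zero hdeg, coeff_iterate_derivative, zero_add, ← two_mul]
    have : ((X ^ 2 - 1 : ℝ[X]) ^ l).coeff (2 * l) = 1 := by
      rw [← hd]; exact (h2.pow l)
    rw [this, Nat.descFactorial_self]
    simp
  rw [hd, ← two_mul, Nat.descFactorial_self] at h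
  simp only [eval_mul, eval_C, integral_mul_const] at h
  rw [integral_weight_pow, Nat.factorial_succ] at h
  have hf : ((2 * l).factorial : ℝ) ≠ 0 := by positivity
  have hf2 : (l.factorial : ℝ) ≠ 0 := by positivity
  have hs : √((2 * (l : ℝ) + 1) / 2) ^ 2 = (2 * l + 1) / 2 := Real.sq_sqrt (by positivity)
  apply mul_left_cancel₀ hf
  rw [← h]
  push_cast
  have h1 : (2 * (l : ℝ) + 1) ≠ 0 := by positivity
  field_simp
  rw [hs]
  ring

/-- The two ladder operators being adjoint up to sign, one integration by parts reduces the weight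
`j + 1` and the indices `a, b` to the weight `j` and the indices `a+1, b+1`. -/
lemma integral_gegenP_mul (j a b : ℕ) :
    ∫ x in Ioo (-1 : ℝ) 1, ((1 - X ^ 2) ^ j * gegenP j a * gegenP j b).eval x
      = if a = b then 1 else 0 := by
  induction j generalizing a b with
  | zero =>
    simp only [gegenP_zero, pow_zero, one_mul, eval_mul]
    split_ifs with h
    · subst h; exact integral_legendreP_sq a
    · exact integral_legendreP_mul_of_ne h
  | succ j ih =>
    have hb : 0 < √(((b : ℝ) + 1) * (b + 2 * j + 2)) := by positivity
    have h := integral_weight_mul_derivative j (gegenP (j + 1) a) (gegenP j (b + 1))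
    have e1 : (1 - X ^ 2) ^ (j + 1) * gegenP (j + 1) a * derivative (gegenP j (b + 1))
        = C √(((b : ℝ) + 1) * (b + 2 * j + 2)) *
          ((1 - X ^ 2) ^ (j + 1) * gegenP (j + 1) a * gegenP (j + 1) b) := by
      rw [derivative_gegenP_succ]; ring
    have e2 : derivative ((1 - X ^ 2) ^ (j + 1) * gegenP (j + 1) a) * gegenP j (b + 1)
        = C (-√(((a : ℝ) + 1) * (a + 2 * j + 2))) *
          ((1 - X ^ 2) ^ j * gegenP j (a + 1) * gegenP j (b + 1)) := by
      rw [derivative_weight_mul_gegenP]; ring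
    rw [e1, e2] at h
    simp only [eval_mul (p := C _), eval_C, integral_const_mul, ih] at h
    apply mul_left_cancel₀ hb.ne'
    rw [h]
    by_cases hab : a = b
    · subst hab; simp
    · simp [hab]

/-- Integrating by parts `j` times moves `(1-x²)^j P_{l+j}^{(j)}` to `P_{l+j}`. -/
lemma iterate_derivative_weight_mul_gegenP (j i l : ℕ) :
    derivative^[j] ((1 - X ^ 2) ^ (i + j) * gegenP (i + j) l)
      = C ((-1) ^ j * (√((l + 2 * (i + j)).descFactorial (2 * (i + j)) : ℝ) /
          √((l + j + 2 * i).descFactorial (2 * i) : ℝ))) *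
        ((1 - X ^ 2) ^ i * gegenP i (l + j)) := by
  induction j generalizing l with
  | zero =>
    have : √((l + 2 * i).descFactorial (2 * i) : ℝ) ≠ 0 := sqrt_descFactorial_ne_zero (by omega)
    simp
  | succ j ih =>
    rw [Function.iterate_succ_apply, ← add_assoc, derivative_weight_mul_gegenP,
      iterate_derivative_C_mul, ih, ← mul_assoc, ← C_mul, show l + 1 + j = l + (j + 1) by ring,
      sqrt_descFactorial_succ]
    congr 2
    push_cast
    ring

/-! ### Completeness of the polynomials -/

/-- A function with exponential moments that is orthogonal to all polynomials vanishes. -/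
theorem ae_eq_zero_of_integral_mul_monomial {μ : Measure (ℝ × ℝ)} [IsFiniteMeasure μ]
    {g : ℝ × ℝ → ℝ} (hg : Integrable g μ)
    (hexp : ∀ L : StrongDual ℝ (ℝ × ℝ), Integrable (fun p => |g p| * Real.exp |L p|) μ)
    (hint : ∀ a b : ℕ, Integrable (fun p => g p * (p.1 ^ a * p.2 ^ b)) μ)
    (h0 : ∀ a b : ℕ, ∫ p, g p * (p.1 ^ a * p.2 ^ b) ∂μ = 0) : g =ᵐ[μ] 0 := by
  -- A power of a linear functional is a combination of monomials, by the binomial theorem.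
  have hpow : ∀ (L : StrongDual ℝ (ℝ × ℝ)) (n : ℕ), ∫ p, g p * (L p) ^ n ∂μ = 0 := by
    intro L n
    have hL : ∀ p : ℝ × ℝ, L p = p.1 * L (1, 0) + p.2 * L (0, 1) := by
      intro p
      have : p = p.1 • ((1, 0) : ℝ × ℝ) + p.2 • ((0, 1) : ℝ × ℝ) := by ext <;> simp
      conv_lhs => rw [this, map_add, map_smul, map_smul]
      simp
    have e : ∀ p : ℝ × ℝ, g p * (L p) ^ n = ∑ i ∈ Finset.range (n + 1),
        (L (1, 0) ^ i * L (0, 1) ^ (n - i) * (n.choose i)) *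
          (g p * (p.1 ^ i * p.2 ^ (n - i))) := by
      intro p
      rw [hL, add_pow, Finset.mul_sum]
      refine Finset.sum_congr rfl fun i _ => ?_
      rw [mul_pow, mul_pow]; ring
    simp_rw [e]
    rw [integral_finsetSum _ fun i _ => (hint i (n - i)).const_mul _]
    refine Finset.sum_eq_zero fun i _ => ?_
    rw [integral_const_mul, h0, mul_zero]
  -- The exponential series is integrated term by term, with `|g| exp |L|` as the integrable
  -- majorant.
  have hchar : ∀ L : StrongDual ℝ (ℝ × ℝ),
      ∫ p, (g p : ℂ) * Complex.exp (L p * Complex.I) ∂μ = 0 := by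
    intro L
    have hs := hasSum_integral_of_dominated_convergence (μ := μ)
      (F := fun (n : ℕ) (p : ℝ × ℝ) => (g p : ℂ) * ((L p * Complex.I) ^ n / (n.factorial : ℂ)))
      (f := fun p => (g p : ℂ) * Complex.exp (L p * Complex.I))
      (fun (n : ℕ) p => |g p| * (|L p| ^ n / n.factorial)) ?_ ?_ ?_ ?_ ?_
    · have hz : ∀ n : ℕ, ∫ p, (g p : ℂ) * ((L p * Complex.I) ^ n / (n.factorial : ℂ)) ∂μ = 0 := by
        intro n
        have e : ∀ p, (g p : ℂ) * ((L p * Complex.I) ^ n / (n.factorial : ℂ))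
            = (Complex.I ^ n / (n.factorial : ℂ)) * ((g p * (L p) ^ n : ℝ) : ℂ) := by
          intro p; push_cast; rw [mul_pow]; ring
        simp_rw [e]
        rw [integral_const_mul, integral_complex_ofReal, hpow]
        simp
      simp_rw [hz] at hs
      exact hs.unique hasSum_zero
    · intro n
      have h1 : AEStronglyMeasurable (fun p => (g p : ℂ)) μ :=
        Complex.continuous_ofReal.comp_aestronglyMeasurable hg.1
      exact h1.mul (by fun_prop)
    · intro n
      refine ae_of_all _ fun p => ?_
      simp
    · refine ae_of_all _ fun p => ?_
      exact (Real.summable_pow_div_factorial _).mul_left _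
    · refine (hexp L).congr (ae_of_all _ fun p => ?_)
      simp only
      rw [tsum_mul_left, Real.exp_eq_exp_ℝ, NormedSpace.exp_eq_tsum_div]
    · refine ae_of_all _ fun p => ?_
      have := NormedSpace.expSeries_div_hasSum_exp (L p * Complex.I)
      rw [← Complex.exp_eq_exp_ℂ] at this
      exact this.mul_left _
  have hfin : ∀ f : ℝ × ℝ → ℝ, Integrable f μ →
      IsFiniteMeasure (μ.withDensity fun p => ENNReal.ofReal (f p)) := by
    intro f hf
    exact isFiniteMeasure_withDensity_ofReal hf.2
  have hm : ∀ f : ℝ × ℝ → ℝ, Integrable f μ → AEMeasurable (fun p => ENNReal.ofReal (f p)) μ :=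
    fun f hf => hf.1.aemeasurable.ennreal_ofReal
  have hgn : Integrable (fun p => -g p) μ := hg.neg
  have := hfin g hg
  have := hfin (fun p => -g p) hgn
  -- The positive and negative parts of `g` are densities of finite measures with equal
  -- characteristic functions. The measures therefore coincide, and both parts must vanish.
  have heq : μ.withDensity (fun p => ENNReal.ofReal (g p))
      = μ.withDensity (fun p => ENNReal.ofReal (-g p)) := by
    apply Measure.ext_of_charFunDual
    ext L
    rw [charFunDual_apply, charFunDual_apply,
      integral_withDensity_eq_integral_toReal_smul₀ (hm _ hg) (by simp),
      integral_withDensity_eq_integral_toReal_smul₀ (hm _ hgn) (by simp), ← sub_eq_zero,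
      ← integral_sub, ← hchar L]
    · congr 1
      ext p
      simp only [ENNReal.toReal_ofReal', Complex.real_smul, ← sub_mul]
      congr 1
      rw [← Complex.ofReal_sub]
      congr 1
      rcases le_total 0 (g p) with h | h
      · rw [max_eq_left h, max_eq_right (by linarith)]; ring
      · rw [max_eq_right h, max_eq_left (by linarith)]; ring
    all_goals
      refine Integrable.mono hg ?_ (ae_of_all _ fun p => ?_)
      · have hexpm : AEStronglyMeasurable (fun p => Complex.exp (L p * Complex.I)) μ := by fun_prop
        first
          | exact (hm _ hg).ennreal_toReal.aestronglyMeasurable.smul hexpm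
          | exact (hm _ hgn).ennreal_toReal.aestronglyMeasurable.smul hexpm
      · rw [norm_smul, Complex.norm_exp_ofReal_mul_I, mul_one, ENNReal.toReal_ofReal',
          Real.norm_eq_abs, Real.norm_eq_abs, abs_of_nonneg (le_max_right _ _)]
        simp [le_abs_self, neg_le_abs]
  rw [withDensity_eq_iff (hm _ hg) (hm _ hgn)] at heq
  · filter_upwards [heq] with p hp
    rcases le_total 0 (g p) with h | h
    · rw [ENNReal.ofReal_of_nonpos (by linarith : -g p ≤ 0), ENNReal.ofReal_eq_zero] at hp
      exact le_antisymm hp h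
    · rw [ENNReal.ofReal_of_nonpos h, eq_comm, ENNReal.ofReal_eq_zero] at hp
      simp only [Pi.zero_apply]; linarith
  · exact hg.lintegral_lt_top.ne

/-! ### The weighted measures -/

/-- The measure `(1-x²)^j dx ⊗ dν` on the strip. -/
def weightedMeasure (j : ℕ) : Measure (ℝ × ℝ) :=
  stripMeasure.withDensity fun p => ENNReal.ofReal ((1 - p.1 ^ 2) ^ j)

instance : IsFiniteMeasure stripMeasure := by unfold stripMeasure; infer_instance

lemma measurableSet_strip : MeasurableSet strip := measurableSet_Ioo.prod MeasurableSet.univ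

lemma ae_mem_strip : ∀ᵐ p ∂stripMeasure, p ∈ strip := by
  have : stripMeasure = (volume.prod (gaussianReal 0 1)).restrict strip := by
    rw [stripMeasure, strip, ← Measure.prod_restrict, Measure.restrict_univ]
  rw [this]
  exact ae_restrict_mem measurableSet_strip

lemma one_sub_sq_pos {p : ℝ × ℝ} (hp : p ∈ strip) : 0 < 1 - p.1 ^ 2 := by
  have h := hp.1
  nlinarith [h.1, h.2]

lemma one_sub_sq_le_one (p : ℝ × ℝ) : 1 - p.1 ^ 2 ≤ 1 := by nlinarith [sq_nonneg p.1]

lemma weightedMeasure_zero : weightedMeasure 0 = stripMeasure := by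
  simp [weightedMeasure]

lemma weightedMeasure_le (j : ℕ) : weightedMeasure j ≤ stripMeasure := by
  conv_rhs => rw [← withDensity_one (μ := stripMeasure)]
  refine withDensity_mono ?_
  filter_upwards [ae_mem_strip] with p hp
  simp only [Pi.one_apply]
  rw [← ENNReal.ofReal_one]
  exact ENNReal.ofReal_le_ofReal (pow_le_one₀ (one_sub_sq_pos hp).le (one_sub_sq_le_one p))

instance (j : ℕ) : IsFiniteMeasure (weightedMeasure j) :=
  isFiniteMeasure_of_le _ (weightedMeasure_le j)

lemma measurable_weight (j : ℕ) :
    Measurable fun p : ℝ × ℝ => ENNReal.ofReal ((1 - p.1 ^ 2) ^ j) := by fun_prop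

lemma integral_weightedMeasure (j : ℕ) (f : ℝ × ℝ → ℝ) :
    ∫ p, f p ∂(weightedMeasure j) = ∫ p, f p * (1 - p.1 ^ 2) ^ j ∂stripMeasure := by
  rw [weightedMeasure, integral_withDensity_eq_integral_toReal_smul (measurable_weight j) (by simp)]
  refine integral_congr_ae ?_
  filter_upwards [ae_mem_strip] with p hp
  rw [ENNReal.toReal_ofReal (pow_nonneg (one_sub_sq_pos hp).le _), smul_eq_mul, mul_comm]

lemma integrable_weightedMeasure_iff (j : ℕ) (f : ℝ × ℝ → ℝ) :
    Integrable f (weightedMeasure j)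
      ↔ Integrable (fun p => f p * (1 - p.1 ^ 2) ^ j) stripMeasure := by
  rw [weightedMeasure, integrable_withDensity_iff (measurable_weight j) (by simp)]
  refine integrable_congr ?_
  filter_upwards [ae_mem_strip] with p hp
  rw [ENNReal.toReal_ofReal (pow_nonneg (one_sub_sq_pos hp).le _)]

lemma integral_stripMeasure_mul (u v : ℝ → ℝ) :
    ∫ p, u p.1 * v p.2 ∂stripMeasure
      = (∫ x in Ioo (-1 : ℝ) 1, u x) * ∫ t, v t ∂(gaussianReal 0 1) := by
  rw [stripMeasure, integral_prod_mul]

lemma integrable_stripMeasure_mul {u v : ℝ → ℝ} (hu : IntegrableOn u (Ioo (-1) 1))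
    (hv : Integrable v (gaussianReal 0 1)) :
    Integrable (fun p : ℝ × ℝ => u p.1 * v p.2) stripMeasure :=
  Integrable.mul_prod hu hv

lemma integrable_poly_strip (p q : ℝ[X]) :
    Integrable (fun z : ℝ × ℝ => p.eval z.1 * q.eval z.2) stripMeasure :=
  integrable_stripMeasure_mul (integrableOn_poly p) (integrable_poly_gaussian q)

lemma memLp_poly_strip (p q : ℝ[X]) :
    MemLp (fun z : ℝ × ℝ => p.eval z.1 * q.eval z.2) 2 stripMeasure := by
  rw [memLp_two_iff_integrable_sq]
  · refine (integrable_poly_strip (p ^ 2) (q ^ 2)).congr (ae_of_all _ fun z => ?_)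
    simp [mul_pow]
  · have h1 := p.continuous
    have h2 := q.continuous
    exact Continuous.aestronglyMeasurable (by fun_prop)

lemma memLp_poly (j : ℕ) (p q : ℝ[X]) :
    MemLp (fun z : ℝ × ℝ => p.eval z.1 * q.eval z.2) 2 (weightedMeasure j) :=
  (memLp_poly_strip p q).mono_measure (weightedMeasure_le j)

/-- The variable `x` is bounded and the Gaussian has all exponential moments. With Hölder this
supplies the exponential integrability needed for completeness. -/
lemma memLp_exp_strip (L : StrongDual ℝ (ℝ × ℝ)) :
    MemLp (fun p => Real.exp |L p|) 2 stripMeasure := by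
  rw [memLp_two_iff_integrable_sq (by fun_prop)]
  set a := L (1, 0)
  set b := L (0, 1)
  have hL : ∀ p : ℝ × ℝ, L p = p.1 * a + p.2 * b := by
    intro p
    have : p = p.1 • ((1, 0) : ℝ × ℝ) + p.2 • ((0, 1) : ℝ × ℝ) := by ext <;> simp
    conv_lhs => rw [this, map_add, map_smul, map_smul]
    simp [a, b]
  have h1 : Integrable (fun p : ℝ × ℝ => Real.exp (2 * |a|) *
      (Real.exp ((2 * b) * p.2) + Real.exp ((-(2 * b)) * p.2))) stripMeasure := by
    refine integrable_stripMeasure_mul (u := fun _ => Real.exp (2 * |a|))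
      (v := fun t => Real.exp ((2 * b) * t) + Real.exp ((-(2 * b)) * t)) (by simp) ?_
    exact (integrable_exp_mul_gaussianReal _).add (integrable_exp_mul_gaussianReal _)
  refine h1.mono (by fun_prop) ?_
  filter_upwards [ae_mem_strip] with p hp
  rw [Real.norm_of_nonneg (by positivity), Real.norm_of_nonneg (by positivity), ← Real.exp_nat_mul]
  have hx : |p.1| ≤ 1 := abs_le.2 ⟨hp.1.1.le, hp.1.2.le⟩
  have h2 : |L p| ≤ |a| + |p.2 * b| := by
    rw [hL]
    refine (abs_add_le _ _).trans ?_
    rw [abs_mul p.1]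
    nlinarith [abs_nonneg a]
  have h3 : Real.exp (2 * |p.2 * b|) ≤ Real.exp ((2 * b) * p.2) + Real.exp ((-(2 * b)) * p.2) := by
    rcases abs_cases (p.2 * b) with h | h
    · rw [h.1, show 2 * (p.2 * b) = 2 * b * p.2 by ring]; linarith [Real.exp_pos (-(2 * b) * p.2)]
    · rw [h.1, show 2 * -(p.2 * b) = -(2 * b) * p.2 by ring]
      linarith [Real.exp_pos ((2 * b) * p.2)]
  calc Real.exp ((2 : ℕ) * |L p|) ≤ Real.exp (2 * |a| + 2 * |p.2 * b|) := by
        apply Real.exp_le_exp.2; push_cast; linarith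
    _ ≤ _ := by
        rw [Real.exp_add]
        exact mul_le_mul_of_nonneg_left h3 (by positivity)

/-! ### The orthonormal bases -/

/-- The orthonormal basis functions of `L²((1-x²)^j dx ⊗ dν)`. -/
def basisFn (j : ℕ) (i : ℕ × ℕ) (p : ℝ × ℝ) : ℝ := (gegenP j i.2).eval p.1 * (hermiteP i.1).eval p.2

lemma memLp_basisFn (j : ℕ) (i : ℕ × ℕ) : MemLp (basisFn j i) 2 (weightedMeasure j) :=
  memLp_poly j _ _

/-- The Fourier coefficients with respect to `basisFn j`. -/
def fourierCoeff (j : ℕ) (g : ℝ × ℝ → ℝ) (i : ℕ × ℕ) : ℝ :=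
  ∫ p, g p * basisFn j i p ∂(weightedMeasure j)

lemma coeff_eq_fourierCoeff (f : L2) (k j : ℕ) : coeff f k j = fourierCoeff 0 f (k, j) := by
  rw [coeff, fourierCoeff, weightedMeasure_zero]
  congr 1
  ext p
  simp only [basisFn, hermiteN_eq, legendreN_eq, gegenP_zero]
  ring

lemma fourierCoeff_basisFn (j : ℕ) (a b : ℕ × ℕ) :
    fourierCoeff j (basisFn j a) b = if a = b then 1 else 0 := by
  rw [fourierCoeff, integral_weightedMeasure]
  have e : ∀ p : ℝ × ℝ, basisFn j a p * basisFn j b p * (1 - p.1 ^ 2) ^ j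
      = ((1 - X ^ 2) ^ j * gegenP j a.2 * gegenP j b.2).eval p.1 *
        ((hermiteP a.1).eval p.2 * (hermiteP b.1).eval p.2) := by
    intro p
    simp [basisFn]
    ring
  simp_rw [e]
  rw [integral_stripMeasure_mul (fun x => ((1 - X ^ 2) ^ j * gegenP j a.2 * gegenP j b.2 : ℝ[X]).eval x)
    (fun t => (hermiteP a.1).eval t * (hermiteP b.1).eval t), integral_gegenP_mul,
    integral_hermiteP_mul]
  by_cases h1 : a.1 = b.1 <;> by_cases h2 : a.2 = b.2 <;> simp [h1, h2, Prod.ext_iff]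

/-- The sequence of normalized Hermite polynomials. -/
def hermiteSeq : Polynomial.Sequence ℝ := ⟨hermiteP, degree_hermiteP⟩

/-- The sequence of normalized derivatives of Legendre polynomials. -/
def gegenSeq (j : ℕ) : Polynomial.Sequence ℝ := ⟨gegenP j, degree_gegenP j⟩

lemma integrable_mul_poly {j : ℕ} {g : ℝ × ℝ → ℝ} (hg : MemLp g 2 (weightedMeasure j))
    (p q : ℝ[X]) :
    Integrable (fun z : ℝ × ℝ => g z * (p.eval z.1 * q.eval z.2)) (weightedMeasure j) :=
  hg.integrable_mul (memLp_poly j p q)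

/-- Both polynomial families span `ℝ[X]`, so orthogonality extends to all polynomials, first in `t`,
then in `x`. -/
lemma ae_eq_zero_of_fourierCoeff {j : ℕ} {g : ℝ × ℝ → ℝ} (hg : MemLp g 2 (weightedMeasure j))
    (h : ∀ i, fourierCoeff j g i = 0) : g =ᵐ[weightedMeasure j] 0 := by
  have h1 : ∀ (l : ℕ) (q : ℝ[X]),
      ∫ z, g z * ((gegenP j l).eval z.1 * q.eval z.2) ∂(weightedMeasure j) = 0 := by
    intro l q
    have hq : q ∈ Submodule.span ℝ (Set.range hermiteSeq) := by
      rw [hermiteSeq.span fun i => isUnit_iff_ne_zero.2 (leadingCoeff_ne_zero.2 (hermiteSeq.ne_zero i))]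
      trivial
    induction hq using Submodule.span_induction with
    | mem q hq =>
      obtain ⟨m, rfl⟩ := hq
      exact h (m, l)
    | zero => simp
    | add q r _ _ hq hr =>
      simp only [eval_add, mul_add]
      rw [integral_add (integrable_mul_poly hg _ _) (integrable_mul_poly hg _ _), hq, hr, add_zero]
    | smul c q _ hq =>
      simp only [eval_smul, smul_eq_mul, mul_left_comm _ c]
      rw [integral_const_mul, hq, mul_zero]
  have h2 : ∀ p q : ℝ[X],
      ∫ z, g z * (p.eval z.1 * q.eval z.2) ∂(weightedMeasure j) = 0 := by
    intro p q
    have hp : p ∈ Submodule.span ℝ (Set.range (gegenSeq j)) := by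
      rw [(gegenSeq j).span fun i => isUnit_iff_ne_zero.2
        (leadingCoeff_ne_zero.2 ((gegenSeq j).ne_zero i))]
      trivial
    induction hp using Submodule.span_induction with
    | mem p hp =>
      obtain ⟨l, rfl⟩ := hp
      exact h1 l q
    | zero => simp
    | add p r _ _ hp hr =>
      simp only [eval_add, add_mul, mul_add]
      rw [integral_add (integrable_mul_poly hg _ _) (integrable_mul_poly hg _ _), hp, hr, add_zero]
    | smul c p _ hp =>
      simp only [eval_smul, smul_eq_mul, mul_assoc, mul_left_comm _ c]
      rw [integral_const_mul, hp, mul_zero]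
  refine ae_eq_zero_of_integral_mul_monomial (hg.integrable (by norm_num)) (fun L => ?_)
    (fun a b => ?_) (fun a b => ?_)
  · exact hg.abs.integrable_mul ((memLp_exp_strip L).mono_measure (weightedMeasure_le j))
  · simpa using integrable_mul_poly hg (X ^ a) (X ^ b)
  · simpa using h2 (X ^ a) (X ^ b)

lemma inner_toLp {j : ℕ} {u v : ℝ × ℝ → ℝ} (hu : MemLp u 2 (weightedMeasure j))
    (hv : MemLp v 2 (weightedMeasure j)) :
    inner ℝ (hu.toLp u) (hv.toLp v) = ∫ p, u p * v p ∂(weightedMeasure j) := by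
  rw [L2.inner_def]
  refine integral_congr_ae ?_
  filter_upwards [hu.coeFn_toLp, hv.coeFn_toLp] with p h1 h2
  rw [h1, h2]
  simp [mul_comm]

lemma orthonormal_basisFn (j : ℕ) :
    Orthonormal ℝ fun i => (memLp_basisFn j i).toLp (basisFn j i) := by
  rw [orthonormal_iff_ite]
  intro a b
  rw [inner_toLp]
  exact fourierCoeff_basisFn j a b

/-- The functions `basisFn j` as a Hilbert basis. -/
def hilbertBasis (j : ℕ) : HilbertBasis (ℕ × ℕ) ℝ (Lp ℝ 2 (weightedMeasure j)) :=
  HilbertBasis.mkOfOrthogonalEqBot (orthonormal_basisFn j) (by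
    rw [Submodule.eq_bot_iff]
    intro g hg
    rw [Submodule.mem_orthogonal] at hg
    rw [Lp.eq_zero_iff_ae_eq_zero]
    refine ae_eq_zero_of_fourierCoeff (Lp.memLp g) fun i => ?_
    have h := hg _ (Submodule.subset_span (mem_range_self i))
    conv at h => lhs; rw [← Lp.toLp_coeFn g (Lp.memLp g)]
    rw [inner_toLp] at h
    rw [fourierCoeff, ← h]
    simp_rw [mul_comm])

lemma hilbertBasis_apply (j : ℕ) (i : ℕ × ℕ) :
    hilbertBasis j i = (memLp_basisFn j i).toLp (basisFn j i) := by
  rw [hilbertBasis, HilbertBasis.coe_mkOfOrthogonalEqBot]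

theorem parseval {j : ℕ} {u v : ℝ × ℝ → ℝ} (hu : MemLp u 2 (weightedMeasure j))
    (hv : MemLp v 2 (weightedMeasure j)) :
    HasSum (fun i => fourierCoeff j u i * fourierCoeff j v i)
      (∫ p, u p * v p ∂(weightedMeasure j)) := by
  have h := (hilbertBasis j).hasSum_inner_mul_inner (hu.toLp u) (hv.toLp v)
  rw [inner_toLp] at h
  have e : ∀ i, inner ℝ (hu.toLp u) (hilbertBasis j i) * inner ℝ (hilbertBasis j i) (hv.toLp v)
      = fourierCoeff j u i * fourierCoeff j v i := by
    intro i
    rw [hilbertBasis_apply, inner_toLp, inner_toLp, fourierCoeff, fourierCoeff]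
    simp_rw [mul_comm (v _)]
  simpa only [e] using h

theorem riesz_fischer (j : ℕ) {c : ℕ × ℕ → ℝ} (hc : Summable fun i => c i ^ 2) :
    ∃ u, MemLp u 2 (weightedMeasure j) ∧ ∀ i, fourierCoeff j u i = c i := by
  have hm : Memℓp c 2 := by
    rw [memℓp_gen_iff (by norm_num)]
    simpa using hc
  let w : lp (fun _ : ℕ × ℕ => ℝ) 2 := ⟨c, hm⟩
  set u := (hilbertBasis j).repr.symm w with hu
  refine ⟨u, Lp.memLp u, fun i => ?_⟩
  have h := (hilbertBasis j).repr_apply_apply u i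
  rw [hu, LinearIsometryEquiv.apply_symm_apply, ← hu] at h
  conv at h => rhs; rw [← Lp.toLp_coeFn u (Lp.memLp u)]
  rw [hilbertBasis_apply, inner_toLp] at h
  change c i = _ at h
  rw [h, fourierCoeff]
  simp_rw [mul_comm]

/-! ### Integration by parts against test functions -/

lemma contDiff_deriv {f : ℝ → ℝ} (hf : ContDiff ℝ ∞ f) : ContDiff ℝ ∞ (deriv f) :=
  ((contDiff_infty_iff_deriv (𝕜 := ℝ)).1 hf).2

lemma contDiff_iteratedDeriv {f : ℝ → ℝ} (hf : ContDiff ℝ ∞ f) (n : ℕ) :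
    ContDiff ℝ ∞ (iteratedDeriv n f) := by
  induction n with
  | zero => simpa using hf
  | succ n ih => rw [iteratedDeriv_succ]; exact contDiff_deriv ih

lemma differentiable_of_smooth {f : ℝ → ℝ} (hf : ContDiff ℝ ∞ f) : Differentiable ℝ f :=
  hf.differentiable (by simp)

lemma integral_mul_iteratedDeriv {u φ : ℝ → ℝ} (hu : ContDiff ℝ ∞ u) (hφ : ContDiff ℝ ∞ φ)
    (hc : HasCompactSupport φ) (n : ℕ) :
    ∫ x, u x * iteratedDeriv n φ x = (-1) ^ n * ∫ x, iteratedDeriv n u x * φ x := by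
  induction n generalizing φ with
  | zero => simp
  | succ n ih =>
    rw [iteratedDeriv_succ', ih (contDiff_deriv hφ) hc.deriv]
    set v := iteratedDeriv n u
    have hv : ContDiff ℝ ∞ v := contDiff_iteratedDeriv hu n
    have h1 : Integrable fun x => deriv v x * φ x :=
      ((contDiff_deriv hv).continuous.mul hφ.continuous).integrable_of_hasCompactSupport
        (hc.mul_left)
    have h2 : Integrable fun x => v x * deriv φ x :=
      (hv.continuous.mul (contDiff_deriv hφ).continuous).integrable_of_hasCompactSupport
        (hc.deriv.mul_left)
    have h := integral_eq_zero_of_hasDerivAt_of_integrable (f := fun x => v x * φ x)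
      (fun x => ((differentiable_of_smooth hv) x).hasDerivAt.mul
        ((differentiable_of_smooth hφ) x).hasDerivAt) (h1.add h2)
      ((hv.continuous.mul hφ.continuous).integrable_of_hasCompactSupport hc.mul_left)
    rw [integral_add h1 h2] at h
    rw [iteratedDeriv_succ, pow_succ]
    linear_combination (-1) ^ n * h

/-- `∂_x^j φ`. -/
def derivX (j : ℕ) (φ : ℝ × ℝ → ℝ) (p : ℝ × ℝ) : ℝ := iteratedDeriv j (fun x => φ (x, p.2)) p.1

/-- `∂_t^k φ`. -/
def derivT (k : ℕ) (φ : ℝ × ℝ → ℝ) (p : ℝ × ℝ) : ℝ := iteratedDeriv k (fun t => φ (p.1, t)) p.2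

lemma fderiv_apply_smooth {φ : ℝ × ℝ → ℝ} (hφ : ContDiff ℝ ∞ φ) (v : ℝ × ℝ) :
    ContDiff ℝ ∞ (fun p => fderiv ℝ φ p v) ∧ tsupport (fun p => fderiv ℝ φ p v) ⊆ tsupport φ :=
  ⟨(hφ.fderiv_right (by simp)).clm_apply contDiff_const, tsupport_fderiv_apply_subset ℝ v⟩

/-- A partial derivative is `fderiv` evaluated at a fixed vector, which preserves smoothness and
does not enlarge the support. -/
lemma derivX_smooth (j : ℕ) {φ : ℝ × ℝ → ℝ} (hφ : ContDiff ℝ ∞ φ) :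
    ContDiff ℝ ∞ (derivX j φ) ∧ tsupport (derivX j φ) ⊆ tsupport φ := by
  induction j generalizing φ with
  | zero =>
    have : derivX 0 φ = φ := by ext p; simp [derivX]
    rw [this]; exact ⟨hφ, subset_rfl⟩
  | succ j ih =>
    obtain ⟨h1, h2⟩ := fderiv_apply_smooth hφ (1, 0)
    have e : derivX (j + 1) φ = derivX j (fun p => fderiv ℝ φ p (1, 0)) := by
      ext p
      rw [derivX, derivX, iteratedDeriv_succ']
      congr 1
      ext x
      have hd : HasFDerivAt φ (fderiv ℝ φ (x, p.2)) (x, p.2) :=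
        (hφ.differentiable (by simp) _).hasFDerivAt
      exact (hd.comp_hasDerivAt x ((hasDerivAt_id x).prodMk (hasDerivAt_const x p.2))).deriv
    rw [e]
    exact ⟨(ih h1).1, (ih h1).2.trans h2⟩

lemma derivT_smooth (k : ℕ) {φ : ℝ × ℝ → ℝ} (hφ : ContDiff ℝ ∞ φ) :
    ContDiff ℝ ∞ (derivT k φ) ∧ tsupport (derivT k φ) ⊆ tsupport φ := by
  induction k generalizing φ with
  | zero =>
    have : derivT 0 φ = φ := by ext p; simp [derivT]
    rw [this]; exact ⟨hφ, subset_rfl⟩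
  | succ k ih =>
    obtain ⟨h1, h2⟩ := fderiv_apply_smooth hφ (0, 1)
    have e : derivT (k + 1) φ = derivT k (fun p => fderiv ℝ φ p (0, 1)) := by
      ext p
      rw [derivT, derivT, iteratedDeriv_succ']
      congr 1
      ext t
      have hd : HasFDerivAt φ (fderiv ℝ φ (p.1, t)) (p.1, t) :=
        (hφ.differentiable (by simp) _).hasFDerivAt
      exact (hd.comp_hasDerivAt t ((hasDerivAt_const t p.1).prodMk (hasDerivAt_id t))).deriv
    rw [e]
    exact ⟨(ih h1).1, (ih h1).2.trans h2⟩

/-- `∂_t^k ∂_x^j φ`. -/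
def mixedDeriv (j k : ℕ) (φ : ℝ × ℝ → ℝ) (p : ℝ × ℝ) : ℝ :=
  iteratedDeriv k (fun t => iteratedDeriv j (fun x => φ (x, t)) p.1) p.2

lemma mixedDeriv_eq (j k : ℕ) (φ : ℝ × ℝ → ℝ) : mixedDeriv j k φ = derivT k (derivX j φ) := rfl

lemma mixedDeriv_smooth (j k : ℕ) {φ : ℝ × ℝ → ℝ} (hφ : ContDiff ℝ ∞ φ) :
    ContDiff ℝ ∞ (mixedDeriv j k φ) ∧ tsupport (mixedDeriv j k φ) ⊆ tsupport φ := by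
  rw [mixedDeriv_eq]
  have h := derivX_smooth j hφ
  have h' := derivT_smooth k h.1
  exact ⟨h'.1, h'.2.trans h.2⟩

lemma hasCompactSupport_of_subset {φ ψ : ℝ × ℝ → ℝ} (hc : HasCompactSupport φ)
    (h : tsupport ψ ⊆ tsupport φ) : HasCompactSupport ψ :=
  IsCompact.of_isClosed_subset hc (isClosed_tsupport ψ) h

lemma hasCompactSupport_slice_left {φ : ℝ × ℝ → ℝ} (hc : HasCompactSupport φ) (t : ℝ) :
    HasCompactSupport fun x => φ (x, t) := by
  refine HasCompactSupport.of_support_subset_isCompact (hc.image continuous_fst) fun x hx => ?_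
  exact ⟨(x, t), subset_tsupport _ hx, rfl⟩

lemma hasCompactSupport_slice_right {φ : ℝ × ℝ → ℝ} (hc : HasCompactSupport φ) (x : ℝ) :
    HasCompactSupport fun t => φ (x, t) := by
  refine HasCompactSupport.of_support_subset_isCompact (hc.image continuous_snd) fun t ht => ?_
  exact ⟨(x, t), subset_tsupport _ ht, rfl⟩

lemma integral_mul_mixedDeriv {a b : ℝ → ℝ} (ha : ContDiff ℝ ∞ a) (hb : ContDiff ℝ ∞ b)
    {φ : ℝ × ℝ → ℝ} (hφ : ContDiff ℝ ∞ φ) (hc : HasCompactSupport φ) (j k : ℕ) :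
    ∫ p : ℝ × ℝ, a p.1 * b p.2 * mixedDeriv j k φ p
      = (-1) ^ (j + k) * ∫ p : ℝ × ℝ, iteratedDeriv j a p.1 * iteratedDeriv k b p.2 * φ p := by
  have hψ := derivX_smooth j hφ
  have hψc := hasCompactSupport_of_subset hc hψ.2
  have hD := mixedDeriv_smooth j k hφ
  have hDc := hasCompactSupport_of_subset hc hD.2
  have hbk := (contDiff_iteratedDeriv hb k).continuous
  have haj := (contDiff_iteratedDeriv ha j).continuous
  have hac := ha.continuous
  have hbc := hb.continuous
  have hint : ∀ {u v : ℝ → ℝ} {ψ : ℝ × ℝ → ℝ}, Continuous u → Continuous v → Continuous ψ →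
      HasCompactSupport ψ → Integrable (fun p : ℝ × ℝ => u p.1 * v p.2 * ψ p)
        ((volume : Measure ℝ).prod volume) := by
    intro u v ψ hu hv hψ hψc
    have hcont : Continuous (fun p : ℝ × ℝ => u p.1 * v p.2 * ψ p) := by fun_prop
    exact hcont.integrable_of_hasCompactSupport hψc.mul_left
  have h1 : ∫ p : ℝ × ℝ, a p.1 * b p.2 * mixedDeriv j k φ p
      = (-1) ^ k * ∫ p : ℝ × ℝ, a p.1 * iteratedDeriv k b p.2 * derivX j φ p := by
    rw [Measure.volume_eq_prod, integral_prod _ (hint hac hbc hD.1.continuous hDc),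
      integral_prod _ (hint hac hbk hψ.1.continuous hψc), ← integral_const_mul]
    congr 1
    ext x
    have h := integral_mul_iteratedDeriv hb
      (hψ.1.comp (contDiff_const.prodMk contDiff_id : ContDiff ℝ ∞ fun t : ℝ => (x, t)))
      (hasCompactSupport_slice_right hψc x) k
    simp only [mul_assoc, integral_const_mul]
    rw [mul_left_comm]
    congr 1
  have h2 : ∫ p : ℝ × ℝ, a p.1 * iteratedDeriv k b p.2 * derivX j φ p
      = (-1) ^ j * ∫ p : ℝ × ℝ, iteratedDeriv j a p.1 * iteratedDeriv k b p.2 * φ p := by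
    rw [Measure.volume_eq_prod, integral_prod_symm _ (hint hac hbk hψ.1.continuous hψc),
      integral_prod_symm _ (hint haj hbk hφ.continuous hc), ← integral_const_mul]
    congr 1
    ext t
    have h := integral_mul_iteratedDeriv ha
      (hφ.comp (contDiff_id.prodMk contDiff_const : ContDiff ℝ ∞ fun x : ℝ => (x, t)))
      (hasCompactSupport_slice_left hc t) j
    simp only [mul_right_comm _ (iteratedDeriv k b t), integral_mul_const]
    rw [← mul_assoc]
    congr 1
  rw [h1, h2, pow_add]
  ring

lemma setIntegral_strip_mul {φ : ℝ × ℝ → ℝ} (hs : tsupport φ ⊆ strip) (f : ℝ × ℝ → ℝ) :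
    ∫ p in strip, f p * φ p = ∫ p, f p * φ p := by
  refine setIntegral_eq_integral_of_forall_compl_eq_zero fun p hp => ?_
  rw [image_eq_zero_of_notMem_tsupport fun h => hp (hs h), mul_zero]

lemma isOpen_strip : IsOpen strip := isOpen_Ioo.prod isOpen_univ

lemma hasWeakDeriv_mul {a b : ℝ → ℝ} (ha : ContDiff ℝ ∞ a) (hb : ContDiff ℝ ∞ b) (j k : ℕ) :
    HasWeakDeriv j k (fun p => a p.1 * b p.2)
      (fun p => iteratedDeriv j a p.1 * iteratedDeriv k b p.2) := by
  have hbk := (contDiff_iteratedDeriv hb k).continuous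
  have haj := (contDiff_iteratedDeriv ha j).continuous
  refine ⟨Continuous.locallyIntegrable (by fun_prop) |>.locallyIntegrableOn _,
    fun φ hφ hc hs => ?_⟩
  change ∫ p in strip, a p.1 * b p.2 * mixedDeriv j k φ p = _
  rw [setIntegral_strip_mul ((mixedDeriv_smooth j k hφ).2.trans hs),
    setIntegral_strip_mul hs (fun p => iteratedDeriv j a p.1 * iteratedDeriv k b p.2),
    integral_mul_mixedDeriv ha hb hφ hc]

lemma memSobolev_of_contDiff {U : Set ℝ} {n : ℕ} {g : ℝ → ℝ} (hg : ContDiff ℝ ∞ g)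
    (h : ∀ i, MemLp (iteratedDeriv i g) 2 (volume.restrict U)) : MemSobolev U n g := by
  refine ⟨by simpa using h 0, fun i _ => ⟨_, h i, fun φ hφ hc hs => ?_⟩⟩
  have e : ∀ (f ψ : ℝ → ℝ), tsupport ψ ⊆ tsupport φ →
      ∫ x in U, f x * ψ x = ∫ x, f x * ψ x := by
    intro f ψ hψ
    refine setIntegral_eq_integral_of_forall_compl_eq_zero fun x hx => ?_
    rw [image_eq_zero_of_notMem_tsupport fun h => hx (hs (hψ h)), mul_zero]
  have hsub : ∀ (n : ℕ), tsupport (iteratedDeriv n φ) ⊆ tsupport φ := by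
    intro n
    induction n with
    | zero => simp
    | succ n ih =>
      rw [iteratedDeriv_succ]
      exact (closure_minimal support_deriv_subset (isClosed_tsupport _)).trans ih
  rw [e _ _ (hsub i), e _ _ subset_rfl, integral_mul_iteratedDeriv hg hφ hc]

/-! ### Lebesgue measure on the strip -/

lemma stripMeasure_eq : stripMeasure
    = (volume.restrict strip).withDensity fun p => ENNReal.ofReal (gaussDens p.2) := by
  rw [stripMeasure, gaussianReal_eq, prod_withDensity_right (measurable_gaussianPDF 0 1),
    strip, Measure.volume_eq_prod, ← Measure.prod_restrict, Measure.restrict_univ]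
  rfl

lemma measurable_gaussDens_snd :
    Measurable fun p : ℝ × ℝ => ENNReal.ofReal (gaussDens p.2) := by
  have := measurable_gaussianPDFReal 0 1
  fun_prop

lemma integral_stripMeasure (f : ℝ × ℝ → ℝ) :
    ∫ p, f p ∂stripMeasure = ∫ p in strip, f p * gaussDens p.2 := by
  rw [stripMeasure_eq, integral_withDensity_eq_integral_toReal_smul measurable_gaussDens_snd
    (by simp)]
  congr 1
  ext p
  rw [ENNReal.toReal_ofReal (gaussDens_pos _).le, smul_eq_mul, mul_comm]

lemma integrable_stripMeasure_iff (f : ℝ × ℝ → ℝ) :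
    Integrable f stripMeasure ↔ IntegrableOn (fun p => f p * gaussDens p.2) strip := by
  rw [stripMeasure_eq, integrable_withDensity_iff measurable_gaussDens_snd (by simp), IntegrableOn]
  simp_rw [ENNReal.toReal_ofReal (gaussDens_pos _).le]

lemma stripMeasure_absolutelyContinuous : stripMeasure ≪ volume.restrict strip := by
  rw [stripMeasure_eq]; exact withDensity_absolutelyContinuous _ _

lemma absolutelyContinuous_stripMeasure : volume.restrict strip ≪ stripMeasure := by
  rw [stripMeasure_eq]
  refine withDensity_absolutelyContinuous' measurable_gaussDens_snd.aemeasurable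
    (ae_of_all _ fun p => ?_)
  simpa using gaussDens_pos p.2

lemma integral_weightedMeasure' (j : ℕ) (f : ℝ × ℝ → ℝ) :
    ∫ p, f p ∂(weightedMeasure j)
      = ∫ p in strip, f p * ((1 - p.1 ^ 2) ^ j * gaussDens p.2) := by
  rw [integral_weightedMeasure, integral_stripMeasure]
  simp_rw [mul_assoc]

lemma integrable_weightedMeasure_iff' (j : ℕ) (f : ℝ × ℝ → ℝ) :
    Integrable f (weightedMeasure j)
      ↔ IntegrableOn (fun p => f p * ((1 - p.1 ^ 2) ^ j * gaussDens p.2)) strip := by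
  rw [integrable_weightedMeasure_iff, integrable_stripMeasure_iff]
  simp_rw [mul_assoc]

lemma continuous_density (j : ℕ) :
    Continuous fun p : ℝ × ℝ => (1 - p.1 ^ 2) ^ j * gaussDens p.2 := by
  have := contDiff_gaussDens.continuous
  fun_prop

lemma density_pos (j : ℕ) {p : ℝ × ℝ} (hp : p ∈ strip) :
    0 < (1 - p.1 ^ 2) ^ j * gaussDens p.2 :=
  mul_pos (pow_pos (one_sub_sq_pos hp) j) (gaussDens_pos _)

/-- On a compact subset of the open strip the density is continuous and positive, so its inverse is
bounded there. -/
lemma locallyIntegrableOn_of_memLp {j : ℕ} {g : ℝ × ℝ → ℝ} (hg : MemLp g 2 (weightedMeasure j)) :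
    LocallyIntegrableOn g strip := by
  rw [locallyIntegrableOn_iff isOpen_strip.isLocallyClosed]
  intro K hK hKc
  have h := (integrable_weightedMeasure_iff' j g).1 (hg.integrable (by norm_num))
  have h2 := (h.mono_set hK).mul_continuousOn
    (g' := fun p => ((1 - p.1 ^ 2) ^ j * gaussDens p.2)⁻¹)
    ((continuous_density j).continuousOn.inv₀ fun p hp => (density_pos j (hK hp)).ne') hKc
  refine h2.congr_fun (fun p hp => ?_) hKc.measurableSet
  have := (density_pos j (hK hp)).ne'
  simp only
  rw [mul_assoc, mul_inv_cancel₀ this, mul_one]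

/-! ### Cutoff functions -/

/-- A bounded smooth function whose derivative has compact support. -/
structure IsProfile (η : ℝ → ℝ) : Prop where
  smooth : ContDiff ℝ ∞ η
  bounded : ∃ C, ∀ u, |η u| ≤ C
  deriv_compact : HasCompactSupport (deriv η)

lemma IsProfile.of_compactSupport {η : ℝ → ℝ} (h : ContDiff ℝ ∞ η) (hc : HasCompactSupport η) :
    IsProfile η :=
  ⟨h, hc.exists_bound_of_continuous h.continuous, hc.deriv⟩

lemma IsProfile.deriv {η : ℝ → ℝ} (h : IsProfile η) : IsProfile (deriv η) :=
  .of_compactSupport (contDiff_deriv h.smooth) h.deriv_compact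

/-- Stability under `η ↦ u η'(u)` makes bounds at the boundary uniform: the large factor `r` from
the chain rule is absorbed together with one factor `1-x²`. -/
lemma IsProfile.mul_deriv {η : ℝ → ℝ} (h : IsProfile η) : IsProfile fun u => u * _root_.deriv η u :=
  .of_compactSupport (contDiff_id.mul (contDiff_deriv h.smooth)) h.deriv_compact.mul_left

/-- A smooth function that vanishes on `(-∞, 1]` and is `1` on `[2, ∞)`. -/
def lowCut (u : ℝ) : ℝ := Real.smoothTransition (u - 1)

/-- A smooth function that is `1` on `[-1, 1]` and vanishes outside `[-2, 2]`. -/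
def highCut (u : ℝ) : ℝ := Real.smoothTransition (2 - u ^ 2)

lemma lowCut_isProfile : IsProfile lowCut := by
  have hs : ContDiff ℝ ∞ lowCut :=
    Real.smoothTransition.contDiff.comp (contDiff_id.sub contDiff_const)
  refine ⟨hs, ⟨1, fun u => ?_⟩, ?_⟩
  · rw [lowCut, abs_of_nonneg (Real.smoothTransition.nonneg _)]
    exact Real.smoothTransition.le_one _
  · refine HasCompactSupport.of_support_subset_isCompact (isCompact_Icc (a := (1 : ℝ)) (b := 2))
      fun u hu => ?_
    by_contra hn
    apply hu
    rw [mem_Icc, not_and_or, not_le, not_le] at hn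
    rcases hn with hn | hn
    · have : lowCut =ᶠ[𝓝 u] fun _ => 0 := by
        filter_upwards [Iio_mem_nhds hn] with v hv
        exact Real.smoothTransition.zero_of_nonpos (by rw [mem_Iio] at hv; linarith)
      rw [this.deriv_eq, deriv_const]
    · have : lowCut =ᶠ[𝓝 u] fun _ => 1 := by
        filter_upwards [Ioi_mem_nhds hn] with v hv
        exact Real.smoothTransition.one_of_one_le (by rw [mem_Ioi] at hv; linarith)
      rw [this.deriv_eq, deriv_const]

lemma highCut_smooth : ContDiff ℝ ∞ highCut :=
  Real.smoothTransition.contDiff.comp (contDiff_const.sub (contDiff_id.pow 2))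

lemma highCut_compact : HasCompactSupport highCut := by
  refine HasCompactSupport.of_support_subset_isCompact (isCompact_Icc (a := (-2 : ℝ)) (b := 2))
    fun u hu => ?_
  by_contra hn
  apply hu
  refine Real.smoothTransition.zero_of_nonpos ?_
  rw [mem_Icc, not_and_or, not_le, not_le] at hn
  rcases hn with hn | hn <;> nlinarith

lemma highCut_isProfile : IsProfile highCut := .of_compactSupport highCut_smooth highCut_compact

lemma abs_lowCut_le (u : ℝ) : |lowCut u| ≤ 1 := by
  rw [lowCut, abs_of_nonneg (Real.smoothTransition.nonneg _)]
  exact Real.smoothTransition.le_one _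

lemma abs_highCut_le (u : ℝ) : |highCut u| ≤ 1 := by
  rw [highCut, abs_of_nonneg (Real.smoothTransition.nonneg _)]
  exact Real.smoothTransition.le_one _

lemma highCut_eq_one {u : ℝ} (h : |u| ≤ 1) : highCut u = 1 := by
  refine Real.smoothTransition.one_of_one_le ?_
  nlinarith [sq_abs u, abs_nonneg u]

lemma lowCut_eq_one {u : ℝ} (h : 2 ≤ u) : lowCut u = 1 :=
  Real.smoothTransition.one_of_one_le (by linarith)

lemma lowCut_eq_zero {u : ℝ} (h : u ≤ 1) : lowCut u = 0 :=
  Real.smoothTransition.zero_of_nonpos (by linarith)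

lemma contDiff_eval (p : ℝ[X]) : ContDiff ℝ ∞ fun x => p.eval x := by
  simpa [aeval_def] using p.contDiff_aeval (𝕜 := ℝ) ∞

/-- The `j`-th derivative of `(1-x²)^j q(x) η(r(1-x²))` is bounded uniformly in `r`. -/
lemma exists_bound_iteratedDeriv_weight (j : ℕ) {η : ℝ → ℝ} (hη : IsProfile η) (q : ℝ[X]) :
    ∃ C, ∀ r : ℝ, ∀ x ∈ Ioo (-1 : ℝ) 1,
      |iteratedDeriv j (fun x => ((1 - X ^ 2) ^ j * q).eval x * η (r * (1 - x ^ 2))) x| ≤ C := by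
  induction j generalizing η q with
  | zero =>
    obtain ⟨C, hC⟩ := hη.bounded
    obtain ⟨M, hM⟩ := (isCompact_Icc (a := (-1 : ℝ)) (b := 1)).exists_bound_of_continuousOn
      q.continuous.continuousOn
    refine ⟨M * C, fun r x hx => ?_⟩
    simp only [iteratedDeriv_zero, pow_zero, one_mul, abs_mul]
    have h1 := hM x (Ioo_subset_Icc_self hx)
    exact mul_le_mul h1 (hC _) (abs_nonneg _) ((norm_nonneg _).trans h1)
  | succ j ih =>
    -- With `u = r(1-x²)`, one derivative of `(1-x²)^(j+1) q η(u)` is `(1-x²)^j (q1 η(u) + q2 u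
    -- η'(u))`. Both terms have the original shape with `j` lowered by one.
    set q1 : ℝ[X] := (1 - X ^ 2) * derivative q - C (2 * ((j : ℝ) + 1)) * X * q
    set q2 : ℝ[X] := C (-2 : ℝ) * X * q
    obtain ⟨C1, h1⟩ := ih hη q1
    obtain ⟨C2, h2⟩ := ih hη.mul_deriv q2
    refine ⟨C1 + C2, fun r x hx => ?_⟩
    have hsm : ∀ {ζ : ℝ → ℝ} (_ : ContDiff ℝ ∞ ζ) (p : ℝ[X]),
        ContDiff ℝ ∞ fun x => p.eval x * ζ (r * (1 - x ^ 2)) := by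
      intro ζ hζ p
      exact (contDiff_eval p).mul (hζ.comp (contDiff_const.mul (contDiff_const.sub
        (contDiff_id.pow 2))))
    have e : _root_.deriv (fun x => ((1 - X ^ 2) ^ (j + 1) * q).eval x * η (r * (1 - x ^ 2)))
        = fun x => ((1 - X ^ 2) ^ j * q1).eval x * η (r * (1 - x ^ 2))
          + ((1 - X ^ 2) ^ j * q2).eval x *
            (r * (1 - x ^ 2) * _root_.deriv η (r * (1 - x ^ 2))) := by
      ext x
      refine HasDerivAt.deriv ?_
      have hi : HasDerivAt (fun x : ℝ => r * (1 - x ^ 2)) (r * (-(2 * x))) x := by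
        have := (((hasDerivAt_pow 2 x).const_sub 1).const_mul r)
        convert! this using 1
        simp
      have hη' := ((differentiable_of_smooth hη.smooth) (r * (1 - x ^ 2))).hasDerivAt.comp x hi
      convert! (((1 - X ^ 2) ^ (j + 1) * q).hasDerivAt x).mul hη' using 1
      simp [q1, q2, derivative_pow]
      ring
    rw [iteratedDeriv_succ', e, iteratedDeriv_fun_add]
    · exact (abs_add_le _ _).trans (add_le_add (h1 r x hx) (h2 r x hx))
    · exact ((hsm hη.smooth _).of_le (by exact_mod_cast le_top)).contDiffAt
    · exact ((hsm hη.mul_deriv.smooth _).of_le (by exact_mod_cast le_top)).contDiffAt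

/-- The derivatives of `b(t) η(rt)` are controlled by those of `b`, uniformly in `r ∈ [0,1]`. -/
lemma exists_bound_iteratedDeriv_mul (k : ℕ) {η b : ℝ → ℝ} (hη : IsProfile η)
    (hb : ContDiff ℝ ∞ b) :
    ∃ C, 0 ≤ C ∧ ∀ r ∈ Icc (0 : ℝ) 1, ∀ t,
      |iteratedDeriv k (fun t => b t * η (r * t)) t|
        ≤ C * ∑ i ∈ Finset.range (k + 1), |iteratedDeriv i b t| := by
  induction k generalizing η b with
  | zero =>
    obtain ⟨C, hC⟩ := hη.bounded
    refine ⟨C, (abs_nonneg _).trans (hC 0), fun r _ t => ?_⟩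
    simp only [iteratedDeriv_zero, abs_mul, zero_add, Finset.range_one, Finset.sum_singleton]
    rw [mul_comm]
    exact mul_le_mul_of_nonneg_right (hC _) (abs_nonneg _)
  | succ k ih =>
    obtain ⟨C1, h10, h1⟩ := ih hη (contDiff_deriv hb)
    obtain ⟨C2, h20, h2⟩ := ih hη.deriv hb
    refine ⟨C1 + C2, by positivity, fun r hr t => ?_⟩
    have hsm : ∀ {ζ c : ℝ → ℝ} (_ : ContDiff ℝ ∞ ζ) (_ : ContDiff ℝ ∞ c),
        ContDiff ℝ ∞ fun t => c t * ζ (r * t) := by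
      intro ζ c hζ hc
      exact hc.mul (hζ.comp (contDiff_const.mul contDiff_id))
    have e : _root_.deriv (fun t => b t * η (r * t))
        = fun t => _root_.deriv b t * η (r * t) + r * (b t * _root_.deriv η (r * t)) := by
      ext t
      refine HasDerivAt.deriv ?_
      have hη' := ((differentiable_of_smooth hη.smooth) (r * t)).hasDerivAt.comp t
        ((hasDerivAt_id t).const_mul r)
      convert! ((differentiable_of_smooth hb) t).hasDerivAt.mul hη' using 1
      simp
      ring
    rw [iteratedDeriv_succ', e, iteratedDeriv_fun_add, iteratedDeriv_const_mul_field]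
    · have s1 : ∑ i ∈ Finset.range (k + 1), |iteratedDeriv i (_root_.deriv b) t|
          ≤ ∑ i ∈ Finset.range (k + 1 + 1), |iteratedDeriv i b t| := by
        rw [Finset.sum_range_succ' _ (k + 1)]
        simp_rw [← iteratedDeriv_succ']
        linarith [abs_nonneg (iteratedDeriv 0 b t)]
      have s2 : ∑ i ∈ Finset.range (k + 1), |iteratedDeriv i b t|
          ≤ ∑ i ∈ Finset.range (k + 1 + 1), |iteratedDeriv i b t| := by
        rw [Finset.sum_range_succ _ (k + 1)]
        linarith [abs_nonneg (iteratedDeriv (k + 1) b t)]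
      refine (abs_add_le _ _).trans ?_
      rw [add_mul]
      refine add_le_add ((h1 r hr t).trans (mul_le_mul_of_nonneg_left s1 h10)) ?_
      rw [abs_mul, abs_of_nonneg hr.1]
      -- The chain rule factor `r` is discarded because `r ≤ 1`.
      refine (mul_le_of_le_one_left (abs_nonneg _) hr.2).trans ?_
      exact (h2 r hr t).trans (mul_le_mul_of_nonneg_left s2 h20)
    · exact ((hsm hη.smooth (contDiff_deriv hb)).of_le (by exact_mod_cast le_top)).contDiffAt
    · exact ((contDiff_const.mul (hsm hη.deriv.smooth hb)).of_le
        (by exact_mod_cast le_top)).contDiffAt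

/-! ### Fourier coefficients of weak derivatives. -/

lemma mixedDeriv_mul (j k : ℕ) (a b : ℝ → ℝ) (p : ℝ × ℝ) :
    mixedDeriv j k (fun p => a p.1 * b p.2) p = iteratedDeriv j a p.1 * iteratedDeriv k b p.2 := by
  simp only [mixedDeriv, iteratedDeriv_mul_const_field, iteratedDeriv_const_mul_field]

/-- The defining identity of weak derivatives for a product test function. -/
lemma HasWeakDeriv.integral_mul {j k : ℕ} {f g : ℝ × ℝ → ℝ} (h : HasWeakDeriv j k f g)
    {a b : ℝ → ℝ} (ha : ContDiff ℝ ∞ a) (hb : ContDiff ℝ ∞ b) (hac : HasCompactSupport a)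
    (hbc : HasCompactSupport b) (has : tsupport a ⊆ Ioo (-1) 1) :
    ∫ p in strip, f p * (iteratedDeriv j a p.1 * iteratedDeriv k b p.2)
      = (-1) ^ (j + k) * ∫ p in strip, g p * (a p.1 * b p.2) := by
  have hsub : tsupport (fun p : ℝ × ℝ => a p.1 * b p.2) ⊆ tsupport a ×ˢ tsupport b := by
    refine closure_minimal (fun p hp => ?_) ((isClosed_tsupport a).prod (isClosed_tsupport b))
    exact ⟨subset_tsupport _ (left_ne_zero_of_mul hp), subset_tsupport _ (right_ne_zero_of_mul hp)⟩
  have h' := h.2 (fun p => a p.1 * b p.2) ((ha.comp contDiff_fst).mul (hb.comp contDiff_snd))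
    (IsCompact.of_isClosed_subset (hac.isCompact.prod hbc.isCompact) (isClosed_tsupport _) hsub)
    (hsub.trans (prod_mono has (subset_univ _)))
  simp_rw [← mixedDeriv_mul j k a b]
  exact h'

/-- The Fourier coefficients of a weak derivative. -/
theorem HasWeakDeriv.fourierCoeff_eq {j k : ℕ} {f g : ℝ × ℝ → ℝ} (h : HasWeakDeriv j k f g)
    (hf : MemLp f 2 stripMeasure) (hg : MemLp g 2 (weightedMeasure j)) (m l : ℕ) :
    fourierCoeff j g (m, l) = √((m + k).descFactorial k : ℝ) *
      √((l + 2 * j).descFactorial (2 * j) : ℝ) * fourierCoeff 0 f (m + k, l + j) := by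
  -- The product `A(x) b(t)` is the basis function times the density of the weighted measure. It
  -- would be the right test function if it had compact support in the strip; `aN` and `bN` are its
  -- truncations near `x = ±1` and for large `|t|`.
  set A : ℝ[X] := (1 - X ^ 2) ^ j * gegenP j l
  set b : ℝ → ℝ := fun t => (hermiteP m).eval t * gaussDens t
  have hbs : ContDiff ℝ ∞ b := (contDiff_eval _).mul contDiff_gaussDens
  set aN : ℕ → ℝ → ℝ := fun N x => A.eval x * lowCut (N * (1 - x ^ 2))
  set bN : ℕ → ℝ → ℝ := fun N t => b t * highCut (((N : ℝ) + 1)⁻¹ * t)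
  have haN : ∀ N, ContDiff ℝ ∞ (aN N) := fun N => (contDiff_eval A).mul
    (lowCut_isProfile.smooth.comp (contDiff_const.mul (contDiff_const.sub (contDiff_id.pow 2))))
  have hbN : ∀ N, ContDiff ℝ ∞ (bN N) := fun N => hbs.mul
    (highCut_smooth.comp (contDiff_const.mul contDiff_id))
  have has : ∀ N, tsupport (aN N) ⊆ {x | 1 ≤ N * (1 - x ^ 2)} := by
    intro N
    refine closure_minimal (fun x hx => ?_) (isClosed_le continuous_const (by fun_prop))
    by_contra hn
    exact hx (by simp only [aN]; rw [lowCut_eq_zero (not_le.1 hn).le, mul_zero])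
  have hsub : ∀ N : ℕ, {x : ℝ | 1 ≤ N * (1 - x ^ 2)} ⊆ Ioo (-1) 1 := by
    intro N x hx
    have h1 : 0 < (1 - x ^ 2) := by
      by_contra hn
      have := mul_nonpos_of_nonneg_of_nonpos (Nat.cast_nonneg N) (not_lt.1 hn)
      have : (1 : ℝ) ≤ N * (1 - x ^ 2) := hx
      linarith
    exact ⟨by nlinarith, by nlinarith⟩
  have hac : ∀ N, HasCompactSupport (aN N) := fun N =>
    isCompact_Icc.of_isClosed_subset (isClosed_tsupport _)
      (((has N).trans (hsub N)).trans Ioo_subset_Icc_self)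
  have hbc : ∀ N, HasCompactSupport (bN N) := fun N => by
    have hN : ((N : ℝ) + 1)⁻¹ ≠ 0 := by positivity
    exact (highCut_compact.comp_homeomorph (Homeomorph.mulLeft₀ _ hN)).mul_left
  have hid := fun N => h.integral_mul (haN N) (hbN N) (hac N) (hbc N) ((has N).trans (hsub N))
  have hf0 : MemLp f 2 (weightedMeasure 0) := by rwa [weightedMeasure_zero]
  have hstripvol : ∀ᵐ p : ℝ × ℝ ∂(volume.restrict strip), p ∈ strip :=
    ae_restrict_mem measurableSet_strip
  have hfm : AEStronglyMeasurable f (volume.restrict strip) :=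
    hf.1.mono_ac absolutelyContinuous_stripMeasure
  have hgm : AEStronglyMeasurable g (volume.restrict strip) :=
    h.1.aestronglyMeasurable
  have hNinv : ∀ N : ℕ, ((N : ℝ) + 1)⁻¹ ∈ Icc (0 : ℝ) 1 := fun N =>
    ⟨by positivity, inv_le_one_of_one_le₀ (by linarith [(Nat.cast_nonneg N : (0 : ℝ) ≤ N)])⟩
  -- Equality near each point, not only at the point, is needed so that all derivatives agree
  -- eventually.
  have hcut1 : ∀ x ∈ Ioo (-1 : ℝ) 1, ∀ᶠ N : ℕ in atTop, aN N =ᶠ[𝓝 x] fun x => A.eval x := by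
    intro x hx
    have hpos : 0 < 1 - x ^ 2 := by nlinarith [hx.1, hx.2]
    have ht : Tendsto (fun N : ℕ => (N : ℝ) * (1 - x ^ 2)) atTop atTop :=
      tendsto_natCast_atTop_atTop.atTop_mul_const hpos
    filter_upwards [ht.eventually_gt_atTop 2] with N hN
    have hc : Continuous fun y : ℝ => (N : ℝ) * (1 - y ^ 2) := by fun_prop
    filter_upwards [hc.continuousAt.eventually (lt_mem_nhds hN)] with y hy
    simp only [aN]
    rw [lowCut_eq_one hy.le, mul_one]
  have hcut2 : ∀ t, ∀ᶠ N : ℕ in atTop, bN N =ᶠ[𝓝 t] b := by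
    intro t
    have ht : Tendsto (fun N : ℕ => (N : ℝ)) atTop atTop := tendsto_natCast_atTop_atTop
    filter_upwards [ht.eventually_gt_atTop |t|] with N hN
    filter_upwards [continuous_abs.continuousAt.eventually (gt_mem_nhds hN)] with s hs
    simp only [bN]
    rw [highCut_eq_one, mul_one]
    rw [abs_mul, abs_of_nonneg (hNinv N).1, inv_mul_le_one₀ (by positivity)]
    linarith
  -- These bounds do not depend on `N` and provide the majorant for the limit of the differentiated
  -- side.
  obtain ⟨C1, hC1⟩ := exists_bound_iteratedDeriv_weight j lowCut_isProfile (gegenP j l)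
  obtain ⟨C2, hC20, hC2⟩ := exists_bound_iteratedDeriv_mul k highCut_isProfile hbs
  have hL : Tendsto (fun N => ∫ p in strip,
      f p * (iteratedDeriv j (aN N) p.1 * iteratedDeriv k (bN N) p.2)) atTop
      (𝓝 (∫ p in strip, f p * (iteratedDeriv j (fun x => A.eval x) p.1 * iteratedDeriv k b p.2))) := by
    refine tendsto_integral_of_dominated_convergence (fun p => ∑ i ∈ Finset.range (k + 1),
      (C1 * C2) * (|f p| * |iteratedDeriv i b p.2|)) (fun N => ?_) ?_ (fun N => ?_) ?_
    · have h1 := (contDiff_iteratedDeriv (haN N) j).continuous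
      have h2 := (contDiff_iteratedDeriv (hbN N) k).continuous
      exact hfm.mul (Continuous.aestronglyMeasurable (by fun_prop))
    · refine integrable_finsetSum _ fun i _ => Integrable.const_mul ?_ _
      simp only [b, iteratedDeriv_hermiteP_mul_gaussDens]
      have h1 := (integrable_mul_poly hf0 1 (C ((-1) ^ i * √((m + i).descFactorial i : ℝ)) *
        hermiteP (m + i))).abs
      rw [weightedMeasure_zero, integrable_stripMeasure_iff] at h1
      refine h1.congr (ae_of_all _ fun p => ?_)
      simp only [eval_one, one_mul, eval_mul, eval_C, abs_mul, abs_of_pos (gaussDens_pos p.2)]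
      ring
    · filter_upwards [hstripvol] with p hp
      rw [Real.norm_eq_abs, abs_mul, abs_mul, ← Finset.mul_sum, ← Finset.mul_sum]
      have h1 := hC1 N p.1 hp.1
      have h2 := hC2 _ (hNinv N) p.2
      have h10 : 0 ≤ C1 := (abs_nonneg _).trans h1
      calc |f p| * (|iteratedDeriv j (aN N) p.1| * |iteratedDeriv k (bN N) p.2|)
          ≤ |f p| * (C1 * (C2 * ∑ i ∈ Finset.range (k + 1), |iteratedDeriv i b p.2|)) := by
            gcongr
        _ = _ := by ring
    · filter_upwards [hstripvol] with p hp
      refine tendsto_const_nhds.mul (Tendsto.mul ?_ ?_)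
      · refine tendsto_const_nhds.congr' ?_
        filter_upwards [hcut1 p.1 hp.1] with N hN
        exact (hN.iteratedDeriv_eq j).symm
      · refine tendsto_const_nhds.congr' ?_
        filter_upwards [hcut2 p.2] with N hN
        exact (hN.iteratedDeriv_eq k).symm
  have hR : Tendsto (fun N => ∫ p in strip, g p * (aN N p.1 * bN N p.2)) atTop
      (𝓝 (∫ p in strip, g p * (A.eval p.1 * b p.2))) := by
    have hint : IntegrableOn (fun p => g p * (A.eval p.1 * b p.2)) strip := by
      have h1 := integrable_mul_poly hg (gegenP j l) (hermiteP m)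
      rw [integrable_weightedMeasure_iff'] at h1
      refine h1.congr (ae_of_all _ fun p => ?_)
      simp only [A, b, eval_mul, eval_pow, eval_sub, eval_one, eval_X]
      ring
    refine tendsto_integral_of_dominated_convergence
      (fun p => |g p * (A.eval p.1 * b p.2)|) (fun N => ?_) hint.abs (fun N => ?_) ?_
    · have h1 := (haN N).continuous
      have h2 := (hbN N).continuous
      exact hgm.mul (Continuous.aestronglyMeasurable (by fun_prop))
    · refine ae_of_all _ fun p => ?_
      simp only [Real.norm_eq_abs, abs_mul, aN, bN]
      gcongr
      · exact mul_le_of_le_one_right (abs_nonneg _) (abs_lowCut_le _)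
      · exact mul_le_of_le_one_right (abs_nonneg _) (abs_highCut_le _)
    · filter_upwards [hstripvol] with p hp
      refine tendsto_const_nhds.mul (Tendsto.mul ?_ ?_)
      · refine tendsto_const_nhds.congr' ?_
        filter_upwards [hcut1 p.1 hp.1] with N hN
        exact hN.self_of_nhds.symm
      · refine tendsto_const_nhds.congr' ?_
        filter_upwards [hcut2 p.2] with N hN
        exact hN.self_of_nhds.symm
  simp_rw [hid] at hL
  have key := tendsto_nhds_unique hL (hR.const_mul _)
  have e1 : ∫ p in strip, g p * (A.eval p.1 * b p.2) = fourierCoeff j g (m, l) := by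
    rw [fourierCoeff, integral_weightedMeasure']
    congr 1
    ext p
    simp only [A, b, basisFn, eval_mul, eval_pow, eval_sub, eval_one, eval_X]
    ring
  have e2 : ∫ p in strip, f p * (iteratedDeriv j (fun x => A.eval x) p.1 * iteratedDeriv k b p.2)
      = (-1) ^ (j + k) * (√((m + k).descFactorial k : ℝ) *
      √((l + 2 * j).descFactorial (2 * j) : ℝ) * fourierCoeff 0 f (m + k, l + j)) := by
    rw [fourierCoeff, integral_weightedMeasure', ← integral_const_mul, ← integral_const_mul]
    congr 1
    ext p
    -- The ladder relations evaluate both derivatives, and their signs combine to the `(-1)^(j+k)`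
    -- of the weak derivative.
    have hA := iterate_derivative_weight_mul_gegenP j 0 l
    simp only [zero_add] at hA
    simp only [b, iteratedDeriv_hermiteP_mul_gaussDens, iteratedDeriv_eval, A, hA, basisFn]
    simp
    ring
  rw [e1, e2] at key
  have hne : ((-1 : ℝ)) ^ (j + k) ≠ 0 := pow_ne_zero _ (by norm_num)
  exact (mul_left_cancel₀ hne key).symm

/-! ### Weak derivatives and Fourier coefficients -/

lemma tsum_ofReal_ne_top_iff {ι : Type*} {h : ι → ℝ} (h0 : ∀ i, 0 ≤ h i) :
    ∑' i, ENNReal.ofReal (h i) ≠ ⊤ ↔ Summable h := by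
  constructor
  · intro H
    have := ENNReal.summable_toReal H
    simpa only [ENNReal.toReal_ofReal (h0 _)] using this
  · intro H
    rw [← ENNReal.ofReal_tsum_of_nonneg h0 H]
    exact ENNReal.ofReal_ne_top

lemma continuous_div_density {φ : ℝ × ℝ → ℝ} (hφ : Continuous φ) (hs : tsupport φ ⊆ strip) (j : ℕ) :
    Continuous fun p => φ p / ((1 - p.1 ^ 2) ^ j * gaussDens p.2) := by
  rw [continuous_iff_continuousAt]
  intro p
  by_cases hp : p ∈ tsupport φ
  · exact hφ.continuousAt.div (continuous_density j).continuousAt (density_pos j (hs hp)).ne'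
  · rw [notMem_tsupport_iff_eventuallyEq] at hp
    have : (fun p => φ p / ((1 - p.1 ^ 2) ^ j * gaussDens p.2)) =ᶠ[𝓝 p] fun _ => 0 := by
      filter_upwards [hp] with q hq
      simp [hq]
    exact continuousAt_const.congr this.symm

lemma memLp_div_density {φ : ℝ × ℝ → ℝ} (hφ : Continuous φ) (hc : HasCompactSupport φ)
    (hs : tsupport φ ⊆ strip) (j : ℕ) :
    MemLp (fun p => φ p / ((1 - p.1 ^ 2) ^ j * gaussDens p.2)) 2 (weightedMeasure j) :=
  (continuous_div_density hφ hs j).memLp_of_hasCompactSupport (by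
    simp_rw [div_eq_mul_inv]
    exact hc.mul_right)

/-- Dividing a test function by the density turns the Lebesgue pairing into an inner product of the
weighted space, where Parseval applies. -/
lemma integral_mul_div_density (j : ℕ) (f φ : ℝ × ℝ → ℝ) :
    ∫ p, f p * (φ p / ((1 - p.1 ^ 2) ^ j * gaussDens p.2)) ∂(weightedMeasure j)
      = ∫ p in strip, f p * φ p := by
  rw [integral_weightedMeasure']
  refine setIntegral_congr_fun measurableSet_strip fun p hp => ?_
  rw [mul_assoc, div_mul_cancel₀ _ (density_pos j hp).ne']

lemma fourierCoeff_div_density (j : ℕ) (φ : ℝ × ℝ → ℝ) (i : ℕ × ℕ) :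
    fourierCoeff j (fun p => φ p / ((1 - p.1 ^ 2) ^ j * gaussDens p.2)) i
      = ∫ p in strip, basisFn j i p * φ p := by
  rw [fourierCoeff, ← integral_mul_div_density j]
  simp_rw [mul_comm (basisFn j i _)]

/-- The index shift `(m, l) ↦ (m + k, l + j)`. -/
def shift (j k : ℕ) (i : ℕ × ℕ) : ℕ × ℕ := (i.1 + k, i.2 + j)

lemma shift_injective (j k : ℕ) : Function.Injective (shift j k) := by
  intro a b h
  simp only [shift, Prod.mk.injEq] at h
  ext <;> omega

lemma mem_range_shift {j k : ℕ} {i : ℕ × ℕ} : i ∈ range (shift j k) ↔ k ≤ i.1 ∧ j ≤ i.2 := by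
  constructor
  · rintro ⟨a, rfl⟩
    simp [shift]
  · intro h
    exact ⟨(i.1 - k, i.2 - j), by ext <;> simp [shift] <;> omega⟩

/-- The square of the norm of `∂_t^k ∂_x^j (H_m P_l)` in `L²((1-x²)^j dx ⊗ dν)`. -/
def derivWeight (j k : ℕ) (i : ℕ × ℕ) : ℝ :=
  (i.1.descFactorial k : ℝ) * ((i.2 + j).descFactorial (2 * j) : ℝ)

lemma derivWeight_nonneg (j k : ℕ) (i : ℕ × ℕ) : 0 ≤ derivWeight j k i := by
  unfold derivWeight; positivity

lemma derivWeight_eq_zero {j k : ℕ} {i : ℕ × ℕ} (h : i ∉ range (shift j k)) :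
    derivWeight j k i = 0 := by
  rw [mem_range_shift, not_and_or, not_le, not_le] at h
  rcases h with h | h
  · rw [derivWeight, Nat.descFactorial_of_lt h]; simp
  · rw [derivWeight, Nat.descFactorial_of_lt (by omega : i.2 + j < 2 * j)]; simp

lemma sqrt_derivWeight_shift (j k : ℕ) (i : ℕ × ℕ) :
    √(derivWeight j k (shift j k i)) = √((i.1 + k).descFactorial k : ℝ) *
      √((i.2 + 2 * j).descFactorial (2 * j) : ℝ) := by
  rw [derivWeight, Real.sqrt_mul (by positivity)]
  simp only [shift]
  rw [show i.2 + j + j = i.2 + 2 * j by ring]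

lemma setIntegral_basisFn_mul_mixedDeriv {φ : ℝ × ℝ → ℝ} (hφ : ContDiff ℝ ∞ φ)
    (hc : HasCompactSupport φ) (hs : tsupport φ ⊆ strip) (j k : ℕ) (i : ℕ × ℕ) :
    ∫ p in strip, basisFn 0 i p * mixedDeriv j k φ p
      = (-1) ^ (j + k) * ∫ p in strip, ((derivative^[j] (legendreP i.2)).eval p.1 *
        (derivative^[k] (hermiteP i.1)).eval p.2) * φ p := by
  rw [setIntegral_strip_mul ((mixedDeriv_smooth j k hφ).2.trans hs),
    setIntegral_strip_mul hs (fun p => (derivative^[j] (legendreP i.2)).eval p.1 *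
        (derivative^[k] (hermiteP i.1)).eval p.2)]
  have h := integral_mul_mixedDeriv (contDiff_eval (legendreP i.2)) (contDiff_eval (hermiteP i.1))
    hφ hc j k
  simp only [iteratedDeriv_eval] at h
  simpa only [basisFn, gegenP_zero] using h

/-- If the formal coefficients of a derivative are square summable, the weak derivative exists. -/
theorem exists_hasWeakDeriv {j k : ℕ} {f : ℝ × ℝ → ℝ} (hf : MemLp f 2 stripMeasure)
    (h : Summable fun i => fourierCoeff 0 f i ^ 2 * derivWeight j k i) :
    ∃ g, HasWeakDeriv j k f g ∧ MemLp g 2 (weightedMeasure j) := by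
  have h' : Summable fun i => (√(derivWeight j k (shift j k i)) *
      fourierCoeff 0 f (shift j k i)) ^ 2 := by
    refine (h.comp_injective (shift_injective j k)).congr fun i => ?_
    simp only [Function.comp, mul_pow, Real.sq_sqrt (derivWeight_nonneg _ _ _)]
    ring
  obtain ⟨g, hg, hgc⟩ := riesz_fischer j h'
  refine ⟨g, ⟨locallyIntegrableOn_of_memLp hg, fun φ hφ hc hs => ?_⟩, hg⟩
  change ∫ p in strip, f p * mixedDeriv j k φ p = _
  have hD := mixedDeriv_smooth j k hφ
  have hDs := hD.2.trans hs
  have hDc := hasCompactSupport_of_subset hc hD.2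
  have hf0 : MemLp f 2 (weightedMeasure 0) := by rwa [weightedMeasure_zero]
  -- The two sides of the weak identity are expanded in different bases, one for each weight, and
  -- compared term by term after shifting the index.
  have h1 := parseval hf0 (memLp_div_density hD.1.continuous hDc hDs 0)
  have h2 := parseval hg (memLp_div_density hφ.continuous hc hs j)
  rw [integral_mul_div_density] at h1 h2
  simp only [fourierCoeff_div_density, hgc] at h1 h2
  rw [← (shift_injective j k).hasSum_iff] at h1
  · refine h1.unique ?_
    convert! h2.mul_left ((-1) ^ (j + k)) using 1
    ext i
    simp only [Function.comp, setIntegral_basisFn_mul_mixedDeriv hφ hc hs]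
    rw [sqrt_derivWeight_shift]
    simp only [shift, iterate_derivative_legendreP_add, iterate_derivative_hermiteP_add, eval_mul,
      eval_C]
    have e : ∀ p : ℝ × ℝ, √((i.2 + 2 * j).descFactorial (2 * j) : ℝ) * eval p.1 (gegenP j i.2) *
        (√((i.1 + k).descFactorial k : ℝ) * eval p.2 (hermiteP i.1)) * φ p
        = (√((i.1 + k).descFactorial k : ℝ) * √((i.2 + 2 * j).descFactorial (2 * j) : ℝ)) *
          (basisFn j i p * φ p) := by
      intro p; rw [basisFn]; ring
    simp_rw [e, integral_const_mul]
    ring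
  -- Outside the range of the shift the basis function is annihilated by the derivative.
  · intro i hi
    rw [setIntegral_basisFn_mul_mixedDeriv hφ hc hs]
    rw [mem_range_shift, not_and_or, not_le, not_le] at hi
    rcases hi with hi | hi
    · simp [iterate_derivative_hermiteP_of_lt hi]
    · simp [iterate_derivative_legendreP_of_lt hi]

/-- The weighted norm of a weak derivative in terms of Fourier coefficients. -/
theorem HasWeakDeriv.hasSum {j k : ℕ} {f g : ℝ × ℝ → ℝ} (h : HasWeakDeriv j k f g)
    (hf : MemLp f 2 stripMeasure) (hg : MemLp g 2 (weightedMeasure j)) :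
    HasSum (fun i => fourierCoeff 0 f i ^ 2 * derivWeight j k i)
      (∫ p, g p ^ 2 * (1 - p.1 ^ 2) ^ j ∂stripMeasure) := by
  have h1 := parseval hg hg
  rw [integral_weightedMeasure] at h1
  rw [← (shift_injective j k).hasSum_iff fun i hi => by rw [derivWeight_eq_zero hi, mul_zero]]
  simp_rw [pow_two (g _)]
  convert! h1 using 1
  ext i
  obtain ⟨m, l⟩ := i
  rw [h.fourierCoeff_eq hf hg]
  simp only [Function.comp]
  rw [← sqrt_derivWeight_shift j k (m, l)]
  have := Real.mul_self_sqrt (derivWeight_nonneg j k (shift j k (m, l)))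
  rw [show (m + k, l + j) = shift j k (m, l) from rfl]
  linear_combination (-fourierCoeff 0 f (shift j k (m, l)) ^ 2) * this

lemma memLp_weightedMeasure_iff {j : ℕ} {g : ℝ × ℝ → ℝ} (hg : LocallyIntegrableOn g strip) :
    MemLp g 2 (weightedMeasure j)
      ↔ Integrable (fun p => g p ^ 2 * (1 - p.1 ^ 2) ^ j) stripMeasure := by
  have hgm : AEStronglyMeasurable g (weightedMeasure j) :=
    hg.aestronglyMeasurable.mono_ac
      ((withDensity_absolutelyContinuous _ _).trans stripMeasure_absolutelyContinuous)
  rw [memLp_two_iff_integrable_sq hgm, integrable_weightedMeasure_iff]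

lemma aestronglyMeasurable_sq_mul {j : ℕ} {g : ℝ × ℝ → ℝ} (hg : LocallyIntegrableOn g strip) :
    AEStronglyMeasurable (fun p => g p ^ 2 * (1 - p.1 ^ 2) ^ j) stripMeasure := by
  have hgm : AEStronglyMeasurable g stripMeasure :=
    hg.aestronglyMeasurable.mono_ac stripMeasure_absolutelyContinuous
  exact (hgm.pow 2).mul (by fun_prop)

lemma ae_sq_mul_nonneg (j : ℕ) (g : ℝ × ℝ → ℝ) :
    0 ≤ᵐ[stripMeasure] fun p => g p ^ 2 * (1 - p.1 ^ 2) ^ j := by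
  filter_upwards [ae_mem_strip] with p hp
  have := one_sub_sq_pos hp
  simp only [Pi.zero_apply]
  positivity

lemma HasWeakDeriv.memLp_iff_lintegral {j k : ℕ} {f g : ℝ × ℝ → ℝ} (h : HasWeakDeriv j k f g) :
    MemLp g 2 (weightedMeasure j)
      ↔ ∫⁻ p, ENNReal.ofReal (g p ^ 2 * (1 - p.1 ^ 2) ^ j) ∂stripMeasure ≠ ⊤ := by
  rw [memLp_weightedMeasure_iff h.1,
    ← lintegral_ofReal_ne_top_iff_integrable (aestronglyMeasurable_sq_mul h.1)
      (ae_sq_mul_nonneg j g)]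

theorem HasWeakDeriv.lintegral_eq {j k : ℕ} {f g : ℝ × ℝ → ℝ} (h : HasWeakDeriv j k f g)
    (hf : MemLp f 2 stripMeasure) (hg : MemLp g 2 (weightedMeasure j)) :
    ∫⁻ p, ENNReal.ofReal (g p ^ 2 * (1 - p.1 ^ 2) ^ j) ∂stripMeasure
      = ∑' i, ENNReal.ofReal (fourierCoeff 0 f i ^ 2 * derivWeight j k i) := by
  have h1 := h.hasSum hf hg
  rw [← ofReal_integral_eq_lintegral_ofReal ((memLp_weightedMeasure_iff h.1).1 hg)
    (ae_sq_mul_nonneg j g), ← h1.tsum_eq, ENNReal.ofReal_tsum_of_nonneg _ h1.summable]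
  exact fun i => mul_nonneg (sq_nonneg _) (derivWeight_nonneg _ _ _)

/-- Every weak derivative with finite weighted integral yields exactly this sum, and one exists when
the sum is finite. Uniqueness of weak derivatives is therefore not needed to evaluate the infimum.
-/
theorem seminormSq_eq (j k : ℕ) (f : L2) :
    seminormSq j k f = ∑' i, ENNReal.ofReal (fourierCoeff 0 f i ^ 2 * derivWeight j k i) := by
  have hf : MemLp f 2 stripMeasure := Lp.memLp f
  apply le_antisymm
  · by_cases ht : ∑' i, ENNReal.ofReal (fourierCoeff 0 f i ^ 2 * derivWeight j k i) = ⊤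
    · rw [ht]; exact le_top
    · obtain ⟨g, hg, hgm⟩ := exists_hasWeakDeriv hf ((tsum_ofReal_ne_top_iff fun i =>
        mul_nonneg (sq_nonneg _) (derivWeight_nonneg j k i)).1 ht)
      rw [← hg.lintegral_eq hf hgm]
      exact iInf₂_le g hg
  · refine le_iInf₂ fun g hg => ?_
    by_cases ht : ∫⁻ p, ENNReal.ofReal (g p ^ 2 * (1 - p.1 ^ 2) ^ j) ∂stripMeasure = ⊤
    · rw [ht]; exact le_top
    · rw [hg.lintegral_eq hf (hg.memLp_iff_lintegral.2 ht)]

/-- The square of the norm of `H_m P_l` in `W^{n,n}`. -/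
def sobolevWeight (n : ℕ) (i : ℕ × ℕ) : ℝ :=
  ∑ j ∈ Finset.range (n + 1), ∑ k ∈ Finset.range (n + 1), derivWeight j k i

lemma sobolevWeight_nonneg (n : ℕ) (i : ℕ × ℕ) : 0 ≤ sobolevWeight n i :=
  Finset.sum_nonneg fun _ _ => Finset.sum_nonneg fun _ _ => derivWeight_nonneg _ _ _

theorem sobolevNormSq_eq (n : ℕ) (f : L2) :
    sobolevNormSq n n f = ∑' i, ENNReal.ofReal (fourierCoeff 0 f i ^ 2 * sobolevWeight n i) := by
  have h0 : ∀ i j k, 0 ≤ fourierCoeff 0 f i ^ 2 * derivWeight j k i := fun i j k =>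
    mul_nonneg (sq_nonneg _) (derivWeight_nonneg _ _ _)
  simp only [sobolevNormSq, seminormSq_eq]
  simp_rw [← Summable.tsum_finsetSum fun _ _ => ENNReal.summable]
  congr 1
  ext i
  simp_rw [sobolevWeight, Finset.mul_sum]
  rw [ENNReal.ofReal_sum_of_nonneg fun j _ => Finset.sum_nonneg fun k _ => h0 i j k]
  refine Finset.sum_congr rfl fun j _ => ?_
  rw [ENNReal.ofReal_sum_of_nonneg fun k _ => h0 i j k]

/-! ### The spaces `W^{n,n}` -/

lemma memLp_coe (f : L2) : MemLp f 2 (weightedMeasure 0) := by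
  rw [weightedMeasure_zero]; exact Lp.memLp f

lemma fourierCoeff_congr {f g : ℝ × ℝ → ℝ} (h : f =ᵐ[stripMeasure] g) (i : ℕ × ℕ) :
    fourierCoeff 0 f i = fourierCoeff 0 g i := by
  rw [fourierCoeff, fourierCoeff, weightedMeasure_zero]
  refine integral_congr_ae ?_
  filter_upwards [h] with p hp
  rw [hp]

/-- The Fourier coefficient as a linear functional on `L²`. -/
def fourierLM (i : ℕ × ℕ) : L2 →ₗ[ℝ] ℝ where
  toFun f := fourierCoeff 0 f i
  map_add' f g := by
    have hi : ∀ f : L2, Integrable (fun p => f p * basisFn 0 i p) (weightedMeasure 0) :=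
      fun f => integrable_mul_poly (memLp_coe f) _ _
    rw [fourierCoeff_congr (Lp.coeFn_add f g), fourierCoeff, fourierCoeff, fourierCoeff,
      ← integral_add (hi f) (hi g)]
    simp [add_mul]
  map_smul' c f := by
    rw [fourierCoeff_congr (Lp.coeFn_smul c f), fourierCoeff, fourierCoeff, RingHom.id_apply,
      smul_eq_mul, ← integral_const_mul]
    simp [mul_assoc]

/-- The basis function `H_m P_l` as an element of `L²`. -/
def basisL (i : ℕ × ℕ) : L2 := (memLp_poly_strip (gegenP 0 i.2) (hermiteP i.1)).toLp (basisFn 0 i)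

lemma basisL_ae (i : ℕ × ℕ) : basisL i =ᵐ[stripMeasure] basisFn 0 i := MemLp.coeFn_toLp _

lemma fourierLM_basisL (i i' : ℕ × ℕ) : fourierLM i' (basisL i) = if i = i' then 1 else 0 := by
  change fourierCoeff 0 (basisL i) i' = _
  rw [fourierCoeff_congr (basisL_ae i), fourierCoeff_basisFn]

lemma sobolevNormSq_eq' (n : ℕ) (f : L2) :
    sobolevNormSq n n f = ∑' i, ENNReal.ofReal (fourierLM i f ^ 2 * sobolevWeight n i) :=
  sobolevNormSq_eq n f

lemma ofReal_sq_add_mul_le {a b w : ℝ} (hw : 0 ≤ w) :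
    ENNReal.ofReal ((a + b) ^ 2 * w)
      ≤ 2 * ENNReal.ofReal (a ^ 2 * w) + 2 * ENNReal.ofReal (b ^ 2 * w) := by
  have h2 : (2 : ℝ≥0∞) = ENNReal.ofReal 2 := by simp
  rw [h2, ← ENNReal.ofReal_mul (by norm_num), ← ENNReal.ofReal_mul (by norm_num),
    ← ENNReal.ofReal_add (by positivity) (by positivity)]
  refine ENNReal.ofReal_le_ofReal ?_
  nlinarith [mul_nonneg (sq_nonneg (a - b)) hw]

/-- This quasi-triangle inequality for the squared norm suffices for the density arguments. -/
lemma sobolevNormSq_add_le (n : ℕ) (f g : L2) :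
    sobolevNormSq n n (f + g) ≤ 2 * sobolevNormSq n n f + 2 * sobolevNormSq n n g := by
  simp only [sobolevNormSq_eq', ← ENNReal.tsum_mul_left, map_add]
  rw [← ENNReal.tsum_add]
  exact ENNReal.tsum_le_tsum fun i => ofReal_sq_add_mul_le (sobolevWeight_nonneg n i)

lemma sobolevNormSq_smul (n : ℕ) (c : ℝ) (f : L2) :
    sobolevNormSq n n (c • f) = ENNReal.ofReal (c ^ 2) * sobolevNormSq n n f := by
  simp only [sobolevNormSq_eq', ← ENNReal.tsum_mul_left, map_smul, smul_eq_mul]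
  congr 1
  ext i
  rw [← ENNReal.ofReal_mul (sq_nonneg c), mul_pow, mul_assoc]

/-! ### Approximation by tensor products of Sobolev functions. -/

lemma HasWeakDeriv.congr_ae {j k : ℕ} {f f' g : ℝ × ℝ → ℝ} (h : HasWeakDeriv j k f g)
    (hf : f =ᵐ[stripMeasure] f') : HasWeakDeriv j k f' g := by
  refine ⟨h.1, fun φ hφ hc hs => ?_⟩
  rw [← h.2 φ hφ hc hs]
  refine integral_congr_ae ?_
  filter_upwards [absolutelyContinuous_stripMeasure.ae_le hf] with p hp
  rw [hp]

/-- Membership in the closure of the tensor product. -/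
def IsApprox (n : ℕ) (f : L2) : Prop :=
  ∀ ε : ℝ≥0∞, 0 < ε → ∃ u ∈ tensorSobolev n n, sobolevNormSq n n (f - u) < ε

lemma exists_quarter {ε : ℝ≥0∞} (hε : 0 < ε) :
    ∃ δ : ℝ≥0∞, 0 < δ ∧ ∀ a b : ℝ≥0∞, a < δ → b < δ → 2 * a + 2 * b < ε := by
  refine ⟨ε / 4, ENNReal.div_pos hε.ne' (by simp), fun a b ha hb => ?_⟩
  have h1 : max a b < ε / 4 := max_lt ha hb
  have h2 : 4 * max a b < ε := by
    rw [mul_comm]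
    exact ENNReal.mul_lt_of_lt_div h1
  refine lt_of_le_of_lt ?_ h2
  calc 2 * a + 2 * b ≤ 2 * max a b + 2 * max a b := by
        gcongr
        · exact le_max_left _ _
        · exact le_max_right _ _
    _ = 4 * max a b := by rw [← add_mul]; norm_num

lemma IsApprox.add {n : ℕ} {f g : L2} (hf : IsApprox n f) (hg : IsApprox n g) :
    IsApprox n (f + g) := by
  intro ε hε
  obtain ⟨δ, hδ, h⟩ := exists_quarter hε
  obtain ⟨u, hu, hu'⟩ := hf δ hδ
  obtain ⟨v, hv, hv'⟩ := hg δ hδ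
  refine ⟨u + v, Submodule.add_mem _ hu hv, ?_⟩
  rw [add_sub_add_comm]
  exact (sobolevNormSq_add_le n _ _).trans_lt (h _ _ hu' hv')

lemma IsApprox.smul {n : ℕ} {f : L2} (hf : IsApprox n f) (c : ℝ) : IsApprox n (c • f) := by
  intro ε hε
  -- For `c = 0` the quotient is `⊤`, and the argument still applies.
  obtain ⟨u, hu, hu'⟩ := hf (ε / ENNReal.ofReal (c ^ 2))
    (ENNReal.div_pos hε.ne' ENNReal.ofReal_ne_top)
  refine ⟨c • u, Submodule.smul_mem _ c hu, ?_⟩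
  rw [← smul_sub, sobolevNormSq_smul, mul_comm]
  exact ENNReal.mul_lt_of_lt_div hu'

lemma isApprox_of_mem {n : ℕ} {f : L2} (hf : f ∈ tensorSobolev n n) : IsApprox n f := by
  intro ε hε
  refine ⟨f, hf, ?_⟩
  rw [sub_self, sobolevNormSq_eq']
  simpa using hε

lemma isApprox_sum {n : ℕ} {ι : Type*} (s : Finset ι) {f : ι → L2} (hf : ∀ i ∈ s, IsApprox n (f i)) :
    IsApprox n (∑ i ∈ s, f i) := by
  classical
  induction s using Finset.induction_on with
  | empty => simpa using isApprox_of_mem (Submodule.zero_mem (tensorSobolev n n))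
  | insert a s ha ih =>
    rw [Finset.sum_insert ha]
    exact (hf a (Finset.mem_insert_self _ _)).add
      (ih fun i hi => hf i (Finset.mem_insert_of_mem hi))

lemma memSobolev_eval (n : ℕ) (p : ℝ[X]) : MemSobolev (Ioo (-1) 1) n fun x => p.eval x := by
  refine memSobolev_of_contDiff (contDiff_eval p) fun i => ?_
  rw [iteratedDeriv_eval, memLp_two_iff_integrable_sq]
  · refine (integrableOn_poly ((derivative^[i] p) ^ 2)).congr (ae_of_all _ fun x => ?_)
    simp
  · exact (Polynomial.continuous _).aestronglyMeasurable

lemma hasCompactSupport_iteratedDeriv {f : ℝ → ℝ} (hf : HasCompactSupport f) (n : ℕ) :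
    HasCompactSupport (iteratedDeriv n f) := by
  induction n with
  | zero => simpa using hf
  | succ n ih => rw [iteratedDeriv_succ]; exact ih.deriv

lemma memSobolev_of_compactSupport (n : ℕ) {h : ℝ → ℝ} (hs : ContDiff ℝ ∞ h)
    (hc : HasCompactSupport h) : MemSobolev univ n h := by
  refine memSobolev_of_contDiff hs fun i => ?_
  exact (contDiff_iteratedDeriv hs i).continuous.memLp_of_hasCompactSupport
    (hasCompactSupport_iteratedDeriv hc i)

lemma one_sub_highCut_isProfile : IsProfile fun u => 1 - highCut u := by
  refine ⟨contDiff_const.sub highCut_smooth, ⟨2, fun u => ?_⟩, ?_⟩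
  · have := abs_le.1 (abs_highCut_le u)
    exact abs_le.2 ⟨by linarith [this.2], by linarith [this.1]⟩
  · have : deriv (fun u => 1 - highCut u) = fun u => -deriv highCut u := by
      ext u; simp
    rw [this]
    exact highCut_isProfile.deriv_compact.neg

/-- Cutting off in `t` converges in the weighted norms. -/
lemma tendsto_lintegral_cutoff (j k : ℕ) (p q : ℝ[X]) :
    Tendsto (fun N : ℕ => ∫⁻ z, ENNReal.ofReal ((iteratedDeriv j (fun x => p.eval x) z.1 *
      iteratedDeriv k (fun t => q.eval t * (1 - highCut (((N : ℝ) + 1)⁻¹ * t))) z.2) ^ 2 *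
        (1 - z.1 ^ 2) ^ j) ∂stripMeasure) atTop (𝓝 0) := by
  obtain ⟨C, hC0, hC⟩ := exists_bound_iteratedDeriv_mul k one_sub_highCut_isProfile (contDiff_eval q)
  have hNinv : ∀ N : ℕ, ((N : ℝ) + 1)⁻¹ ∈ Icc (0 : ℝ) 1 := fun N =>
    ⟨by positivity, inv_le_one_of_one_le₀ (by linarith [(Nat.cast_nonneg N : (0 : ℝ) ≤ N)])⟩
  have hbound : Integrable (fun z : ℝ × ℝ => ∑ i ∈ Finset.range (k + 1), (C ^ 2 * (k + 1)) *
      (((derivative^[j] p) ^ 2).eval z.1 * ((derivative^[i] q) ^ 2).eval z.2)) stripMeasure :=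
    integrable_finsetSum _ fun i _ => (integrable_poly_strip _ _).const_mul _
  have hz : (∫⁻ _ : ℝ × ℝ, (0 : ℝ≥0∞) ∂stripMeasure) = 0 := by simp
  rw [← hz]
  refine tendsto_lintegral_of_dominated_convergence (fun z => ENNReal.ofReal
    (∑ i ∈ Finset.range (k + 1), (C ^ 2 * (k + 1)) *
      (((derivative^[j] p) ^ 2).eval z.1 * ((derivative^[i] q) ^ 2).eval z.2))) (fun N => ?_)
    (fun N => ?_) hbound.lintegral_lt_top.ne ?_
  · have h1 := (contDiff_iteratedDeriv (contDiff_eval p) j).continuous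
    have hs : ContDiff ℝ ∞ fun t => q.eval t * (1 - highCut (((N : ℝ) + 1)⁻¹ * t)) :=
      (contDiff_eval q).mul (contDiff_const.sub
        (highCut_smooth.comp (contDiff_const.mul contDiff_id)))
    have h2 := (contDiff_iteratedDeriv hs k).continuous
    exact (Continuous.measurable (by fun_prop)).ennreal_ofReal
  · filter_upwards [ae_mem_strip] with z hz
    refine ENNReal.ofReal_le_ofReal ?_
    have hw := one_sub_sq_pos hz
    refine (mul_le_of_le_one_right (sq_nonneg _)
      (pow_le_one₀ hw.le (one_sub_sq_le_one z))).trans ?_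
    have hD := hC _ (hNinv N) z.2
    have h1 : iteratedDeriv k (fun t => q.eval t * (1 - highCut (((N : ℝ) + 1)⁻¹ * t))) z.2 ^ 2
        ≤ C ^ 2 * ((k + 1) * ∑ i ∈ Finset.range (k + 1), ((derivative^[i] q).eval z.2) ^ 2) := by
      rw [← sq_abs]
      refine (pow_le_pow_left₀ (abs_nonneg _) hD 2).trans ?_
      rw [mul_pow]
      refine mul_le_mul_of_nonneg_left ?_ (sq_nonneg C)
      -- Cauchy–Schwarz over `k + 1` summands accounts for the constant in the majorant.
      have := sq_sum_le_card_mul_sum_sq (s := Finset.range (k + 1))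
        (f := fun i => |iteratedDeriv i (fun t => q.eval t) z.2|)
      simpa [iteratedDeriv_eval] using this
    rw [mul_pow, iteratedDeriv_eval, ← Finset.mul_sum]
    simp only [eval_pow, ← Finset.mul_sum]
    refine (mul_le_mul_of_nonneg_left h1 (sq_nonneg _)).trans (le_of_eq ?_)
    ring
  · refine ae_of_all _ fun z => tendsto_const_nhds.congr' ?_
    have ht : Tendsto (fun N : ℕ => (N : ℝ)) atTop atTop := tendsto_natCast_atTop_atTop
    filter_upwards [ht.eventually_gt_atTop |z.2|] with N hN
    have : (fun t => q.eval t * (1 - highCut (((N : ℝ) + 1)⁻¹ * t))) =ᶠ[𝓝 z.2] fun _ => 0 := by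
      filter_upwards [continuous_abs.continuousAt.eventually (gt_mem_nhds hN)] with s hs
      rw [highCut_eq_one, sub_self, mul_zero]
      rw [abs_mul, abs_of_nonneg (hNinv N).1, inv_mul_le_one₀ (by positivity)]
      linarith
    rw [this.iteratedDeriv_eq k]
    simp

/-- A Hermite polynomial is not in `H^n(ℝ)` with Lebesgue measure, so it is cut off in `t`; the
Gaussian makes the error tend to zero. The Legendre factor is admissible as it stands. -/
lemma isApprox_basisL (n : ℕ) (i : ℕ × ℕ) : IsApprox n (basisL i) := by
  intro ε hε
  set p := gegenP 0 i.2
  set q := hermiteP i.1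
  set b : ℕ → ℝ → ℝ := fun N t => q.eval t * highCut (((N : ℝ) + 1)⁻¹ * t)
  have hbs : ∀ N, ContDiff ℝ ∞ (b N) := fun N =>
    (contDiff_eval q).mul (highCut_smooth.comp (contDiff_const.mul contDiff_id))
  have hbc : ∀ N, HasCompactSupport (b N) := fun N => by
    have hN : ((N : ℝ) + 1)⁻¹ ≠ 0 := by positivity
    exact (highCut_compact.comp_homeomorph (Homeomorph.mulLeft₀ _ hN)).mul_left
  have hmem : ∀ N, MemLp (fun z : ℝ × ℝ => p.eval z.1 * b N z.2) 2 stripMeasure := by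
    intro N
    refine (memLp_poly_strip p q).mono ?_ (ae_of_all _ fun z => ?_)
    · have h1 := p.continuous
      have h2 := (hbs N).continuous
      exact Continuous.aestronglyMeasurable (by fun_prop)
    · simp only [Real.norm_eq_abs, abs_mul, b]
      gcongr
      exact mul_le_of_le_one_right (abs_nonneg _) (abs_highCut_le _)
  have hsub : ∀ N, (basisL i - (hmem N).toLp _ : L2) =ᵐ[stripMeasure]
      fun z => p.eval z.1 * (q.eval z.2 * (1 - highCut (((N : ℝ) + 1)⁻¹ * z.2))) := by
    intro N
    filter_upwards [Lp.coeFn_sub (basisL i) ((hmem N).toLp _), basisL_ae i, (hmem N).coeFn_toLp]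
      with z h1 h2 h3
    rw [h1, Pi.sub_apply, h2, h3]
    simp only [basisFn, b, p, q]
    ring
  have hle : ∀ N, sobolevNormSq n n (basisL i - (hmem N).toLp _)
      ≤ ∑ j ∈ Finset.range (n + 1), ∑ k ∈ Finset.range (n + 1),
        ∫⁻ z, ENNReal.ofReal ((iteratedDeriv j (fun x => p.eval x) z.1 *
          iteratedDeriv k (fun t => q.eval t * (1 - highCut (((N : ℝ) + 1)⁻¹ * t))) z.2) ^ 2 *
          (1 - z.1 ^ 2) ^ j) ∂stripMeasure := by
    intro N
    refine Finset.sum_le_sum fun j _ => Finset.sum_le_sum fun k _ => ?_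
    refine iInf₂_le (fun z : ℝ × ℝ => iteratedDeriv j (fun x => p.eval x) z.1 *
      iteratedDeriv k (fun t => q.eval t * (1 - highCut (((N : ℝ) + 1)⁻¹ * t))) z.2) ?_
    refine HasWeakDeriv.congr_ae ?_ (hsub N).symm
    exact hasWeakDeriv_mul (contDiff_eval p) ((contDiff_eval q).mul (contDiff_const.sub
        (highCut_smooth.comp (contDiff_const.mul contDiff_id)))) j k
  have hlim := tendsto_finsetSum (Finset.range (n + 1)) fun j _ =>
    tendsto_finsetSum (Finset.range (n + 1)) fun k _ => tendsto_lintegral_cutoff j k p q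
  simp only [Finset.sum_const_zero] at hlim
  obtain ⟨N, hN⟩ := (hlim.eventually (gt_mem_nhds hε)).exists
  refine ⟨(hmem N).toLp _, Submodule.subset_span ⟨fun x => p.eval x, b N, memSobolev_eval n p,
    memSobolev_of_compactSupport n (hbs N) (hbc N), (hmem N).coeFn_toLp⟩, (hle N).trans_lt hN⟩

/-- The squared norm is a sum over coefficients, so truncating the expansion leaves the tail of a
convergent series, and finite combinations of basis functions are already approximable. -/
theorem mem_sobolevSpace_iff (n : ℕ) (f : L2) :
    f ∈ sobolevSpace n n ↔ sobolevNormSq n n f < ⊤ := by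
  refine ⟨fun h => h.1, fun h => ⟨h, fun ε hε => ?_⟩⟩
  obtain ⟨δ, hδ, hsum⟩ := exists_quarter hε
  have hlim := ENNReal.tendsto_tsum_compl_atTop_zero
    (f := fun i => ENNReal.ofReal (fourierLM i f ^ 2 * sobolevWeight n i))
    (by rw [← sobolevNormSq_eq']; exact h.ne)
  obtain ⟨s, hs⟩ := (hlim.eventually (gt_mem_nhds hδ)).exists
  set g : L2 := ∑ i ∈ s, fourierLM i f • basisL i
  have hg : IsApprox n g := isApprox_sum s fun i _ => (isApprox_basisL n i).smul _
  have hgc : ∀ i, fourierLM i g = if i ∈ s then fourierLM i f else 0 := by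
    intro i
    simp [g, fourierLM_basisL]
  have hfg : sobolevNormSq n n (f - g) < δ := by
    refine lt_of_le_of_lt (le_of_eq ?_) hs
    rw [sobolevNormSq_eq']
    refine Eq.trans ?_ (tsum_subtype {i | i ∉ s}
      (fun i => ENNReal.ofReal (fourierLM i f ^ 2 * sobolevWeight n i))).symm
    congr 1
    ext i
    rw [map_sub, hgc]
    by_cases hi : i ∈ s <;> simp [hi]
  obtain ⟨u, hu, hgu⟩ := hg δ hδ
  refine ⟨u, hu, ?_⟩
  have : f - u = (f - g) + (g - u) := by abel
  rw [this]
  exact (sobolevNormSq_add_le n _ _).trans_lt (hsum _ _ hfg hgu)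

/-! ### Comparison of weights -/

lemma pow_le_mul_descFactorial {n m : ℕ} (h : n ≤ m) :
    m ^ n ≤ (n + 1) ^ n * m.descFactorial n := by
  -- Each of the `n` factors of the descending factorial is at least `m + 1 - n`.
  have h1 : m ≤ (n + 1) * (m + 1 - n) := by
    obtain ⟨d, rfl⟩ := Nat.exists_eq_add_of_le h
    rw [show n + d + 1 - n = d + 1 by omega]
    nlinarith
  calc m ^ n ≤ ((n + 1) * (m + 1 - n)) ^ n := Nat.pow_le_pow_left h1 n
    _ = (n + 1) ^ n * (m + 1 - n) ^ n := mul_pow _ _ _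
    _ ≤ _ := Nat.mul_le_mul_left _ (Nat.pow_sub_le_descFactorial m n)

lemma pow_le_mul_descFactorial_add {n l : ℕ} (h : n ≤ l) :
    l ^ (2 * n) ≤ (n + 1) ^ (2 * n) * (l + n).descFactorial (2 * n) := by
  have h1 : l ≤ (n + 1) * (l + n + 1 - 2 * n) := by
    obtain ⟨d, rfl⟩ := Nat.exists_eq_add_of_le h
    rw [show n + d + n + 1 - 2 * n = d + 1 by omega]
    nlinarith
  calc l ^ (2 * n) ≤ ((n + 1) * (l + n + 1 - 2 * n)) ^ (2 * n) := Nat.pow_le_pow_left h1 _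
    _ = (n + 1) ^ (2 * n) * (l + n + 1 - 2 * n) ^ (2 * n) := mul_pow _ _ _
    _ ≤ _ := Nat.mul_le_mul_left _ (Nat.pow_sub_le_descFactorial _ _)

/-- For `m < n` the derivative of order `n` vanishes, and the undifferentiated term `k = 0` takes
over since `m` is bounded. -/
lemma exists_pow_le_descFactorial (n m : ℕ) :
    ∃ k ≤ n, max m 1 ^ n ≤ (n + 1) ^ n * m.descFactorial k := by
  rcases Nat.eq_zero_or_pos n with rfl | hn
  · exact ⟨0, le_rfl, by simp⟩
  · rcases le_or_gt n m with h | h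
    · exact ⟨n, le_rfl, by rw [max_eq_left (by omega)]; exact pow_le_mul_descFactorial h⟩
    · exact ⟨0, by omega, by simpa using Nat.pow_le_pow_left (by omega) n⟩

lemma exists_pow_le_descFactorial_add (n l : ℕ) :
    ∃ j ≤ n, max l 1 ^ (2 * n) ≤ (n + 1) ^ (2 * n) * (l + j).descFactorial (2 * j) := by
  rcases Nat.eq_zero_or_pos n with rfl | hn
  · exact ⟨0, le_rfl, by simp⟩
  · rcases le_or_gt n l with h | h
    · exact ⟨n, le_rfl, by rw [max_eq_left (by omega)]; exact pow_le_mul_descFactorial_add h⟩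
    · exact ⟨0, by omega, by simpa using Nat.pow_le_pow_left (by omega) (2 * n)⟩

lemma derivWeight_le {n j k : ℕ} (hj : j ≤ n) (hk : k ≤ n) (i : ℕ × ℕ) :
    derivWeight j k i ≤ ((n + 1 : ℕ) : ℝ) ^ (2 * n) *
      ((max i.1 1 : ℕ) ^ n * (max i.2 1 : ℕ) ^ (2 * n)) := by
  have h1 : i.1.descFactorial k ≤ (max i.1 1) ^ n :=
    (Nat.descFactorial_le_pow _ _).trans ((Nat.pow_le_pow_left (le_max_left _ _) k).trans
      (Nat.pow_le_pow_right (by omega) hk))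
  have h2 : (i.2 + j).descFactorial (2 * j) ≤ (n + 1) ^ (2 * n) * (max i.2 1) ^ (2 * n) := by
    rw [← mul_pow]
    have h3 : i.2 + j ≤ (n + 1) * max i.2 1 := by
      have := le_max_left i.2 1
      have := le_max_right i.2 1
      nlinarith
    exact (Nat.descFactorial_le_pow _ _).trans ((Nat.pow_le_pow_left h3 _).trans
      (Nat.pow_le_pow_right (by positivity) (by omega)))
  have h := Nat.mul_le_mul h1 h2
  rw [mul_left_comm] at h
  rw [derivWeight]
  exact_mod_cast h

/-- The weight `k_*^η j_*^{2η}`. -/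
def powWeight (η : ℝ) (i : ℕ × ℕ) : ℝ := ((max i.1 1 : ℕ) : ℝ) ^ η * ((max i.2 1 : ℕ) : ℝ) ^ (2 * η)

lemma powWeight_pos (η : ℝ) (i : ℕ × ℕ) : 0 < powWeight η i := by
  have h1 : 0 < max i.1 1 := by omega
  have h2 : 0 < max i.2 1 := by omega
  unfold powWeight
  positivity

lemma weightedTerm_eq (b : ℕ → ℕ → ℝ) (η : ℝ) (i : ℕ × ℕ) :
    weightedTerm b η i = b i.1 i.2 ^ 2 * powWeight η i := by
  rw [weightedTerm, powWeight, mul_assoc]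

lemma powWeight_natCast (n : ℕ) (i : ℕ × ℕ) :
    powWeight n i = ((max i.1 1 : ℕ) ^ n * (max i.2 1 : ℕ) ^ (2 * n) : ℝ) := by
  rw [powWeight, Real.rpow_natCast, show (2 * (n : ℝ)) = ((2 * n : ℕ) : ℝ) by push_cast; ring,
    Real.rpow_natCast]

theorem exists_sobolevWeight_bounds (n : ℕ) : ∃ c C : ℝ, 0 < c ∧ 0 < C ∧
    ∀ i, c * powWeight n i ≤ sobolevWeight n i ∧ sobolevWeight n i ≤ C * powWeight n i := by
  refine ⟨(((n + 1 : ℕ) : ℝ) ^ n * ((n + 1 : ℕ) : ℝ) ^ (2 * n))⁻¹,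
    (n + 1) * ((n + 1) * ((n + 1 : ℕ) : ℝ) ^ (2 * n)), by positivity, by positivity,
    fun i => ⟨?_, ?_⟩⟩
  · obtain ⟨k, hk, h1⟩ := exists_pow_le_descFactorial n i.1
    obtain ⟨j, hj, h2⟩ := exists_pow_le_descFactorial_add n i.2
    have h3 : derivWeight j k i ≤ sobolevWeight n i := by
      refine le_trans ?_ (Finset.single_le_sum (f := fun j => ∑ k ∈ Finset.range (n + 1),
        derivWeight j k i) (fun j _ => Finset.sum_nonneg fun k _ => derivWeight_nonneg _ _ _)
        (Finset.mem_range.2 (Nat.lt_succ_of_le hj)))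
      exact Finset.single_le_sum (f := fun k => derivWeight j k i)
        (fun k _ => derivWeight_nonneg _ _ _) (Finset.mem_range.2 (Nat.lt_succ_of_le hk))
    refine le_trans ?_ h3
    rw [powWeight_natCast, inv_mul_le_iff₀ (by positivity), derivWeight]
    have h := Nat.mul_le_mul h1 h2
    rw [mul_mul_mul_comm] at h
    exact_mod_cast h
  · rw [powWeight_natCast, mul_assoc, mul_assoc]
    refine (Finset.sum_le_sum fun j hj => Finset.sum_le_sum fun k hk => derivWeight_le
      (Nat.lt_succ_iff.1 (Finset.mem_range.1 hj)) (Nat.lt_succ_iff.1 (Finset.mem_range.1 hk)) i).trans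
      (le_of_eq ?_)
    simp

/-! ### The mixed derivative of order `n` -/

lemma exists_tailWeight_bounds (n : ℕ) : ∃ c C : ℝ, 0 < c ∧ 0 < C ∧ ∀ p : ℕ × ℕ,
    c * (((n + p.1 : ℕ) : ℝ) ^ n * ((n + p.2 : ℕ) : ℝ) ^ (2 * n)) ≤ derivWeight n n (shift n n p) ∧
    derivWeight n n (shift n n p)
      ≤ C * (((n + p.1 : ℕ) : ℝ) ^ n * ((n + p.2 : ℕ) : ℝ) ^ (2 * n)) := by
  refine ⟨(((n + 1 : ℕ) : ℝ) ^ n * ((n + 1 : ℕ) : ℝ) ^ (2 * n))⁻¹, (2 : ℝ) ^ (2 * n),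
    by positivity, by positivity, fun p => ⟨?_, ?_⟩⟩
  · rw [inv_mul_le_iff₀ (by positivity), derivWeight]
    have h := Nat.mul_le_mul (pow_le_mul_descFactorial (n := n) (m := n + p.1) (by omega))
      (pow_le_mul_descFactorial_add (n := n) (l := n + p.2) (by omega))
    rw [mul_mul_mul_comm] at h
    simp only [shift, add_comm _ n] at h ⊢
    exact_mod_cast h
  · have h1 := Nat.descFactorial_le_pow (n + p.1) n
    have h2 : (n + p.2 + n).descFactorial (2 * n) ≤ 2 ^ (2 * n) * (n + p.2) ^ (2 * n) := by
      rw [← mul_pow]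
      exact (Nat.descFactorial_le_pow _ _).trans (Nat.pow_le_pow_left (by omega) _)
    have h := Nat.mul_le_mul h1 h2
    rw [mul_left_comm] at h
    rw [derivWeight]
    simp only [shift, add_comm _ n] at h ⊢
    exact_mod_cast h

lemma summable_iff_of_bounds {ι : Type*} {u v : ι → ℝ} {c C : ℝ} (hc : 0 < c)
    (hv : ∀ i, 0 ≤ v i) (h : ∀ i, c * v i ≤ u i ∧ u i ≤ C * v i) : Summable v ↔ Summable u := by
  constructor
  · intro hs
    exact Summable.of_nonneg_of_le (fun i => (mul_nonneg hc.le (hv i)).trans (h i).1)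
      (fun i => (h i).2) (hs.mul_left C)
  · intro hs
    have := Summable.of_nonneg_of_le (fun i => mul_nonneg hc.le (hv i)) (fun i => (h i).1) hs
    exact (summable_mul_left_iff hc.ne').1 this

lemma tsum_bounds {ι : Type*} {u v : ι → ℝ} {c C : ℝ} (hc : 0 < c)
    (hv : ∀ i, 0 ≤ v i) (h : ∀ i, c * v i ≤ u i ∧ u i ≤ C * v i) (hs : Summable v) :
    c * ∑' i, v i ≤ ∑' i, u i ∧ ∑' i, u i ≤ C * ∑' i, v i := by
  have hu := (summable_iff_of_bounds hc hv h).1 hs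
  rw [← tsum_mul_left, ← tsum_mul_left]
  exact ⟨(hs.mul_left c).tsum_le_tsum (fun i => (h i).1) hu,
    hu.tsum_le_tsum (fun i => (h i).2) (hs.mul_left C)⟩

lemma exists_tailTerm_bounds (n : ℕ) : ∃ c C : ℝ, 0 < c ∧ 0 < C ∧ ∀ (f : ℝ × ℝ → ℝ) (p : ℕ × ℕ),
    c * tailTerm (fun k j => fourierCoeff 0 f (k, j)) n p
        ≤ fourierCoeff 0 f (shift n n p) ^ 2 * derivWeight n n (shift n n p) ∧
      fourierCoeff 0 f (shift n n p) ^ 2 * derivWeight n n (shift n n p)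
        ≤ C * tailTerm (fun k j => fourierCoeff 0 f (k, j)) n p := by
  obtain ⟨c, C, hc, hC, h⟩ := exists_tailWeight_bounds n
  refine ⟨c, C, hc, hC, fun f p => ?_⟩
  have e : (n + p.1, n + p.2) = shift n n p := by simp [shift, add_comm]
  have h1 := mul_le_mul_of_nonneg_left (h p).1 (sq_nonneg (fourierCoeff 0 f (shift n n p)))
  have h2 := mul_le_mul_of_nonneg_left (h p).2 (sq_nonneg (fourierCoeff 0 f (shift n n p)))
  simp only [tailTerm, e]
  exact ⟨le_trans (le_of_eq (by ring)) h1, h2.trans (le_of_eq (by ring))⟩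

lemma tailTerm_nonneg (b : ℕ → ℕ → ℝ) (n : ℕ) (p : ℕ × ℕ) : 0 ≤ tailTerm b n p := by
  unfold tailTerm; positivity

lemma rpow_half_sq {x : ℝ} (hx : 0 ≤ x) (n : ℕ) : (x ^ ((n : ℝ) / 2)) ^ 2 = x ^ n := by
  rw [← Real.rpow_natCast, ← Real.rpow_mul hx, Nat.cast_ofNat, div_mul_cancel₀ _ two_ne_zero,
    Real.rpow_natCast]

lemma memLp_mul_rpow_iff {n : ℕ} {g : ℝ × ℝ → ℝ} (hg : LocallyIntegrableOn g strip) :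
    MemLp (fun p => g p * (1 - p.1 ^ 2) ^ ((n : ℝ) / 2)) 2 stripMeasure
      ↔ MemLp g 2 (weightedMeasure n) := by
  have hgm : AEStronglyMeasurable g stripMeasure :=
    hg.aestronglyMeasurable.mono_ac stripMeasure_absolutelyContinuous
  have hm : Measurable fun p : ℝ × ℝ => (1 - p.1 ^ 2) ^ ((n : ℝ) / 2) := by fun_prop
  have hgm' : AEStronglyMeasurable (fun p => g p * (1 - p.1 ^ 2) ^ ((n : ℝ) / 2)) stripMeasure :=
    hgm.mul hm.aestronglyMeasurable
  rw [memLp_weightedMeasure_iff hg, memLp_two_iff_integrable_sq hgm']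
  refine integrable_congr ?_
  filter_upwards [ae_mem_strip] with p hp
  rw [mul_pow, rpow_half_sq (one_sub_sq_pos hp).le]

/-- Only the single derivative of order `(n, n)` enters. Its kernel contains the modes with an index
below `n`, which is why the sum starts at `n`. -/
theorem summable_tailTerm_iff {f : ℝ × ℝ → ℝ} (hf : MemLp f 2 stripMeasure) (n : ℕ) :
    Summable (tailTerm (fun k j => fourierCoeff 0 f (k, j)) n) ↔
      ∃ g : ℝ × ℝ → ℝ, HasWeakDeriv n n f g ∧
        MemLp (fun p => g p * (1 - p.1 ^ 2) ^ ((n : ℝ) / 2)) 2 stripMeasure := by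
  obtain ⟨c, C, hc, -, h⟩ := exists_tailTerm_bounds n
  rw [summable_iff_of_bounds hc (tailTerm_nonneg _ n) (h f)]
  have hi := (shift_injective n n).summable_iff
    (f := fun i => fourierCoeff 0 f i ^ 2 * derivWeight n n i)
    fun i hi => by rw [derivWeight_eq_zero hi, mul_zero]
  refine hi.trans ⟨fun hs => ?_, fun ⟨g, hg, hgm⟩ => ?_⟩
  · obtain ⟨g, hg, hgm⟩ := exists_hasWeakDeriv hf hs
    exact ⟨g, hg, (memLp_mul_rpow_iff hg.1).2 hgm⟩
  · exact (hg.hasSum hf ((memLp_mul_rpow_iff hg.1).1 hgm)).summable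

theorem exists_tailTerm_norm_bounds (n : ℕ) : ∃ c C : ℝ, 0 < c ∧ 0 < C ∧
    ∀ f g : ℝ × ℝ → ℝ, MemLp f 2 stripMeasure → HasWeakDeriv n n f g →
      MemLp (fun p => g p * (1 - p.1 ^ 2) ^ ((n : ℝ) / 2)) 2 stripMeasure →
      c * ∑' p, tailTerm (fun k j => fourierCoeff 0 f (k, j)) n p
          ≤ ∫ p, g p ^ 2 * (1 - p.1 ^ 2) ^ n ∂stripMeasure ∧
        ∫ p, g p ^ 2 * (1 - p.1 ^ 2) ^ n ∂stripMeasure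
          ≤ C * ∑' p, tailTerm (fun k j => fourierCoeff 0 f (k, j)) n p := by
  obtain ⟨c, C, hc, hC, h⟩ := exists_tailTerm_bounds n
  refine ⟨c, C, hc, hC, fun f g hf hg hgm => ?_⟩
  have hs := hg.hasSum hf ((memLp_mul_rpow_iff hg.1).1 hgm)
  rw [← (shift_injective n n).hasSum_iff fun i hi => by rw [derivWeight_eq_zero hi, mul_zero]] at hs
  rw [← hs.tsum_eq]
  exact tsum_bounds hc (tailTerm_nonneg _ n) (h f) ((summable_tailTerm_iff hf n).2 ⟨g, hg, hgm⟩)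

/-! ### Real interpolation -/

/-- The weighted sum of squares of the coefficients, as an extended number. -/
def weightedSum (η : ℝ) (f : L2) : ℝ≥0∞ :=
  ∑' i, ENNReal.ofReal (fourierLM i f ^ 2 * powWeight η i)

theorem exists_sobolevNormSq_bounds (n : ℕ) : ∃ c C : ℝ, 0 < c ∧ 0 < C ∧ ∀ f : L2,
    ENNReal.ofReal c * weightedSum n f ≤ sobolevNormSq n n f ∧
      sobolevNormSq n n f ≤ ENNReal.ofReal C * weightedSum n f := by
  obtain ⟨c, C, hc, hC, h⟩ := exists_sobolevWeight_bounds n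
  refine ⟨c, C, hc, hC, fun f => ?_⟩
  simp only [weightedSum, sobolevNormSq_eq', ← ENNReal.tsum_mul_left, ← ENNReal.ofReal_mul hc.le,
    ← ENNReal.ofReal_mul hC.le]
  refine ⟨ENNReal.tsum_le_tsum fun i => ENNReal.ofReal_le_ofReal ?_,
    ENNReal.tsum_le_tsum fun i => ENNReal.ofReal_le_ofReal ?_⟩
  · rw [mul_left_comm]
    exact mul_le_mul_of_nonneg_left (h i).1 (sq_nonneg _)
  · rw [mul_left_comm C]
    exact mul_le_mul_of_nonneg_left (h i).2 (sq_nonneg _)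

lemma summable_fourierLM_sq (f : L2) : Summable fun i => fourierLM i f ^ 2 := by
  have := (parseval (memLp_coe f) (memLp_coe f)).summable
  simp only [← pow_two] at this
  exact this

lemma exists_fourierLM_eq {c : ℕ × ℕ → ℝ} (hc : Summable fun i => c i ^ 2) :
    ∃ f : L2, ∀ i, fourierLM i f = c i := by
  obtain ⟨u, hu, huc⟩ := riesz_fischer 0 hc
  rw [weightedMeasure_zero] at hu
  refine ⟨hu.toLp u, fun i => ?_⟩
  rw [← huc i]
  exact fourierCoeff_congr hu.coeFn_toLp i

/-- The minimum of the weights of `W^n` and `r² W^{n+1}`. -/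
def minWeight (n : ℕ) (r : ℝ) (i : ℕ × ℕ) : ℝ :=
  min (powWeight n i) (r ^ 2 * powWeight (n + 1 : ℕ) i)

lemma minWeight_nonneg (n : ℕ) (r : ℝ) (i : ℕ × ℕ) : 0 ≤ minWeight n r i :=
  le_min (powWeight_pos _ _).le (mul_nonneg (sq_nonneg r) (powWeight_pos _ _).le)

/-- The discrete counterpart of the square of the functional `J`. -/
def minSum (n : ℕ) (r : ℝ) (f : L2) : ℝ≥0∞ :=
  ∑' i, ENNReal.ofReal (fourierLM i f ^ 2 * minWeight n r i)

lemma sq_rpow_half (x : ℝ≥0∞) : (x ^ (1 / 2 : ℝ)) ^ 2 = x := by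
  rw [← ENNReal.rpow_natCast, ← ENNReal.rpow_mul]
  norm_num

lemma rpow_half_sq' (x : ℝ≥0∞) : (x ^ 2) ^ (1 / 2 : ℝ) = x := by
  rw [← ENNReal.rpow_natCast, ← ENNReal.rpow_mul]
  norm_num

lemma minSum_add_le (n : ℕ) (r : ℝ) (v w : L2) :
    minSum n r (v + w) ≤ 2 * weightedSum n v
      + 2 * (ENNReal.ofReal (r ^ 2) * weightedSum (n + 1 : ℕ) w) := by
  simp only [minSum, weightedSum, ← ENNReal.tsum_mul_left, map_add]
  rw [← ENNReal.tsum_add]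
  refine ENNReal.tsum_le_tsum fun i => (ofReal_sq_add_mul_le (minWeight_nonneg n r i)).trans ?_
  gcongr
  · exact min_le_left _ _
  · rw [← ENNReal.ofReal_mul (sq_nonneg r), mul_left_comm (r ^ 2)]
    gcongr
    exact min_le_right _ _

lemma sq_add_sq_le (a b : ℝ≥0∞) : a ^ 2 + b ^ 2 ≤ (a + b) ^ 2 := by
  have : (a + b) ^ 2 = a ^ 2 + b ^ 2 + 2 * a * b := by ring
  rw [this]
  exact le_self_add

/-- For any decomposition, `(a+b)² ≤ 2a² + 2b²` holds coefficientwise, and the minimal weight is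
bounded by the weight belonging to each part. The halving of `d` compensates the factor 2. -/
lemma exists_minSum_le_functionalJ (n : ℕ) : ∃ c : ℝ, 0 < c ∧ ∀ (r : ℝ) (f : L2), 0 < r →
    ENNReal.ofReal c * minSum n r f ≤ functionalJ n r f ^ 2 := by
  obtain ⟨c, _, hc, _, h⟩ := exists_sobolevNormSq_bounds n
  obtain ⟨c', _, hc', _, h'⟩ := exists_sobolevNormSq_bounds (n + 1)
  set d := min c c'
  have hd : 0 < d := lt_min hc hc'
  refine ⟨d / 2, by positivity, fun r f hr => ?_⟩
  have key : (ENNReal.ofReal (d / 2) * minSum n r f) ^ (1 / 2 : ℝ) ≤ functionalJ n r f := by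
    refine le_iInf fun v => le_iInf fun w => le_iInf fun _ => le_iInf fun _ => le_iInf fun hf => ?_
    rw [← rpow_half_sq' (_ + _)]
    refine ENNReal.rpow_le_rpow ?_ (by norm_num)
    refine le_trans ?_ (sq_add_sq_le _ _)
    rw [mul_pow, sq_rpow_half, sq_rpow_half, ← ENNReal.ofReal_pow hr.le, hf]
    have e : ENNReal.ofReal (d / 2) * 2 = ENNReal.ofReal d := by
      rw [show (2 : ℝ≥0∞) = ENNReal.ofReal 2 by simp, ← ENNReal.ofReal_mul (by positivity)]
      congr 1; ring
    calc ENNReal.ofReal (d / 2) * minSum n r (v + w)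
        ≤ ENNReal.ofReal (d / 2) * (2 * weightedSum n v
          + 2 * (ENNReal.ofReal (r ^ 2) * weightedSum (n + 1 : ℕ) w)) := by
          gcongr; exact minSum_add_le n r v w
      _ = ENNReal.ofReal d * weightedSum n v
          + ENNReal.ofReal (r ^ 2) * (ENNReal.ofReal d * weightedSum (n + 1 : ℕ) w) := by
          rw [← e]; ring
      _ ≤ ENNReal.ofReal c * weightedSum n v
          + ENNReal.ofReal (r ^ 2) * (ENNReal.ofReal c' * weightedSum (n + 1 : ℕ) w) := by
          gcongr
          · exact min_le_left _ _
          · exact min_le_right _ _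
      _ ≤ _ := by
          gcongr
          · exact (h v).1
          · exact (h' w).1
  calc ENNReal.ofReal (d / 2) * minSum n r f
      = ((ENNReal.ofReal (d / 2) * minSum n r f) ^ (1 / 2 : ℝ)) ^ 2 := (sq_rpow_half _).symm
    _ ≤ _ := by gcongr

lemma exists_functionalJ_le_minSum (n : ℕ) : ∃ C : ℝ, 0 < C ∧ ∀ (r : ℝ) (f : L2), 0 < r →
    functionalJ n r f ^ 2 ≤ ENNReal.ofReal C * minSum n r f := by
  classical
  obtain ⟨_, C, _, hC, h⟩ := exists_sobolevNormSq_bounds n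
  obtain ⟨_, C', _, hC', h'⟩ := exists_sobolevNormSq_bounds (n + 1)
  set K := max C C'
  have hK : 0 < K := lt_max_of_lt_left hC
  refine ⟨4 * K, by positivity, fun r f hr => ?_⟩
  by_cases htop : minSum n r f = ⊤
  · rw [htop, ENNReal.mul_top (by simpa using hK)]
    exact le_top
  have hr2 : 0 < r ^ 2 := by positivity
  -- Each coefficient goes entirely to the part with the smaller weight, and a tie goes to `v`.
  obtain ⟨v, hv⟩ := exists_fourierLM_eq
    (c := fun i => if powWeight n i ≤ r ^ 2 * powWeight (n + 1 : ℕ) i then fourierLM i f else 0)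
    ((summable_fourierLM_sq f).of_nonneg_of_le (fun i => sq_nonneg _) fun i => by
      split_ifs
      · exact le_rfl
      · simpa using sq_nonneg _)
  have h1 : weightedSum n v ≤ minSum n r f := by
    refine ENNReal.tsum_le_tsum fun i => ENNReal.ofReal_le_ofReal ?_
    have hm := mul_nonneg (sq_nonneg (fourierLM i f)) (minWeight_nonneg n r i)
    rw [minWeight] at hm
    rw [hv, minWeight]
    split_ifs with hi
    · rw [min_eq_left hi]
    · simpa using hm
  have h2 : ENNReal.ofReal (r ^ 2) * weightedSum (n + 1 : ℕ) (f - v) ≤ minSum n r f := by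
    rw [weightedSum, ← ENNReal.tsum_mul_left]
    refine ENNReal.tsum_le_tsum fun i => ?_
    rw [← ENNReal.ofReal_mul hr2.le]
    refine ENNReal.ofReal_le_ofReal ?_
    have hm := mul_nonneg (sq_nonneg (fourierLM i f)) (minWeight_nonneg n r i)
    rw [minWeight] at hm
    rw [map_sub, hv, mul_left_comm, minWeight]
    split_ifs with hi
    · simpa using hm
    · rw [min_eq_right (not_le.1 hi).le, sub_zero]
  have h3 : sobolevNormSq n n v ≤ ENNReal.ofReal K * minSum n r f :=
    (h v).2.trans (mul_le_mul' (ENNReal.ofReal_le_ofReal (le_max_left _ _)) h1)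
  have h4 : ENNReal.ofReal (r ^ 2) * sobolevNormSq (n + 1) (n + 1) (f - v)
      ≤ ENNReal.ofReal K * minSum n r f := by
    refine (mul_le_mul_right (h' (f - v)).2 _).trans ?_
    rw [mul_left_comm]
    exact mul_le_mul' (ENNReal.ofReal_le_ofReal (le_max_right _ _)) h2
  have hfin : ENNReal.ofReal K * minSum n r f < ⊤ :=
    ENNReal.mul_lt_top ENNReal.ofReal_lt_top (lt_top_iff_ne_top.2 htop)
  have hvmem : v ∈ sobolevSpace n n := (mem_sobolevSpace_iff n v).2 (h3.trans_lt hfin)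
  have hwmem : f - v ∈ sobolevSpace (n + 1) (n + 1) := by
    refine (mem_sobolevSpace_iff (n + 1) (f - v)).2 (lt_top_iff_ne_top.2 fun ht => ?_)
    rw [ht, ENNReal.mul_top (by simpa using hr.ne')] at h4
    exact (h4.trans_lt hfin).false
  have hJ : functionalJ n r f ≤ sobolevNormSq n n v ^ (1 / 2 : ℝ)
      + ENNReal.ofReal r * sobolevNormSq (n + 1) (n + 1) (f - v) ^ (1 / 2 : ℝ) :=
    iInf_le_of_le v (iInf_le_of_le (f - v) (iInf_le_of_le hvmem (iInf_le_of_le hwmem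
      (iInf_le_of_le (by abel) le_rfl))))
  -- Both parts have the same bound; squaring this sum of two roots produces the factor 4.
  have hJ2 : functionalJ n r f ≤ 2 * (ENNReal.ofReal K * minSum n r f) ^ (1 / 2 : ℝ) := by
    refine hJ.trans ?_
    rw [two_mul]
    refine add_le_add (ENNReal.rpow_le_rpow h3 (by norm_num)) ?_
    conv_lhs => rw [← rpow_half_sq' (ENNReal.ofReal r), ← ENNReal.mul_rpow_of_nonneg _ _ (by norm_num),
      ← ENNReal.ofReal_pow hr.le]
    exact ENNReal.rpow_le_rpow h4 (by norm_num)
  calc functionalJ n r f ^ 2 ≤ (2 * (ENNReal.ofReal K * minSum n r f) ^ (1 / 2 : ℝ)) ^ 2 := by gcongr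
    _ = 4 * (ENNReal.ofReal K * minSum n r f) := by
        rw [mul_pow, sq_rpow_half]; norm_num
    _ = _ := by
        rw [← mul_assoc, ENNReal.ofReal_mul (by norm_num)]
        simp

/-- The value of `∫ min(1, λr²) r^{-2θ-1} dr` is `interpConst θ * λ^θ`. -/
def interpConst (θ : ℝ) : ℝ := 1 / (2 - 2 * θ) + 1 / (2 * θ)

lemma lintegral_min_mul_rpow {θ l : ℝ} (h0 : 0 < θ) (h1 : θ < 1) (hl : 0 < l) :
    ∫⁻ r in Ioi (0 : ℝ), ENNReal.ofReal (r ^ (-2 * θ) / r * min 1 (r ^ 2 * l))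
      = ENNReal.ofReal (interpConst θ * l ^ θ) := by
  -- The minimum changes branch where `r² l = 1`. The integral converges at `0` because `θ < 1` and
  -- at infinity because `θ > 0`.
  set s : ℝ := l ^ (-(1 / 2) : ℝ)
  have hs : 0 < s := by positivity
  have hs2 : s ^ 2 * l = 1 := by
    rw [← Real.rpow_natCast, ← Real.rpow_mul hl.le]
    nth_rewrite 2 [← Real.rpow_one l]
    rw [← Real.rpow_add hl]
    norm_num
  have hsl : ∀ a : ℝ, s ^ (2 * a) = l ^ (-a) := by
    intro a
    rw [← Real.rpow_mul hl.le]
    congr 1; ring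
  rw [← Ioc_union_Ioi_eq_Ioi hs.le, lintegral_union measurableSet_Ioi Ioc_disjoint_Ioi_same]
  have e1 : ∫⁻ r in Ioc 0 s, ENNReal.ofReal (r ^ (-2 * θ) / r * min 1 (r ^ 2 * l))
      = ENNReal.ofReal (l ^ θ * (1 / (2 - 2 * θ))) := by
    have hc : ∫⁻ r in Ioc 0 s, ENNReal.ofReal (r ^ (-2 * θ) / r * min 1 (r ^ 2 * l))
        = ∫⁻ r in Ioc 0 s, ENNReal.ofReal (l * r ^ (1 - 2 * θ)) := by
      refine setLIntegral_congr_fun measurableSet_Ioc fun r hr => ?_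
      have hr0 : 0 < r := hr.1
      have hle : r ^ 2 * l ≤ 1 := by
        rw [← hs2]
        have := hr.2
        gcongr
      rw [min_eq_right hle, show (1 - 2 * θ) = -2 * θ + 1 by ring, Real.rpow_add hr0, Real.rpow_one]
      congr 1
      field_simp
    have hi : IntegrableOn (fun r : ℝ => r ^ (1 - 2 * θ)) (Ioc 0 s) := by
      rw [← intervalIntegrable_iff_integrableOn_Ioc_of_le hs.le]
      exact intervalIntegral.intervalIntegrable_rpow' (by linarith)
    rw [hc, ← ofReal_integral_eq_lintegral_ofReal (hi.const_mul l)]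
    · rw [integral_const_mul, ← intervalIntegral.integral_of_le hs.le,
        integral_rpow (Or.inl (by linarith)), Real.zero_rpow (by linarith),
        show 1 - 2 * θ + 1 = 2 * (1 - θ) by ring, hsl, sub_zero,
        show -(1 - θ) = θ - 1 by ring, Real.rpow_sub_one hl.ne']
      congr 1
      field_simp
    · refine (ae_restrict_iff' measurableSet_Ioc).2 (ae_of_all _ fun r hr => ?_)
      have := hr.1
      simp only [Pi.zero_apply]
      positivity
  have e2 : ∫⁻ r in Ioi s, ENNReal.ofReal (r ^ (-2 * θ) / r * min 1 (r ^ 2 * l))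
      = ENNReal.ofReal (l ^ θ * (1 / (2 * θ))) := by
    have hc : ∫⁻ r in Ioi s, ENNReal.ofReal (r ^ (-2 * θ) / r * min 1 (r ^ 2 * l))
        = ∫⁻ r in Ioi s, ENNReal.ofReal (r ^ (-2 * θ - 1)) := by
      refine setLIntegral_congr_fun measurableSet_Ioi fun r hr => ?_
      have hr0 : 0 < r := hs.trans hr
      have hle : 1 ≤ r ^ 2 * l := by
        rw [← hs2]
        have : s ≤ r := le_of_lt hr
        gcongr
      rw [min_eq_left hle, mul_one, Real.rpow_sub_one hr0.ne']
    rw [hc, ← ofReal_integral_eq_lintegral_ofReal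
      (integrableOn_Ioi_rpow_of_lt (by linarith) hs)]
    · rw [integral_Ioi_rpow_of_lt (by linarith) hs, show -2 * θ - 1 + 1 = 2 * (-θ) by ring, hsl,
        neg_neg]
      congr 1
      field_simp
    · refine (ae_restrict_iff' measurableSet_Ioi).2 (ae_of_all _ fun r hr => ?_)
      have : 0 < r := hs.trans hr
      simp only [Pi.zero_apply]
      positivity
  have h2 : 0 < 2 - 2 * θ := by linarith
  rw [e1, e2, ← ENNReal.ofReal_add (by positivity) (by positivity), interpConst]
  congr 1
  ring

lemma powWeight_succ (n : ℕ) (i : ℕ × ℕ) : powWeight (n + 1 : ℕ) i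
    = powWeight n i * ((max i.1 1 : ℕ) * ((max i.2 1 : ℕ) : ℝ) ^ 2) := by
  rw [powWeight_natCast, powWeight_natCast]
  ring

/-- The base of the power `θ` is the ratio of consecutive integer weights, so the interpolated
weight is their geometric mean. -/
lemma powWeight_add (n : ℕ) (θ : ℝ) (i : ℕ × ℕ) : powWeight (n + θ) i
    = powWeight n i * ((max i.1 1 : ℕ) * ((max i.2 1 : ℕ) : ℝ) ^ 2) ^ θ := by
  have h1 : (0 : ℝ) < (max i.1 1 : ℕ) := by
    have : 0 < max i.1 1 := by omega
    exact_mod_cast this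
  have h2 : (0 : ℝ) < (max i.2 1 : ℕ) := by
    have : 0 < max i.2 1 := by omega
    exact_mod_cast this
  rw [powWeight, powWeight, Real.mul_rpow h1.le (by positivity), ← Real.rpow_natCast _ 2,
    ← Real.rpow_mul h2.le, Real.rpow_add h1, mul_add, Real.rpow_add h2]
  push_cast
  ring

/-- By Tonelli the integral is taken for each mode separately, where it is a scaled copy of one
scalar integral. -/
lemma lintegral_minSum {θ : ℝ} (h0 : 0 < θ) (h1 : θ < 1) (n : ℕ) (f : L2) :
    ∫⁻ r in Ioi (0 : ℝ), ENNReal.ofReal (r ^ (-2 * θ) / r) * minSum n r f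
      = ENNReal.ofReal (interpConst θ) * weightedSum (n + θ) f := by
  have hκ : 0 < interpConst θ := by
    have h2 : 0 < 2 - 2 * θ := by linarith
    unfold interpConst; positivity
  simp only [minSum, weightedSum, ← ENNReal.tsum_mul_left]
  rw [lintegral_tsum]
  · congr 1
    ext i
    set l : ℝ := (max i.1 1 : ℕ) * ((max i.2 1 : ℕ) : ℝ) ^ 2
    have hl : 0 < l := by
      have h1 : 0 < max i.1 1 := by omega
      have h2 : 0 < max i.2 1 := by omega
      positivity
    have hB : 0 ≤ fourierLM i f ^ 2 * powWeight n i := mul_nonneg (sq_nonneg _) (powWeight_pos _ _).le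
    have e : ∀ r ∈ Ioi (0 : ℝ), ENNReal.ofReal (r ^ (-2 * θ) / r) *
        ENNReal.ofReal (fourierLM i f ^ 2 * minWeight n r i)
        = ENNReal.ofReal (fourierLM i f ^ 2 * powWeight n i) *
          ENNReal.ofReal (r ^ (-2 * θ) / r * min 1 (r ^ 2 * l)) := by
      intro r hr
      have hr0 : 0 < r := hr
      rw [← ENNReal.ofReal_mul (by positivity), ← ENNReal.ofReal_mul hB]
      congr 1
      have hm : minWeight n r i = powWeight n i * min 1 (r ^ 2 * l) := by
        rw [mul_min_of_nonneg _ _ (powWeight_pos _ _).le, minWeight, powWeight_succ, mul_one]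
        congr 1
        ring
      rw [hm]
      ring
    rw [setLIntegral_congr_fun measurableSet_Ioi e, lintegral_const_mul' _ _ ENNReal.ofReal_ne_top,
      lintegral_min_mul_rpow h0 h1 hl, ← ENNReal.ofReal_mul hB, ← ENNReal.ofReal_mul hκ.le,
      powWeight_add]
    congr 1
    ring
  · intro i
    have : Measurable fun r : ℝ => minWeight n r i := by unfold minWeight; fun_prop
    exact Measurable.aemeasurable (by fun_prop)

theorem exists_interpNormSq_bounds (n : ℕ) {θ : ℝ} (h0 : 0 < θ) (h1 : θ < 1) :
    ∃ c C : ℝ, 0 < c ∧ 0 < C ∧ ∀ f : L2,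
      ENNReal.ofReal c * weightedSum (n + θ) f ≤ interpNormSq n θ f ∧
        interpNormSq n θ f ≤ ENNReal.ofReal C * weightedSum (n + θ) f := by
  have hκ : 0 < interpConst θ := by
    have h2 : 0 < 2 - 2 * θ := by linarith
    unfold interpConst; positivity
  obtain ⟨c, hc, h⟩ := exists_minSum_le_functionalJ n
  obtain ⟨C, hC, h'⟩ := exists_functionalJ_le_minSum n
  have e : ∀ (d : ℝ) (f : L2), 0 < d →
      ENNReal.ofReal (d * interpConst θ) * weightedSum (n + θ) f
        = ∫⁻ r in Ioi (0 : ℝ), ENNReal.ofReal (r ^ (-2 * θ) / r) *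
          (ENNReal.ofReal d * minSum n r f) := by
    intro d f hd
    rw [ENNReal.ofReal_mul hd.le, mul_assoc, ← lintegral_minSum h0 h1,
      ← lintegral_const_mul' _ _ ENNReal.ofReal_ne_top]
    simp_rw [mul_left_comm (ENNReal.ofReal d)]
  refine ⟨c * interpConst θ, C * interpConst θ, by positivity, by positivity, fun f => ⟨?_, ?_⟩⟩
  · rw [e c f hc]
    refine setLIntegral_mono' measurableSet_Ioi fun r hr => ?_
    gcongr
    exact h r f hr
  · rw [e C f hC]
    refine setLIntegral_mono' measurableSet_Ioi fun r hr => ?_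
    gcongr
    exact h' r f hr

/-! ### The spaces `W^η` -/

theorem exists_normSqW_bounds {η : ℝ} (hη : 0 ≤ η) : ∃ c C : ℝ, 0 < c ∧ 0 < C ∧ ∀ f : L2,
    ENNReal.ofReal c * weightedSum η f ≤ normSqW η f ∧
      normSqW η f ≤ ENNReal.ofReal C * weightedSum η f := by
  by_cases h : η = ⌊η⌋₊
  · obtain ⟨c, C, hc, hC, H⟩ := exists_sobolevNormSq_bounds ⌊η⌋₊
    refine ⟨c, C, hc, hC, fun f => ?_⟩
    rw [normSqW, if_pos h]
    have := H f
    rwa [← h] at this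
  · have h0 : 0 < η - ⌊η⌋₊ := sub_pos.2 (lt_of_le_of_ne (Nat.floor_le hη) (Ne.symm h))
    have h1 : η - ⌊η⌋₊ < 1 := by linarith [Nat.lt_floor_add_one η]
    obtain ⟨c, C, hc, hC, H⟩ := exists_interpNormSq_bounds ⌊η⌋₊ h0 h1
    refine ⟨c, C, hc, hC, fun f => ?_⟩
    rw [normSqW, if_neg h]
    have := H f
    rwa [add_sub_cancel] at this

lemma mem_spaceW_iff (η : ℝ) (f : L2) : f ∈ spaceW η ↔ normSqW η f < ⊤ := by
  unfold spaceW normSqW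
  split_ifs with h
  · exact mem_sobolevSpace_iff _ f
  · exact Iff.rfl

lemma weightedTerm_nonneg (b : ℕ → ℕ → ℝ) (η : ℝ) (i : ℕ × ℕ) : 0 ≤ weightedTerm b η i := by
  rw [weightedTerm_eq]
  exact mul_nonneg (sq_nonneg _) (powWeight_pos _ _).le

lemma weightedSum_eq (η : ℝ) (f : L2) :
    weightedSum η f = ∑' i, ENNReal.ofReal (weightedTerm (coeff f) η i) := by
  simp only [weightedTerm_eq, coeff_eq_fourierCoeff]
  rfl

theorem mem_spaceW_iff_summable {η : ℝ} (hη : 0 ≤ η) (f : L2) :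
    f ∈ spaceW η ↔ Summable (weightedTerm (coeff f) η) := by
  obtain ⟨c, C, hc, hC, h⟩ := exists_normSqW_bounds hη
  rw [mem_spaceW_iff, ← tsum_ofReal_ne_top_iff (weightedTerm_nonneg _ _), ← weightedSum_eq]
  constructor
  · intro hf ht
    have := (h f).1
    rw [ht, ENNReal.mul_top (by simpa using hc)] at this
    exact (this.trans_lt hf).false
  · intro hf
    exact (h f).2.trans_lt (ENNReal.mul_lt_top ENNReal.ofReal_lt_top (lt_top_iff_ne_top.2 hf))

theorem exists_normSqW_tsum_bounds {η : ℝ} (hη : 0 ≤ η) : ∃ c C : ℝ, 0 < c ∧ 0 < C ∧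
    ∀ f ∈ spaceW η,
      ENNReal.ofReal (c * ∑' p, weightedTerm (coeff f) η p) ≤ normSqW η f ∧
        normSqW η f ≤ ENNReal.ofReal (C * ∑' p, weightedTerm (coeff f) η p) := by
  obtain ⟨c, C, hc, hC, h⟩ := exists_normSqW_bounds hη
  refine ⟨c, C, hc, hC, fun f hf => ?_⟩
  rw [ENNReal.ofReal_mul hc.le, ENNReal.ofReal_mul hC.le, ENNReal.ofReal_tsum_of_nonneg
    (weightedTerm_nonneg _ _) ((mem_spaceW_iff_summable hη f).1 hf), ← weightedSum_eq]
  exact h f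

/-! ### Covariance kernels -/

lemma exists_sphere_inner {u : ℝ} (hu : u ∈ Icc (-1 : ℝ) 1) :
    ∃ x y : Metric.sphere (0 : EuclideanSpace ℝ (Fin 3)) 1,
      inner ℝ (x : EuclideanSpace ℝ (Fin 3)) (y : EuclideanSpace ℝ (Fin 3)) = u := by
  have h : 0 ≤ 1 - u ^ 2 := by nlinarith [hu.1, hu.2]
  refine ⟨⟨!₂[1, 0, 0], ?_⟩, ⟨!₂[u, √(1 - u ^ 2), 0], ?_⟩, ?_⟩
  · simp [EuclideanSpace.norm_eq, Fin.sum_univ_three]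
  · simp [EuclideanSpace.norm_eq, Fin.sum_univ_three, Real.sq_sqrt h]
  · simp [PiLp.inner_apply, Fin.sum_univ_three]

/-- Positive definiteness at two points with coefficients `1` and `±1`; symmetry in the time lag
makes the two off-diagonal terms equal. -/
lemma IsCovarianceKernel.abs_le {ψ : ℝ → ℝ → ℝ} (h : IsCovarianceKernel ψ) {u : ℝ}
    (hu : u ∈ Icc (-1 : ℝ) 1) (t : ℝ) : |ψ u t| ≤ ψ 1 0 := by
  classical
  obtain ⟨x, y, hxy⟩ := exists_sphere_inner hu
  have hself : ∀ z : Metric.sphere (0 : EuclideanSpace ℝ (Fin 3)) 1,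
      inner ℝ (z : EuclideanSpace ℝ (Fin 3)) (z : EuclideanSpace ℝ (Fin 3)) = (1 : ℝ) := by
    intro z
    rw [real_inner_self_eq_norm_sq, norm_eq_of_mem_sphere]
    norm_num
  -- If the two points coincide, the finite set has one element and the bound is nonnegativity at
  -- the origin.
  by_cases hP : (x, t) = (y, (0 : ℝ))
  · obtain ⟨rfl, rfl⟩ := Prod.mk.inj hP
    have h1 : u = 1 := by rw [← hxy, hself]
    have h0 := h.posDef {(x, 0)} (fun _ => 1)
    simp only [Finset.sum_singleton, hself, sub_self, one_mul] at h0
    rw [h1, abs_of_nonneg h0]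
  · have key : ∀ ε : ℝ, ε ^ 2 = 1 → 0 ≤ ψ 1 0 + ε * ψ u t := by
      intro ε hε
      have h0 := h.posDef {(x, t), (y, 0)} (fun p => if p = (x, t) then 1 else ε)
      have hyx : inner ℝ (y : EuclideanSpace ℝ (Fin 3)) (x : EuclideanSpace ℝ (Fin 3)) = u := by
        rw [real_inner_comm, hxy]
      simp only [Finset.sum_pair hP, hself, hxy, hyx, sub_self, sub_zero, zero_sub,
        if_neg (Ne.symm hP), if_true, h.symm u hu t] at h0
      rw [show ε * ε = 1 by rw [← pow_two, hε]] at h0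
      linarith
    rw [_root_.abs_le]
    exact ⟨by linarith [key 1 (by norm_num)], by linarith [key (-1) (by norm_num)]⟩

lemma IsCovarianceKernel.memLp {ψ : ℝ → ℝ → ℝ} (h : IsCovarianceKernel ψ) :
    MemLp (fun p : ℝ × ℝ => ψ p.1 p.2) 2 stripMeasure := by
  have hsub : strip ⊆ Icc (-1 : ℝ) 1 ×ˢ univ := prod_mono Ioo_subset_Icc_self subset_rfl
  refine MemLp.of_bound (((h.continuousOn.mono hsub).aestronglyMeasurable
    measurableSet_strip).mono_ac stripMeasure_absolutelyContinuous) (ψ 1 0) ?_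
  filter_upwards [ae_mem_strip] with p hp
  exact h.abs_le (hsub hp).1 p.2

lemma spectrumCoeff_eq {ψ : ℝ → ℝ → ℝ} (h : IsCovarianceKernel ψ) (k j : ℕ) :
    spectrumCoeff ψ k j = fourierCoeff 0 (fun p => ψ p.1 p.2) (k, j) := by
  have hm : MemLp (fun p : ℝ × ℝ => ψ p.1 p.2) 2 (weightedMeasure 0) := by
    rw [weightedMeasure_zero]; exact h.memLp
  have hi : Integrable (fun p : ℝ × ℝ => ψ p.1 p.2 * basisFn 0 (k, j) p) (weightedMeasure 0) :=
    integrable_mul_poly hm _ _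
  rw [weightedMeasure_zero, stripMeasure] at hi
  rw [fourierCoeff, weightedMeasure_zero, stripMeasure, integral_prod_symm _ hi, spectrumCoeff]
  congr 1
  ext t
  rw [schoenbergFun, ← integral_mul_const]
  congr 1
  ext x
  simp only [basisFn, hermiteN_eq, legendreN_eq, gegenP_zero]
  ring

lemma summable_sq_of_weightedTerm {b : ℕ → ℕ → ℝ} {n : ℕ} (h : Summable (weightedTerm b n)) :
    Summable fun p : ℕ × ℕ => (b p.1 p.2 * ((p.1 : ℝ) ^ ((n : ℝ) / 2) * (p.2 : ℝ) ^ n)) ^ 2 := by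
  refine h.of_nonneg_of_le (fun p => sq_nonneg _) fun p => ?_
  -- Passing from `k_*`, `j_*` to `k`, `j` only decreases the weight.
  rw [weightedTerm_eq, powWeight_natCast, mul_pow, mul_pow, rpow_half_sq (Nat.cast_nonneg _),
    ← pow_mul, mul_comm n 2]
  gcongr
  · exact le_max_left _ _
  · exact le_max_left _ _

end HermiteLegendre

end

theorem mainTheorem1 :
    -- coefficient characterization of `W^η`, with equivalence of norms
    (∀ η : ℝ, 0 ≤ η →
      (∀ f : L2, f ∈ spaceW η ↔
        Summable (weightedTerm (coeff f) η)) ∧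
      ∃ c C : ℝ, 0 < c ∧ 0 < C ∧ ∀ f ∈ spaceW η,
        ENNReal.ofReal (c * ∑' p, weightedTerm (coeff f) η p)
            ≤ normSqW η f ∧
          normSqW η f ≤
            ENNReal.ofReal
              (C * ∑' p, weightedTerm (coeff f) η p)) ∧
    -- the mixed derivative of integer order `n`
    (∀ n : ℕ,
      (∀ f : L2,
        Summable (tailTerm (coeff f) n) ↔
          ∃ g : ℝ × ℝ → ℝ, HasWeakDeriv n n f g ∧
            MemLp (fun p => g p * (1 - p.1 ^ 2) ^ ((n : ℝ) / 2)) 2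
              stripMeasure) ∧
      ∃ c C : ℝ, 0 < c ∧ 0 < C ∧ ∀ (f : L2) (g : ℝ × ℝ → ℝ),
        HasWeakDeriv n n f g →
        MemLp (fun p => g p * (1 - p.1 ^ 2) ^ ((n : ℝ) / 2)) 2 stripMeasure →
        c * ∑' p, tailTerm (coeff f) n p
            ≤ ∫ p, g p ^ 2 * (1 - p.1 ^ 2) ^ n ∂stripMeasure ∧
          ∫ p, g p ^ 2 * (1 - p.1 ^ 2) ^ n ∂stripMeasure ≤
            C * ∑' p, tailTerm (coeff f) n p) ∧
    -- covariance kernels on `S² × ℝ` and their Hermite power spectrum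
    (∀ ψ : ℝ → ℝ → ℝ, IsCovarianceKernel ψ →
      ∃ f : L2,
        (f =ᵐ[stripMeasure] fun p => ψ p.1 p.2) ∧
        ∀ n : ℕ,
          (f ∈ spaceW n ↔
            Summable (weightedTerm (spectrumCoeff ψ) n)) ∧
          (f ∈ spaceW n →
            Summable fun p : ℕ × ℕ =>
              (spectrumCoeff ψ p.1 p.2 *
                ((p.1 : ℝ) ^ ((n : ℝ) / 2) * (p.2 : ℝ) ^ n)) ^ 2) ∧
          (Summable (tailTerm (spectrumCoeff ψ) n) ↔
            ∃ g : ℝ × ℝ → ℝ,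
              HasWeakDeriv n n (fun p => ψ p.1 p.2) g ∧
              MemLp (fun p => g p * (1 - p.1 ^ 2) ^ ((n : ℝ) / 2)) 2
                stripMeasure)) := by
  refine ⟨fun η hη => ⟨mem_spaceW_iff_summable hη, exists_normSqW_tsum_bounds hη⟩,
    fun n => ⟨fun f => ?_, ?_⟩, fun ψ hψ => ?_⟩
  · simp only [show coeff f = fun k j => fourierCoeff 0 f (k, j) from
      funext fun k => funext fun j => coeff_eq_fourierCoeff f k j]
    exact summable_tailTerm_iff (Lp.memLp f) n
  · obtain ⟨c, C, hc, hC, h⟩ := exists_tailTerm_norm_bounds n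
    refine ⟨c, C, hc, hC, fun f g hg hgm => ?_⟩
    simp only [show coeff f = fun k j => fourierCoeff 0 f (k, j) from
      funext fun k => funext fun j => coeff_eq_fourierCoeff f k j]
    exact h f g (Lp.memLp f) hg hgm
  · have hf := hψ.memLp.coeFn_toLp
    have hs : spectrumCoeff ψ = fun k j => fourierCoeff 0 (fun p => ψ p.1 p.2) (k, j) :=
      funext fun k => funext fun j => spectrumCoeff_eq hψ k j
    -- The coefficients depend only on the `L²` class, so the characterization of `W^n` transfers to
    -- the power spectrum.
    have hc : coeff (hψ.memLp.toLp _) = spectrumCoeff ψ := by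
      rw [hs]
      ext k j
      rw [coeff_eq_fourierCoeff, fourierCoeff_congr hf]
    refine ⟨hψ.memLp.toLp _, hf, fun n => ?_⟩
    have hmem := mem_spaceW_iff_summable (Nat.cast_nonneg (α := ℝ) n) (hψ.memLp.toLp _)
    rw [hc] at hmem
    refine ⟨hmem, fun h => summable_sq_of_weightedTerm (hmem.1 h), ?_⟩
    rw [hs]
    exact summable_tailTerm_iff hψ.memLp n
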